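/- Let $\mathcal H$ and $\mathcal G$ be complex Hilbert spaces (for example $\mathcal G=\mathcal H$), and let $H=(H_1,\dots,H_n)$ be a family of strongly commuting self-adjoint (possibly unbounded) operators on $\mathcal H$ with joint spectral measure $E$ on $\mathbb R^n$. Put $\mathcal N=\{1,\dots,n\}$, and let $D(H)=D(H_1)\cap\dots\cap D(H_n)$ carry the graph topology of the family. For $\emptyset\ne a\subset\mathcal N$ write $x_a\cdot H_a=\sum_{j\in a}x_jH_j$ for $x_a\in\mathbb R^{a}$, and for $\lambda\in\mathbb R^n$, $\mu\in(0,1)^n$ write $$\operatorname{Im}R_a(\lambda+i\mu)=\prod_{j\in a}\operatorname{Im}\,(H_j-\lambda_j-i\mu_j)^{-1},\qquad \operatorname{Im}B=\tfrac1{2i}(B-B^*).$$ For $K\subset\mathbb R^n$ let $K(a)=\{x\in\mathbb R^n : \exists\, y\in K,\ x_j=y_j \text{ for all } j\in a\}$. Let $J\subset\mathbb R^n$ be open and let $T:D(H)\to\mathcal G$ be linear and continuous. $T$ is called locally $H$-smooth on $J$ if for every $\emptyset\neq a\subset\mathcal N$ and every compact $K\subset J$ there is a constant $C_{K(a)}<\infty$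 such that $$\int_{\mathbb R^{a}}\|T e^{i x_a\cdot H_a}E(K(a))f\|^2\,dx_a\le C_{K(a)}\|f\|^2$$ for all $f\in\mathcal H$ with $E(K(a))f\in D(H)$ (this is every $f\in\mathcal H$ when $a=\mathcal N$, and always includes every $f\in D(H)$). For a bounded Borel set $B$ the operator $TE(B):\mathcal H\to\mathcal G$ is bounded, and $\|T\operatorname{Im}R_a(\lambda+i\mu)T^*\|\in[0,\infty]$ denotes $\sup_B\|TE(B)\operatorname{Im}R_a(\lambda+i\mu)(TE(B))^*\|$ over all bounded Borel sets $B\subset\mathbb R^n$, that is, the norm of the possibly unbounded operator $T\operatorname{Im}R_a(\lambda+i\mu)T^*$. Consider the condition $$\text{(K)}\qquad \sup_{\lambda\in K,\ \mu\in(0,1)^n}\|T\operatorname{Im}R_a(\lambda+i\mu)T^*\|<\infty\quad\text{for every }\emptyset\neq a\subset\mathcal N\text{ and every compact }K\subset J.$$ **Theorem.** (1) If (K) holds, then $T$ is locally $H$-smooth on $J$. (2) Suppose that $T$ is $H_j$-bounded for every $j\in\mathcal N$, i.e. for every $j$ there is a constant $C_j$ with $\|Tu\|\le C_j(\|u\|+\|H_ju\|)$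 for all $u\in D(H)$ (this is automatic if $n=1$ or if $T$ is bounded on $\mathcal H$). Then $T$ is locally $H$-smooth on $J$ if and only if (K) holds. -/

import Mathlib

open MeasureTheory
open scoped ENNReal NNReal InnerProductSpace

noncomputable section

/-- A projection-valued measure on `X` acting in the Hilbert space `V`: a strongly countably
additive map from the measurable sets to the orthogonal projections, multiplicative on
intersections.  (The normalisation `E(X) = 1` is not part of this structure; it is part of
`IsJointSpectralMeasure`.) -/
structure ProjectionValuedMeasure (X : Type*) [MeasurableSpace X] (V : Type*)
    [NormedAddCommGroup V] [InnerProductSpace ℂ V] [CompleteSpace V] where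
  /-- The projection `E(S)`. -/
  proj : Set X → V →L[ℂ] V
  isStarProjection : ∀ S : Set X, MeasurableSet S → IsStarProjection (proj S)
  proj_inter : ∀ S S' : Set X, MeasurableSet S → MeasurableSet S' →
    proj (S ∩ S') = proj S * proj S'
  hasSum_proj : ∀ S : ℕ → Set X, (∀ i, MeasurableSet (S i)) →
    Pairwise (Function.onFun Disjoint S) → ∀ f : V, HasSum (fun i => proj (S i) f)
      (proj (⋃ i, S i) f)

namespace ProjectionValuedMeasure

variable {X : Type*} [MeasurableSpace X] {V : Type*}
  [NormedAddCommGroup V] [InnerProductSpace ℂ V] [CompleteSpace V]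

instance : Zero (ProjectionValuedMeasure X V) where
  zero :=
    { proj := fun _ => 0
      isStarProjection := fun _ _ => IsStarProjection.zero _
      proj_inter := fun _ _ _ _ => by simp
      hasSum_proj := fun _ _ _ f => by simp }

theorem proj_empty (E : ProjectionValuedMeasure X V) : E.proj ∅ = 0 := by
  ext f
  have h := E.hasSum_proj (fun _ => ∅) (fun _ => MeasurableSet.empty)
    (fun _ _ _ => by simp [Function.onFun]) f
  have h1 := h.summable.tendsto_atTop_zero
  simpa using tendsto_nhds_unique tendsto_const_nhds h1

theorem re_inner_proj_nonneg (E : ProjectionValuedMeasure X V) {S : Set X}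
    (hS : MeasurableSet S) (f : V) : 0 ≤ (⟪f, E.proj S f⟫_ℂ).re := by
  have h := E.isStarProjection S hS
  have h1 : E.proj S f = E.proj S (E.proj S f) := by
    conv_lhs => rw [← h.isIdempotentElem.eq]
    rfl
  have h2 : ⟪f, E.proj S f⟫_ℂ = ⟪E.proj S f, E.proj S f⟫_ℂ := by
    conv_lhs => rw [h1]
    exact (h.isSelfAdjoint.isSymmetric f (E.proj S f)).symm
  rw [h2]
  exact inner_self_nonneg (𝕜 := ℂ)

/-- The scalar spectral measure `S ↦ ⟨f, E(S) f⟩` of a vector `f`. -/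
def scalarMeasure (E : ProjectionValuedMeasure X V) (f : V) : Measure X :=
  Measure.ofMeasurable (fun S _ => ENNReal.ofReal (⟪f, E.proj S f⟫_ℂ).re)
    (by simp [E.proj_empty])
    (by
      intro S hS hd
      have h := (E.hasSum_proj S hS hd f).mapL (Complex.reCLM ∘L
        (innerSL ℂ f).restrictScalars ℝ)
      have h' : HasSum (fun i => (⟪f, E.proj (S i) f⟫_ℂ).re)
          (⟪f, E.proj (⋃ i, S i) f⟫_ℂ).re := by simpa using h
      rw [← h'.tsum_eq]
      exact ENNReal.ofReal_tsum_of_nonneg (fun i => E.re_inner_proj_nonneg (hS i) f) h'.summable)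

open Classical in
/-- The bounded operator `∫ φ dE` for a bounded measurable function `φ`, i.e. the unique bounded
operator `A` with `⟨f, A f⟩ = ∫ φ(x) d⟨f, E(x) f⟩` for every `f`. -/
def integral (E : ProjectionValuedMeasure X V) (φ : X → ℂ) : V →L[ℂ] V :=
  if h : ∃ A : V →L[ℂ] V, ∀ f : V, ⟪f, A f⟫_ℂ = ∫ x, φ x ∂(E.scalarMeasure f)
  then h.choose else 0

end ProjectionValuedMeasure

open Classical in
/-- The resolvent `(A - z)⁻¹`: the unique bounded operator that is a two-sided inverse of
`A - z : D(A) → V`, whenever `z` lies in the resolvent set of `A`. -/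
def LinearPMap.resolventOp {V : Type*} [NormedAddCommGroup V] [InnerProductSpace ℂ V]
    (A : V →ₗ.[ℂ] V) (z : ℂ) : V →L[ℂ] V :=
  if h : ∃ R : V →L[ℂ] V,
      (∀ f : V, ∃ hf : R f ∈ A.domain, A ⟨R f, hf⟩ - z • R f = f) ∧
      (∀ u : A.domain, R (A u - z • (u : V)) = u)
  then h.choose else 0

namespace KatoSmooth

variable {V : Type*} [NormedAddCommGroup V] [InnerProductSpace ℂ V] [CompleteSpace V]
variable {G : Type*} [NormedAddCommGroup G] [InnerProductSpace ℂ G] [CompleteSpace G]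
variable {n : ℕ}

/-- Strong commutativity of a family of self-adjoint operators: all resolvents commute. -/
def StronglyCommuting (H : Fin n → V →ₗ.[ℂ] V) : Prop :=
  ∀ i j : Fin n, ∀ z w : ℂ, z.im ≠ 0 → w.im ≠ 0 →
    Commute ((H i).resolventOp z) ((H j).resolventOp w)

/-- `E` is the joint spectral measure of the family `H`: it is normalised, and
`H_j = ∫ x_j dE(x)` for every `j`, with equality of domains. -/
structure IsJointSpectralMeasure (H : Fin n → V →ₗ.[ℂ] V)
    (E : ProjectionValuedMeasure (Fin n → ℝ) V) : Prop where
  proj_univ : E.proj Set.univ = 1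
  mem_domain_iff : ∀ (j : Fin n) (f : V),
    f ∈ (H j).domain ↔ ∫⁻ x, ‖x j‖ₑ ^ 2 ∂(E.scalarMeasure f) < ⊤
  inner_apply : ∀ (j : Fin n) (u : (H j).domain),
    ⟪(u : V), H j u⟫_ℂ = ((∫ x, x j ∂(E.scalarMeasure (u : V)) : ℝ) : ℂ)

open Classical in
/-- The joint spectral measure of a family of strongly commuting self-adjoint operators (it exists
and is unique by the spectral theorem; for other families the value is irrelevant). -/
def jointSpectralMeasure (H : Fin n → V →ₗ.[ℂ] V) :
    ProjectionValuedMeasure (Fin n → ℝ) V :=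
  if h : ∃ E, IsJointSpectralMeasure H E then h.choose else 0

/-- `e^{i x_a · H_a}` for `x_a ∈ ℝ^a`. -/
def expI (H : Fin n → V →ₗ.[ℂ] V) (a : Finset (Fin n)) (x : a → ℝ) : V →L[ℂ] V :=
  (jointSpectralMeasure H).integral
    fun σ => Complex.exp (Complex.I * ((∑ j : a, x j * σ j : ℝ) : ℂ))

/-- `Im R_a(λ + iμ) = ∏_{j ∈ a} Im (H_j - λ_j - iμ_j)⁻¹`, with `Im B = (B - B*) / (2i)`; the
product is taken in the increasing order of the indices. -/
def imResolvent (H : Fin n → V →ₗ.[ℂ] V) (a : Finset (Fin n)) (lam mu : Fin n → ℝ) :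
    V →L[ℂ] V :=
  ((a.sort (· ≤ ·)).map fun j =>
    ((imaginaryPart ((H j).resolventOp ((lam j : ℂ) + Complex.I * (mu j : ℂ))) :
      selfAdjoint (V →L[ℂ] V)) : V →L[ℂ] V)).prod

/-- The set `K(a)`: all `x` such that some point of `K` has the same `a`-coordinates as `x`. -/
def cyl (K : Set (Fin n → ℝ)) (a : Finset (Fin n)) : Set (Fin n → ℝ) :=
  {x | ∃ y ∈ K, ∀ j ∈ a, x j = y j}

/-- `D(H) = D(H_1) ∩ ⋯ ∩ D(H_n)`. -/
def jointDomain (H : Fin n → V →ₗ.[ℂ] V) : Submodule ℂ V := ⨅ j, (H j).domain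

/-- `H_j u` for `u ∈ D(H)`. -/
def component (H : Fin n → V →ₗ.[ℂ] V) (j : Fin n) (u : jointDomain H) : V :=
  H j ⟨u, (Submodule.mem_iInf _).1 u.2 j⟩

/-- `T : D(H) → G` is continuous for the graph topology of `D(H)`. -/
def GraphContinuous (H : Fin n → V →ₗ.[ℂ] V) (T : jointDomain H →ₗ[ℂ] G) : Prop :=
  ∃ C : ℝ, ∀ u : jointDomain H, ‖T u‖ ≤ C * (‖(u : V)‖ + ∑ j, ‖component H j u‖)

/-- `T : D(H) → G` is `H_j`-bounded, i.e. continuous for the graph norm of the single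
operator `H_j`. -/
def RelativelyBounded (H : Fin n → V →ₗ.[ℂ] V) (T : jointDomain H →ₗ[ℂ] G) (j : Fin n) : Prop :=
  ∃ C : ℝ, ∀ u : jointDomain H, ‖T u‖ ≤ C * (‖(u : V)‖ + ‖component H j u‖)

open Classical in
/-- `T w`, which is only of interest for `w ∈ D(H)`. -/
def applyOn (H : Fin n → V →ₗ.[ℂ] V) (T : jointDomain H →ₗ[ℂ] G) (w : V) : G :=
  if hw : w ∈ jointDomain H then T ⟨w, hw⟩ else 0

/-- `T : D(H) → G` is locally `H`-smooth on `J`: for every nonempty `a` and every compact `K ⊆ J`,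
`∫ ‖T e^{i x_a · H_a} E(K(a)) f‖² dx_a ≤ C ‖f‖²` for all `f` for which `E(K(a)) f ∈ D(H)`
(every `f` if `a = {1, …, n}`; in general a dense set of `f`, as it contains `D(H)`).
The operator `e^{i x_a · H_a}` maps `D(H)` to itself. -/
def LocallySmooth (H : Fin n → V →ₗ.[ℂ] V) (T : jointDomain H →ₗ[ℂ] G)
    (J : Set (Fin n → ℝ)) : Prop :=
  ∀ a : Finset (Fin n), a.Nonempty → ∀ K : Set (Fin n → ℝ), IsCompact K → K ⊆ J →
    ∃ C : ℝ≥0, ∀ f : V, (jointSpectralMeasure H).proj (cyl K a) f ∈ jointDomain H →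
      ∫⁻ x : a → ℝ,
        ‖applyOn H T (expI H a x ((jointSpectralMeasure H).proj (cyl K a) f))‖ₑ ^ 2
      ≤ C * ‖f‖ₑ ^ 2

open Classical in
/-- The operator `T E(B) : V → G`, for a bounded Borel set `B`. It is everywhere defined and
bounded if `T` is continuous on `D(H)`, since `E(B)` maps `V` continuously to `D(H)`. -/
def truncate (H : Fin n → V →ₗ.[ℂ] V) (T : jointDomain H →ₗ[ℂ] G) (B : Set (Fin n → ℝ)) :
    V →L[ℂ] G :=
  if h : ∃ S : V →L[ℂ] G, ∀ f : V,
      ∃ hf : (jointSpectralMeasure H).proj B f ∈ jointDomain H, S f = T ⟨_, hf⟩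
  then h.choose else 0

/-- The norm `‖T Im R_a(λ + iμ) T*‖ ∈ [0, ∞]` of the (possibly unbounded) operator
`T Im R_a(λ + iμ) T*`, which is the increasing limit of the bounded operators
`T E(B) Im R_a(λ + iμ) (T E(B))*` over the bounded Borel sets `B ⊆ ℝⁿ`. -/
def katoNorm (H : Fin n → V →ₗ.[ℂ] V) (T : jointDomain H →ₗ[ℂ] G) (a : Finset (Fin n))
    (lam mu : Fin n → ℝ) : ℝ≥0∞ :=
  ⨆ (B : Set (Fin n → ℝ)) (_ : Bornology.IsBounded B) (_ : MeasurableSet B),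
    ‖truncate H T B ∘L imResolvent H a lam mu ∘L
      ContinuousLinearMap.adjoint (truncate H T B)‖ₑ

/-- For every nonempty `a` and every compact `K ⊆ J`,
`sup_{λ ∈ K, μ ∈ (0,1)ⁿ} ‖T Im R_a(λ + iμ) T*‖ < ∞`. -/
def KatoCondition (H : Fin n → V →ₗ.[ℂ] V) (T : jointDomain H →ₗ[ℂ] G)
    (J : Set (Fin n → ℝ)) : Prop :=
  ∀ a : Finset (Fin n), a.Nonempty → ∀ K : Set (Fin n → ℝ), IsCompact K → K ⊆ J →
    (⨆ (lam ∈ K) (mu : Fin n → ℝ) (_ : ∀ j, mu j ∈ Set.Ioo (0 : ℝ) 1),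
      katoNorm H T a lam mu) < ⊤

end KatoSmooth

end

open Filter Topology

set_option linter.unusedSectionVars false

/-! For a bounded Borel set `B` put `A = T E(B)`, and for `h ∈ G` let `μ_h` be the scalar spectral
measure of `A* h`. Smoothness and (K) are both compared with a third condition,
`LocallyBoundedDensity`: over compact `K ⊆ J`, the marginal of `μ_h` on `ℝ^a` has Lebesgue density
at most `C ‖h‖²`, with `C` independent of `B` and `h`.

(K) implies bounded density. Since `Im R_a` is the integral of a product of Poisson kernels, `‖A Im
R_a A*‖` is the best constant in a bound for the Poisson integrals of the `μ_h`. A Poisson kernel of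
width `r` is at least `1/(2r)` within distance `r` of its centre, so (K) bounds the mass of small
cubes by a multiple of their volume. Besicovitch differentiation finishes
(`LocallyBoundedDensity.of_katoCondition`).

Bounded density implies smoothness. On a box of half-side `R` the phase is replaced by a step
function on a grid of side `π/R`. Its exponentials are orthogonal on that box, and by duality the
density bound controls each Parseval coefficient. The resulting bound does not depend on `R`, and
Fatou's lemma removes first the box and the grid, then `B` (`LocallyBoundedDensity.locallySmooth`).

Smoothness implies bounded density. On vectors `E(S) A* h`, with `S` above a cube of half-side `r`,
the pairing of `A e^{i x·H} E(S) A* h` with `h` is the Fourier transform of `μ_h` on `S`. It is at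
least half the mass for `|x| ≲ 1/r`, and the smoothness integral then forces the mass to be
`O(r^|a|)` (`LocallyBoundedDensity.of_locallySmooth`).

Bounded density implies (K) under relative boundedness. Each Poisson kernel is split into a near and
a far part. A product with a nonempty set `c` of near factors is controlled by the density on `ℝ^c`
and the bounded far factors. If all factors are far, the density says nothing, and the bound on `T
(H_j + i)⁻¹` takes over (`LocallyBoundedDensity.katoCondition`).

All this presupposes a joint spectral measure. The last parts construct it from the commuting
resolvents at `i` through Gelfand duality and the Riesz–Markov theorem. -/

/-! ### Bounded measurable functions and polarisation -/

/-- A bounded measurable complex-valued function. -/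
structure BoundedMeasurable {X : Type*} [MeasurableSpace X] (φ : X → ℂ) : Prop where
  measurable : Measurable φ
  bounded : ∃ M : ℝ, ∀ x, ‖φ x‖ ≤ M

namespace BoundedMeasurable

variable {X : Type*} [MeasurableSpace X] {φ ψ : X → ℂ}

theorem const (c : ℂ) : BoundedMeasurable (fun _ : X => c) :=
  ⟨measurable_const, ‖c‖, fun _ => le_rfl⟩

theorem add (hφ : BoundedMeasurable φ) (hψ : BoundedMeasurable ψ) :
    BoundedMeasurable (fun x => φ x + ψ x) := by
  obtain ⟨M, hM⟩ := hφ.bounded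
  obtain ⟨N, hN⟩ := hψ.bounded
  exact ⟨hφ.measurable.add hψ.measurable, M + N,
    fun x => (norm_add_le _ _).trans (add_le_add (hM x) (hN x))⟩

theorem mul (hφ : BoundedMeasurable φ) (hψ : BoundedMeasurable ψ) :
    BoundedMeasurable (fun x => φ x * ψ x) := by
  obtain ⟨M, hM⟩ := hφ.bounded
  obtain ⟨N, hN⟩ := hψ.bounded
  exact ⟨hφ.measurable.mul hψ.measurable, M * N, fun x => by
    rw [norm_mul]
    exact mul_le_mul (hM x) (hN x) (norm_nonneg _) ((norm_nonneg _).trans (hM x))⟩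

theorem const_mul (c : ℂ) (hφ : BoundedMeasurable φ) : BoundedMeasurable (fun x => c * φ x) :=
  (const c).mul hφ

theorem neg (hφ : BoundedMeasurable φ) : BoundedMeasurable (fun x => -φ x) := by
  simpa using hφ.const_mul (-1)

theorem sub (hφ : BoundedMeasurable φ) (hψ : BoundedMeasurable ψ) :
    BoundedMeasurable (fun x => φ x - ψ x) := by
  simpa [sub_eq_add_neg] using hφ.add hψ.neg

theorem star (hφ : BoundedMeasurable φ) :
    BoundedMeasurable (fun x => (starRingEnd ℂ) (φ x)) := by
  obtain ⟨M, hM⟩ := hφ.bounded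
  exact ⟨Complex.continuous_conj.measurable.comp hφ.measurable, M, fun x => by simpa using hM x⟩

theorem indicator (hφ : BoundedMeasurable φ) {S : Set X} (hS : MeasurableSet S) :
    BoundedMeasurable (S.indicator φ) := by
  obtain ⟨M, hM⟩ := hφ.bounded
  exact ⟨hφ.measurable.indicator hS, M, fun x => (norm_indicator_le_norm_self _ _).trans (hM x)⟩

theorem indicator_one {S : Set X} (hS : MeasurableSet S) :
    BoundedMeasurable (S.indicator (fun _ => (1 : ℂ))) :=
  (const 1).indicator hS

theorem finset_sum {ι : Type*} (s : Finset ι) {φ : ι → X → ℂ}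
    (h : ∀ i ∈ s, BoundedMeasurable (φ i)) : BoundedMeasurable (fun x => ∑ i ∈ s, φ i x) := by
  classical
  induction s using Finset.induction_on with
  | empty => simpa using const (X := X) 0
  | insert i s hi ih =>
    simp only [Finset.sum_insert hi]
    exact (h i (Finset.mem_insert_self _ _)).add
      (ih fun j hj => h j (Finset.mem_insert_of_mem hj))

theorem finset_prod {ι : Type*} (s : Finset ι) {φ : ι → X → ℂ}
    (h : ∀ i ∈ s, BoundedMeasurable (φ i)) : BoundedMeasurable (fun x => ∏ i ∈ s, φ i x) := by
  classical
  induction s using Finset.induction_on with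
  | empty => simpa using const (X := X) 1
  | insert i s hi ih =>
    simp only [Finset.prod_insert hi]
    exact (h i (Finset.mem_insert_self _ _)).mul
      (ih fun j hj => h j (Finset.mem_insert_of_mem hj))

theorem simpleFunc (s : SimpleFunc X ℂ) : BoundedMeasurable s := by
  refine ⟨s.measurable, ∑ c ∈ s.range, ‖c‖, fun x => ?_⟩
  exact Finset.single_le_sum (f := fun c : ℂ => ‖c‖) (fun _ _ => norm_nonneg _)
    (s.mem_range_self x)

theorem integrable (hφ : BoundedMeasurable φ) (μ : Measure X) [IsFiniteMeasure μ] :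
    Integrable φ μ := by
  obtain ⟨M, hM⟩ := hφ.bounded
  exact Integrable.of_bound hφ.measurable.aestronglyMeasurable M (Eventually.of_forall hM)

theorem integrable_norm_sq (hφ : BoundedMeasurable φ) (μ : Measure X) [IsFiniteMeasure μ] :
    Integrable (fun x => ‖φ x‖ ^ 2) μ := by
  obtain ⟨M, hM⟩ := hφ.bounded
  refine Integrable.of_bound (hφ.measurable.norm.pow_const 2).aestronglyMeasurable (M ^ 2)
    (Eventually.of_forall fun x => ?_)
  rw [Real.norm_of_nonneg (by positivity)]
  exact pow_le_pow_left₀ (norm_nonneg _) (hM x) 2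

end BoundedMeasurable

/-- Polarisation of an identity `‖v + c w‖² = ∫ ‖φ + c ψ‖²`. -/
theorem BoundedMeasurable.inner_eq_integral {X : Type*} [MeasurableSpace X] {φ ψ : X → ℂ}
    (hφ : BoundedMeasurable φ) (hψ : BoundedMeasurable ψ) {V : Type*} [NormedAddCommGroup V]
    [InnerProductSpace ℂ V] {μ : Measure X} [IsFiniteMeasure μ] {v w : V}
    (hc : ∀ c : ℂ, ‖v + c • w‖ ^ 2 = ∫ x, ‖φ x + c * ψ x‖ ^ 2 ∂μ) :
    ⟪v, w⟫_ℂ = ∫ x, (starRingEnd ℂ) (φ x) * ψ x ∂μ := by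
  have hi : ∀ c : ℂ, Integrable (fun x => ((‖φ x + c * ψ x‖ : ℂ)) ^ 2) μ := by
    intro c
    have := ((hφ.add (hψ.const_mul c)).integrable_norm_sq μ).ofReal (𝕜 := ℂ)
    simpa using this
  have hc' : ∀ c : ℂ, (‖v + c • w‖ : ℂ) ^ 2 = ∫ x, (‖φ x + c * ψ x‖ : ℂ) ^ 2 ∂μ := by
    intro c
    have := congrArg (fun r : ℝ => (r : ℂ)) (hc c)
    simp only [← integral_complex_ofReal] at this
    simpa using this
  have key : ∀ x, (starRingEnd ℂ) (φ x) * ψ x =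
      ((‖φ x + 1 * ψ x‖ : ℂ) ^ 2 - (‖φ x + (-1) * ψ x‖ : ℂ) ^ 2 +
        ((‖φ x + (-Complex.I) * ψ x‖ : ℂ) ^ 2 -
        (‖φ x + Complex.I * ψ x‖ : ℂ) ^ 2) * Complex.I) / 4 := by
    intro x
    have := inner_eq_sum_norm_sq_div_four (𝕜 := ℂ) (φ x) (ψ x)
    simp only [RCLike.inner_apply, RCLike.I_to_complex, smul_eq_mul] at this
    rw [mul_comm, this]
    simp [sub_eq_add_neg]
  simp_rw [key]
  have h1 := MeasureTheory.integral_sub (hi 1) (hi (-1))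
  have h2 := MeasureTheory.integral_sub (hi (-Complex.I)) (hi Complex.I)
  have h3 := MeasureTheory.integral_add ((hi 1).sub (hi (-1)))
    (((hi (-Complex.I)).sub (hi Complex.I)).mul_const Complex.I)
  simp only [Pi.sub_apply] at h3
  rw [MeasureTheory.integral_div, h3, MeasureTheory.integral_mul_const, h1, h2, ← hc', ← hc',
    ← hc', ← hc', inner_eq_sum_norm_sq_div_four (𝕜 := ℂ)]
  simp [sub_eq_add_neg]

/-- Two bounded operators on a complex Hilbert space with the same quadratic form agree. -/
theorem ContinuousLinearMap.eq_of_inner_self_eq {V : Type*} [NormedAddCommGroup V]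
    [InnerProductSpace ℂ V] {A B : V →L[ℂ] V} (h : ∀ f, ⟪f, A f⟫_ℂ = ⟪f, B f⟫_ℂ) : A = B := by
  have h' := (ext_inner_map (A : V →ₗ[ℂ] V) (B : V →ₗ[ℂ] V)).1 fun f => by
    rw [← inner_conj_symm, ← inner_conj_symm ((B : V →ₗ[ℂ] V) f)]
    exact congrArg _ (h f)
  exact ContinuousLinearMap.coe_injective h'

/-! ### Bounded functional calculus of a projection-valued measure -/

namespace ProjectionValuedMeasure

variable {X : Type*} [MeasurableSpace X] {V : Type*}
  [NormedAddCommGroup V] [InnerProductSpace ℂ V] [CompleteSpace V]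
  (E : ProjectionValuedMeasure X V)

theorem scalarMeasure_apply (f : V) {S : Set X} (hS : MeasurableSet S) :
    E.scalarMeasure f S = ENNReal.ofReal (⟪f, E.proj S f⟫_ℂ).re :=
  Measure.ofMeasurable_apply S hS

theorem inner_proj {S : Set X} (hS : MeasurableSet S) (f : V) :
    ⟪f, E.proj S f⟫_ℂ = ((‖E.proj S f‖ ^ 2 : ℝ) : ℂ) := by
  have h := E.isStarProjection S hS
  have h1 : E.proj S f = E.proj S (E.proj S f) := by
    conv_lhs => rw [← h.isIdempotentElem.eq]
    rfl
  have h2 : ⟪f, E.proj S f⟫_ℂ = ⟪E.proj S f, E.proj S f⟫_ℂ := by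
    conv_lhs => rw [h1]
    exact (h.isSelfAdjoint.isSymmetric f (E.proj S f)).symm
  rw [h2, inner_self_eq_norm_sq_to_K]
  norm_cast

theorem norm_proj_le {S : Set X} (hS : MeasurableSet S) (f : V) : ‖E.proj S f‖ ≤ ‖f‖ := by
  have h1 := congrArg Complex.re (E.inner_proj hS f)
  rw [Complex.ofReal_re] at h1
  have h2 : (⟪f, E.proj S f⟫_ℂ).re ≤ ‖f‖ * ‖E.proj S f‖ := re_inner_le_norm (𝕜 := ℂ) _ _
  rw [h1, pow_two] at h2
  rcases (norm_nonneg (E.proj S f)).eq_or_lt with h0 | h0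
  · rw [← h0]; exact norm_nonneg _
  · exact le_of_mul_le_mul_right h2 h0

theorem scalarMeasure_eq_norm_sq (f : V) {S : Set X} (hS : MeasurableSet S) :
    E.scalarMeasure f S = ENNReal.ofReal (‖E.proj S f‖ ^ 2) := by
  rw [E.scalarMeasure_apply f hS, E.inner_proj hS, Complex.ofReal_re]

theorem scalarMeasure_eq_enorm_sq (f : V) {S : Set X} (hS : MeasurableSet S) :
    E.scalarMeasure f S = ‖E.proj S f‖ₑ ^ 2 := by
  rw [E.scalarMeasure_eq_norm_sq f hS, ENNReal.ofReal_pow (norm_nonneg _), ofReal_norm]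

instance isFiniteMeasure_scalarMeasure (f : V) : IsFiniteMeasure (E.scalarMeasure f) :=
  ⟨by rw [E.scalarMeasure_eq_norm_sq f MeasurableSet.univ]; exact ENNReal.ofReal_lt_top⟩

theorem scalarMeasure_le (f : V) (S : Set X) : E.scalarMeasure f S ≤ ‖f‖ₑ ^ 2 := by
  refine (measure_mono (Set.subset_univ S)).trans ?_
  rw [E.scalarMeasure_eq_enorm_sq f MeasurableSet.univ]
  gcongr
  exact enorm_le_iff_norm_le.2 (E.norm_proj_le MeasurableSet.univ f)

theorem real_scalarMeasure (f : V) {S : Set X} (hS : MeasurableSet S) :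
    (E.scalarMeasure f).real S = ‖E.proj S f‖ ^ 2 := by
  rw [measureReal_def, E.scalarMeasure_eq_norm_sq f hS, ENNReal.toReal_ofReal (by positivity)]

/-- The operator `∑ c • E(s = c)` of a simple function `s`. -/
noncomputable def simpleOp (s : SimpleFunc X ℂ) : V →L[ℂ] V := ∑ c ∈ s.range, c • E.proj (s ⁻¹' {c})

theorem inner_simpleOp (s : SimpleFunc X ℂ) (f : V) :
    ⟪f, E.simpleOp s f⟫_ℂ = ∫ x, s x ∂(E.scalarMeasure f) := by
  rw [SimpleFunc.integral_eq_sum _ ((BoundedMeasurable.simpleFunc s).integrable _)]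
  simp only [simpleOp, sum_apply, inner_sum, smul_apply,
    inner_smul_right]
  refine Finset.sum_congr rfl fun c _ => ?_
  rw [E.inner_proj (s.measurableSet_fiber c), E.real_scalarMeasure f (s.measurableSet_fiber c),
    Complex.real_smul, mul_comm]

theorem simpleOp_sub (s t : SimpleFunc X ℂ) : E.simpleOp (s - t) = E.simpleOp s - E.simpleOp t := by
  refine ContinuousLinearMap.eq_of_inner_self_eq fun f => ?_
  rw [sub_apply, inner_sub_right, inner_simpleOp, inner_simpleOp,
    inner_simpleOp, ← integral_sub ((BoundedMeasurable.simpleFunc s).integrable _)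
      ((BoundedMeasurable.simpleFunc t).integrable _)]
  rfl

theorem proj_apply_proj {S S' : Set X} (hS : MeasurableSet S) (hS' : MeasurableSet S') (f : V) :
    E.proj S (E.proj S' f) = E.proj (S ∩ S') f := by
  rw [E.proj_inter S S' hS hS']; rfl

theorem inner_proj_proj {S S' : Set X} (hS : MeasurableSet S) (hS' : MeasurableSet S') (f g : V) :
    ⟪E.proj S f, E.proj S' g⟫_ℂ = ⟪f, E.proj (S ∩ S') g⟫_ℂ := by
  rw [← E.proj_apply_proj hS hS']
  exact (E.isStarProjection S hS).isSelfAdjoint.isSymmetric f _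

/-- Distinct fibres of `s` are disjoint, so the cross terms vanish. This `L²` isometry is what
allows passage to limits of simple functions. -/
theorem norm_simpleOp_sq (s : SimpleFunc X ℂ) (f : V) :
    ‖E.simpleOp s f‖ ^ 2 = ∫ x, ‖s x‖ ^ 2 ∂(E.scalarMeasure f) := by
  have h1 : ∫ x, ‖s x‖ ^ 2 ∂(E.scalarMeasure f) =
      ∫ x, (s.map fun c => ‖c‖ ^ 2) x ∂(E.scalarMeasure f) := rfl
  have hi : Integrable s (E.scalarMeasure f) := (BoundedMeasurable.simpleFunc s).integrable _
  rw [h1, ← SimpleFunc.integral_eq_integral _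
    ((BoundedMeasurable.simpleFunc s).integrable_norm_sq (E.scalarMeasure f)),
    SimpleFunc.map_integral _ _ hi (by simp)]
  have h2 : ((‖E.simpleOp s f‖ ^ 2 : ℝ) : ℂ) = ⟪E.simpleOp s f, E.simpleOp s f⟫_ℂ := by
    rw [inner_self_eq_norm_sq_to_K]; norm_cast
  have h3 : ⟪E.simpleOp s f, E.simpleOp s f⟫_ℂ =
      ∑ c ∈ s.range, (((E.scalarMeasure f).real (s ⁻¹' {c}) * ‖c‖ ^ 2 : ℝ) : ℂ) := by
    simp only [simpleOp, sum_apply, inner_sum, sum_inner,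
      smul_apply, inner_smul_right, inner_smul_left]
    refine Finset.sum_congr rfl fun c hc => ?_
    rw [Finset.sum_eq_single c]
    · rw [E.inner_proj_proj (s.measurableSet_fiber c) (s.measurableSet_fiber c), Set.inter_self,
        E.inner_proj (s.measurableSet_fiber c), E.real_scalarMeasure f (s.measurableSet_fiber c),
        ← mul_assoc, Complex.mul_conj, Complex.normSq_eq_norm_sq]
      push_cast; ring
    · intro d _ hd
      rw [E.inner_proj_proj (s.measurableSet_fiber d) (s.measurableSet_fiber c)]
      have : s ⁻¹' {d} ∩ s ⁻¹' {c} = ∅ := by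
        ext x; simp only [Set.mem_inter_iff, Set.mem_preimage, Set.mem_singleton_iff,
          Set.mem_empty_iff_false, iff_false, not_and]
        rintro rfl h; exact hd h
      rw [this, E.proj_empty]; simp
    · intro h; exact absurd hc h
  have h4 := h2.trans h3
  rw [← Complex.ofReal_sum] at h4
  exact Complex.ofReal_injective h4

/-- By the isometry, uniformly bounded simple approximations of `φ` give strongly Cauchy operators,
and the limit is bounded by the uniform boundedness principle. The norm identity is carried along
because the definition of `integral` only fixes the quadratic form. -/
theorem exists_integral {φ : X → ℂ} (hφ : BoundedMeasurable φ) :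
    ∃ A : V →L[ℂ] V, (∀ f, ⟪f, A f⟫_ℂ = ∫ x, φ x ∂(E.scalarMeasure f)) ∧
      ∀ f, ‖A f‖ ^ 2 = ∫ x, ‖φ x‖ ^ 2 ∂(E.scalarMeasure f) := by
  obtain ⟨M, hM⟩ := hφ.bounded
  have hsm := hφ.measurable.stronglyMeasurable
  let s : ℕ → SimpleFunc X ℂ := hsm.approxBounded |M|
  have hs : ∀ k x, ‖s k x‖ ≤ |M| := fun k x => hsm.norm_approxBounded_le (abs_nonneg M) k x
  have hlim : ∀ x, Tendsto (fun k => s k x) atTop (𝓝 (φ x)) := fun x =>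
    hsm.tendsto_approxBounded_of_norm_le ((hM x).trans (le_abs_self M))
  have hcauchy : ∀ f, CauchySeq fun k => E.simpleOp (s k) f := by
    intro f
    have hd : ∀ k l, ‖E.simpleOp (s k) f - E.simpleOp (s l) f‖ ^ 2 ≤
        2 * ∫ x, ‖s k x - φ x‖ ^ 2 ∂(E.scalarMeasure f) +
        2 * ∫ x, ‖s l x - φ x‖ ^ 2 ∂(E.scalarMeasure f) := by
      intro k l
      have hk := (((BoundedMeasurable.simpleFunc (s k)).sub hφ).integrable_norm_sq
        (E.scalarMeasure f)).const_mul 2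
      have hl := (((BoundedMeasurable.simpleFunc (s l)).sub hφ).integrable_norm_sq
        (E.scalarMeasure f)).const_mul 2
      have : ‖E.simpleOp (s k) f - E.simpleOp (s l) f‖ ^ 2 = ‖E.simpleOp (s k - s l) f‖ ^ 2 := by
        rw [simpleOp_sub]; rfl
      rw [this, norm_simpleOp_sq, ← integral_const_mul, ← integral_const_mul,
        ← integral_add hk hl]
      refine integral_mono ((BoundedMeasurable.simpleFunc _).integrable_norm_sq _) (hk.add hl)
        fun x => ?_
      have h1 : ‖s k x - s l x‖ ≤ ‖s k x - φ x‖ + ‖s l x - φ x‖ := by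
        have := norm_sub_le (s k x - φ x) (s l x - φ x)
        simpa using this
      simp only [SimpleFunc.coe_sub, Pi.sub_apply]
      nlinarith [sq_nonneg (‖s k x - φ x‖ - ‖s l x - φ x‖), norm_nonneg (s k x - s l x)]
    have hz : Tendsto (fun k => ∫ x, ‖s k x - φ x‖ ^ 2 ∂(E.scalarMeasure f)) atTop (𝓝 0) := by
      have : Tendsto (fun k => ∫ x, ‖s k x - φ x‖ ^ 2 ∂(E.scalarMeasure f)) atTop
          (𝓝 (∫ _, (0 : ℝ) ∂(E.scalarMeasure f))) := by
        refine tendsto_integral_of_dominated_convergence (fun _ => (2 * |M|) ^ 2) ?_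
          (integrable_const _) ?_ ?_
        · exact fun k => (((s k).measurable.sub hφ.measurable).norm.pow_const 2).aestronglyMeasurable
        · refine fun k => Eventually.of_forall fun x => ?_
          rw [Real.norm_of_nonneg (by positivity)]
          refine pow_le_pow_left₀ (norm_nonneg _) ((norm_sub_le _ _).trans ?_) 2
          linarith [hs k x, (hM x).trans (le_abs_self M)]
        · refine Eventually.of_forall fun x => ?_
          have := ((hlim x).sub_const (φ x)).norm.pow 2
          simpa using this
      simpa using this
    rw [Metric.cauchySeq_iff]
    intro ε hε
    have hev := hz.eventually (gt_mem_nhds (show (0 : ℝ) < ε ^ 2 / 4 by positivity))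
    obtain ⟨N, hN⟩ := eventually_atTop.1 hev
    refine ⟨N, fun k hk l hl => ?_⟩
    rw [dist_eq_norm]
    refine lt_of_pow_lt_pow_left₀ 2 hε.le ((hd k l).trans_lt ?_)
    linarith [hN k hk, hN l hl]
  choose L hL using fun f => cauchySeq_tendsto_of_complete (hcauchy f)
  let A : V →L[ℂ] V := continuousLinearMapOfTendsto (fun k => E.simpleOp (s k))
    (tendsto_pi_nhds.2 hL)
  have hA : ∀ f, Tendsto (fun k => E.simpleOp (s k) f) atTop (𝓝 (A f)) := hL
  refine ⟨A, fun f => ?_, fun f => ?_⟩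
  · refine tendsto_nhds_unique ((tendsto_const_nhds (x := f)).inner (𝕜 := ℂ) (hA f)) ?_
    simp only [inner_simpleOp]
    exact tendsto_integral_of_dominated_convergence (fun _ => |M|)
      (fun k => (s k).measurable.aestronglyMeasurable) (integrable_const _)
      (fun k => Eventually.of_forall (hs k)) (Eventually.of_forall hlim)
  · refine tendsto_nhds_unique ((hA f).norm.pow 2) ?_
    simp only [norm_simpleOp_sq]
    refine tendsto_integral_of_dominated_convergence (fun _ => |M| ^ 2)
      (fun k => ((s k).measurable.norm.pow_const 2).aestronglyMeasurable) (integrable_const _)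
      (fun k => Eventually.of_forall fun x => ?_) (Eventually.of_forall fun x => (hlim x).norm.pow 2)
    rw [Real.norm_of_nonneg (by positivity)]
    exact pow_le_pow_left₀ (norm_nonneg _) (hs k x) 2

variable {φ ψ : X → ℂ}

theorem inner_integral (hφ : BoundedMeasurable φ) (f : V) :
    ⟪f, E.integral φ f⟫_ℂ = ∫ x, φ x ∂(E.scalarMeasure f) := by
  have h : ∃ A : V →L[ℂ] V, ∀ f : V, ⟪f, A f⟫_ℂ = ∫ x, φ x ∂(E.scalarMeasure f) :=
    (E.exists_integral hφ).imp fun _ h => h.1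
  rw [integral, dif_pos h]
  exact h.choose_spec f

theorem integral_eq_of_inner (hφ : BoundedMeasurable φ) {A : V →L[ℂ] V}
    (hA : ∀ f, ⟪f, A f⟫_ℂ = ∫ x, φ x ∂(E.scalarMeasure f)) : E.integral φ = A :=
  ContinuousLinearMap.eq_of_inner_self_eq fun f => by rw [E.inner_integral hφ, hA]

theorem norm_integral_sq (hφ : BoundedMeasurable φ) (f : V) :
    ‖E.integral φ f‖ ^ 2 = ∫ x, ‖φ x‖ ^ 2 ∂(E.scalarMeasure f) := by
  obtain ⟨A, hA, hA'⟩ := E.exists_integral hφ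
  rw [E.integral_eq_of_inner hφ hA, hA']

theorem integral_add (hφ : BoundedMeasurable φ) (hψ : BoundedMeasurable ψ) :
    E.integral (fun x => φ x + ψ x) = E.integral φ + E.integral ψ :=
  E.integral_eq_of_inner (hφ.add hψ) fun f => by
    rw [add_apply, inner_add_right, E.inner_integral hφ, E.inner_integral hψ,
      MeasureTheory.integral_add (hφ.integrable _) (hψ.integrable _)]

theorem integral_const_mul (c : ℂ) (hφ : BoundedMeasurable φ) :
    E.integral (fun x => c * φ x) = c • E.integral φ :=
  E.integral_eq_of_inner (hφ.const_mul c) fun f => by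
    rw [smul_apply, inner_smul_right, E.inner_integral hφ,
      MeasureTheory.integral_const_mul]

theorem integral_neg (hφ : BoundedMeasurable φ) :
    E.integral (fun x => -φ x) = -E.integral φ := by
  simpa using E.integral_const_mul (-1) hφ

theorem integral_sub (hφ : BoundedMeasurable φ) (hψ : BoundedMeasurable ψ) :
    E.integral (fun x => φ x - ψ x) = E.integral φ - E.integral ψ := by
  simpa [sub_eq_add_neg, E.integral_neg hψ] using E.integral_add hφ hψ.neg

theorem integral_zero : E.integral (fun _ => 0) = 0 :=
  E.integral_eq_of_inner (BoundedMeasurable.const 0) fun f => by simp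

theorem integral_finset_sum {ι : Type*} (s : Finset ι) {φ : ι → X → ℂ}
    (h : ∀ i ∈ s, BoundedMeasurable (φ i)) :
    E.integral (fun x => ∑ i ∈ s, φ i x) = ∑ i ∈ s, E.integral (φ i) := by
  classical
  induction s using Finset.induction_on with
  | empty => simpa using E.integral_zero
  | insert i s hi ih =>
    simp only [Finset.sum_insert hi]
    rw [E.integral_add (h i (Finset.mem_insert_self _ _))
      (BoundedMeasurable.finset_sum s fun j hj => h j (Finset.mem_insert_of_mem hj)),
      ih fun j hj => h j (Finset.mem_insert_of_mem hj)]

theorem adjoint_integral (hφ : BoundedMeasurable φ) :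
    ContinuousLinearMap.adjoint (E.integral φ) =
      E.integral (fun x => (starRingEnd ℂ) (φ x)) := by
  refine (E.integral_eq_of_inner hφ.star fun f => ?_).symm
  rw [ContinuousLinearMap.adjoint_inner_right, ← inner_conj_symm, E.inner_integral hφ,
    ← integral_conj]

/-- Polarisation of the norm identity for `φ + c ψ`. Multiplicativity follows by applying it to the
conjugate of `φ` and moving the adjoint across. -/
theorem inner_integral_integral (hφ : BoundedMeasurable φ) (hψ : BoundedMeasurable ψ) (f : V) :
    ⟪E.integral φ f, E.integral ψ f⟫_ℂ =
      ∫ x, (starRingEnd ℂ) (φ x) * ψ x ∂(E.scalarMeasure f) := by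
  refine hφ.inner_eq_integral hψ fun c => ?_
  rw [← E.norm_integral_sq (hφ.add (hψ.const_mul c)) f, E.integral_add hφ (hψ.const_mul c),
    E.integral_const_mul c hψ]
  rfl

theorem integral_mul (hφ : BoundedMeasurable φ) (hψ : BoundedMeasurable ψ) :
    E.integral (fun x => φ x * ψ x) = E.integral φ * E.integral ψ :=
  E.integral_eq_of_inner (hφ.mul hψ) fun f => by
    have h := E.inner_integral_integral hφ.star hψ f
    rw [← E.adjoint_integral hφ, ContinuousLinearMap.adjoint_inner_left] at h
    simpa using h

theorem integral_mul_apply (hφ : BoundedMeasurable φ) (hψ : BoundedMeasurable ψ) (f : V) :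
    E.integral φ (E.integral ψ f) = E.integral (fun x => φ x * ψ x) f := by
  rw [E.integral_mul hφ hψ]; rfl

theorem integral_indicator_one {S : Set X} (hS : MeasurableSet S) :
    E.integral (S.indicator fun _ => (1 : ℂ)) = E.proj S :=
  E.integral_eq_of_inner (BoundedMeasurable.indicator_one hS) fun f => by
    rw [E.inner_proj hS, integral_indicator hS, setIntegral_const, E.real_scalarMeasure f hS]
    simp

theorem proj_integral (hφ : BoundedMeasurable φ) {S : Set X} (hS : MeasurableSet S) (f : V) :
    E.proj S (E.integral φ f) = E.integral (S.indicator φ) f := by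
  rw [← E.integral_indicator_one hS,
    E.integral_mul_apply (BoundedMeasurable.indicator_one hS) hφ]
  congr 2
  ext x
  by_cases hx : x ∈ S <;> simp [hx]

theorem integral_proj (hφ : BoundedMeasurable φ) {S : Set X} (hS : MeasurableSet S) (f : V) :
    E.integral φ (E.proj S f) = E.integral (S.indicator φ) f := by
  rw [← E.integral_indicator_one hS,
    E.integral_mul_apply hφ (BoundedMeasurable.indicator_one hS)]
  congr 2
  ext x
  by_cases hx : x ∈ S <;> simp [hx]

theorem enorm_integral_sq (hφ : BoundedMeasurable φ) (f : V) :
    ‖E.integral φ f‖ₑ ^ 2 = ∫⁻ x, ‖φ x‖ₑ ^ 2 ∂(E.scalarMeasure f) := by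
  rw [← ofReal_norm, ← ENNReal.ofReal_pow (norm_nonneg _), E.norm_integral_sq hφ,
    ofReal_integral_eq_lintegral_ofReal (hφ.integrable_norm_sq _)
      (Eventually.of_forall fun x => by positivity)]
  simp [ENNReal.ofReal_pow]

/-- `E(S)` turns `φ` into `1_S φ`, so the isometry computes the mass of every `S`. Domain questions
for vectors `∫ φ dE f` thereby become integrability questions for `f`. -/
theorem scalarMeasure_integral (hφ : BoundedMeasurable φ) (f : V) :
    E.scalarMeasure (E.integral φ f) =
      (E.scalarMeasure f).withDensity fun x => ‖φ x‖ₑ ^ 2 := by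
  ext S hS
  rw [E.scalarMeasure_eq_enorm_sq _ hS, E.proj_integral hφ hS,
    E.enorm_integral_sq (hφ.indicator hS), withDensity_apply _ hS, ← lintegral_indicator hS]
  congr 1
  ext x
  by_cases hx : x ∈ S <;> simp [hx]

theorem scalarMeasure_proj {S : Set X} (hS : MeasurableSet S) (f : V) :
    E.scalarMeasure (E.proj S f) = (E.scalarMeasure f).restrict S := by
  ext S' hS'
  rw [E.scalarMeasure_eq_enorm_sq _ hS', E.proj_apply_proj hS' hS,
    Measure.restrict_apply hS', E.scalarMeasure_eq_enorm_sq _ (hS'.inter hS)]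

theorem norm_integral_le {M : ℝ} (hφ : Measurable φ) (hM : ∀ x, ‖φ x‖ ≤ M) (f : V) :
    ‖E.integral φ f‖ ≤ |M| * ‖f‖ := by
  have hφ' : BoundedMeasurable φ := ⟨hφ, M, hM⟩
  have h : ‖E.integral φ f‖ₑ ^ 2 ≤ (‖M‖ₑ * ‖f‖ₑ) ^ 2 := by
    rw [E.enorm_integral_sq hφ', mul_pow]
    calc ∫⁻ x, ‖φ x‖ₑ ^ 2 ∂(E.scalarMeasure f) ≤ ∫⁻ _, ‖M‖ₑ ^ 2 ∂(E.scalarMeasure f) := by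
          refine lintegral_mono fun x => ?_
          gcongr
          exact enorm_le_iff_norm_le.2 (by simpa using (hM x).trans (le_abs_self M))
      _ ≤ _ := by
          rw [lintegral_const]
          gcongr
          exact E.scalarMeasure_le f _
  have h2 := (ENNReal.pow_le_pow_left_iff two_ne_zero).1 h
  have h3 : ‖M‖ₑ * ‖f‖ₑ = ‖(|M| * ‖f‖ : ℝ)‖ₑ := by
    rw [enorm_mul, Real.enorm_abs, enorm_norm]
  rw [h3, enorm_le_iff_norm_le, Real.norm_of_nonneg (by positivity)] at h2
  exact h2

theorem tendsto_integral {ι : Type*} {l : Filter ι} [l.IsCountablyGenerated] {Φ : ι → X → ℂ}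
    {M : ℝ} (hΦ : ∀ k, Measurable (Φ k)) (hM : ∀ k x, ‖Φ k x‖ ≤ M) (hφ : BoundedMeasurable φ)
    (hlim : ∀ x, Tendsto (fun k => Φ k x) l (𝓝 (φ x))) (f : V) :
    Tendsto (fun k => E.integral (Φ k) f) l (𝓝 (E.integral φ f)) := by
  obtain ⟨M', hM'⟩ := hφ.bounded
  rw [tendsto_iff_norm_sub_tendsto_zero]
  have h : Tendsto (fun k => ‖E.integral (Φ k) f - E.integral φ f‖ ^ 2) l (𝓝 0) := by
    have h1 : ∀ k, ‖E.integral (Φ k) f - E.integral φ f‖ ^ 2 =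
        ∫ x, ‖Φ k x - φ x‖ ^ 2 ∂(E.scalarMeasure f) := by
      intro k
      have hk : BoundedMeasurable (Φ k) := ⟨hΦ k, M, hM k⟩
      rw [← E.norm_integral_sq (hk.sub hφ), E.integral_sub hk hφ]
      rfl
    simp_rw [h1]
    have : Tendsto (fun k => ∫ x, ‖Φ k x - φ x‖ ^ 2 ∂(E.scalarMeasure f)) l
        (𝓝 (∫ _, (0 : ℝ) ∂(E.scalarMeasure f))) := by
      refine tendsto_integral_filter_of_dominated_convergence (fun _ => (M + M') ^ 2) ?_ ?_
        (integrable_const _) ?_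
      · exact Eventually.of_forall fun k =>
          (((hΦ k).sub hφ.measurable).norm.pow_const 2).aestronglyMeasurable
      · refine Eventually.of_forall fun k => Eventually.of_forall fun x => ?_
        rw [Real.norm_of_nonneg (by positivity)]
        exact pow_le_pow_left₀ (norm_nonneg _)
          ((norm_sub_le _ _).trans (add_le_add (hM k x) (hM' x))) 2
      · refine Eventually.of_forall fun x => ?_
        have := ((hlim x).sub_const (φ x)).norm.pow 2
        simpa using this
    simpa using this
  have h2 := h.sqrt
  simpa [Real.sqrt_sq (norm_nonneg _)] using h2

end ProjectionValuedMeasure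

/-! ### The operators and their resolvents as spectral integrals -/

namespace KatoSmooth

variable {V : Type*} [NormedAddCommGroup V] [InnerProductSpace ℂ V] [CompleteSpace V]
variable {G : Type*} [NormedAddCommGroup G] [InnerProductSpace ℂ G] [CompleteSpace G]
variable {n : ℕ} {H : Fin n → V →ₗ.[ℂ] V} {E : ProjectionValuedMeasure (Fin n → ℝ) V}

theorem measurable_coord (j : Fin n) : Measurable fun x : Fin n → ℝ => ((x j : ℝ) : ℂ) :=
  Complex.measurable_ofReal.comp (measurable_pi_apply j)

namespace IsJointSpectralMeasure

theorem integral_one (hE : IsJointSpectralMeasure H E) : E.integral (fun _ => 1) = 1 := by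
  rw [← hE.proj_univ, ← E.integral_indicator_one MeasurableSet.univ]
  simp

theorem integral_mem_domain (hE : IsJointSpectralMeasure H E) {j : Fin n} {φ : (Fin n → ℝ) → ℂ}
    (hφ : BoundedMeasurable φ) (hxφ : BoundedMeasurable fun x => (x j : ℂ) * φ x) (f : V) :
    E.integral φ f ∈ (H j).domain := by
  rw [hE.mem_domain_iff, E.scalarMeasure_integral hφ, lintegral_withDensity_eq_lintegral_mul _
    (hφ.measurable.enorm.pow_const 2) (by fun_prop)]
  have h := E.enorm_integral_sq hxφ f
  simp only [enorm_mul, mul_pow] at h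
  have h2 : ∫⁻ x, ((fun x => ‖φ x‖ₑ ^ 2) * fun x : Fin n → ℝ => ‖x j‖ₑ ^ 2) x
      ∂(E.scalarMeasure f) = ‖E.integral (fun x => (x j : ℂ) * φ x) f‖ₑ ^ 2 := by
    rw [h]
    refine lintegral_congr fun x => ?_
    simp only [Pi.mul_apply]
    rw [mul_comm]
    congr 2
    exact (enorm_eq_iff_norm_eq.2 (by simp)).symm
  rw [h2]
  exact ENNReal.pow_lt_top enorm_lt_top

theorem integrable_coord (hE : IsJointSpectralMeasure H E) {j : Fin n} {u : V}
    (hu : u ∈ (H j).domain) : Integrable (fun x : Fin n → ℝ => x j) (E.scalarMeasure u) := by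
  have h : MemLp (fun x : Fin n → ℝ => x j) 2 (E.scalarMeasure u) := by
    refine ⟨(measurable_pi_apply j).aestronglyMeasurable, ?_⟩
    rw [eLpNorm_lt_top_iff_lintegral_rpow_enorm_lt_top (by simp) (by simp)]
    simpa using (hE.mem_domain_iff j u).1 hu
  exact h.integrable (by norm_num)

theorem boundedMeasurable_indicator_coord {j : Fin n} {B : Set (Fin n → ℝ)} (hB : MeasurableSet B)
    {R : ℝ} (hR : ∀ x ∈ B, |x j| ≤ R) :
    BoundedMeasurable (B.indicator fun x : Fin n → ℝ => ((x j : ℝ) : ℂ)) := by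
  refine ⟨(measurable_coord j).indicator hB, |R|, fun x => ?_⟩
  by_cases hx : x ∈ B
  · simpa [hx] using (hR x hx).trans (le_abs_self R)
  · simp [hx]

theorem proj_mem_domain (hE : IsJointSpectralMeasure H E) {j : Fin n} {B : Set (Fin n → ℝ)}
    (hB : MeasurableSet B) {R : ℝ} (hR : ∀ x ∈ B, |x j| ≤ R) (f : V) :
    E.proj B f ∈ (H j).domain := by
  rw [← E.integral_indicator_one hB]
  refine hE.integral_mem_domain (BoundedMeasurable.indicator_one hB) ?_ f
  convert boundedMeasurable_indicator_coord hB hR using 1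
  ext x
  by_cases hx : x ∈ B <;> simp [hx]

/-- `E(B) H_j u = (∫_B x_j dE) u` for `u ∈ D(H_j)` if `x_j` is bounded on `B`. -/
theorem proj_apply (hE : IsJointSpectralMeasure H E) {j : Fin n} {B : Set (Fin n → ℝ)}
    (hB : MeasurableSet B) {R : ℝ} (hR : ∀ x ∈ B, |x j| ≤ R) (u : (H j).domain) :
    E.proj B (H j u) = E.integral (B.indicator fun x : Fin n → ℝ => ((x j : ℝ) : ℂ)) u := by
  set A := E.integral (B.indicator fun x : Fin n → ℝ => ((x j : ℝ) : ℂ)) with hAdef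
  have hbm := boundedMeasurable_indicator_coord (j := j) hB hR
  refine ext_inner_left ℂ fun v => ?_
  -- As `E(B)` is self-adjoint, it is enough to pair with vectors in its range.
  let w : (H j).domain := ⟨E.proj B v, hE.proj_mem_domain hB hR v⟩
  have hcompl : ∀ c : ℂ, E.proj Bᶜ ((u : V) + c • (w : V)) = E.proj Bᶜ u := by
    intro c
    rw [map_add, map_smul, E.proj_apply_proj hB.compl hB, Set.compl_inter_self, E.proj_empty]
    simp
  -- Only the quadratic form of `H_j` is given. Adding `c w` changes nothing off `B`, so the
  -- complement contributes a constant independent of `c`, which cancels in the polarisation below.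
  have hdiff : ∀ c : ℂ, ⟪(u : V) + c • (w : V), H j (u + c • w)⟫_ℂ =
      ⟪(u : V) + c • (w : V), A ((u : V) + c • (w : V))⟫_ℂ +
        ((∫ x, x j ∂(E.scalarMeasure (E.proj Bᶜ u)) : ℝ) : ℂ) := by
    intro c
    have h1 := hE.inner_apply j (u + c • w)
    have h2 := hE.integrable_coord (u + c • w).2
    rw [← integral_add_compl hB h2] at h1
    simp only [Submodule.coe_add, Submodule.coe_smul] at h1
    rw [h1, hAdef, E.inner_integral hbm, integral_indicator hB, ← hcompl c,
      E.scalarMeasure_proj hB.compl, integral_complex_ofReal]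
    push_cast
    rfl
  have hpol : ∀ F : (H j).domain →ₗ[ℂ] V, 4 * ⟪(w : V), F u⟫_ℂ =
      (⟪(u : V) + (1 : ℂ) • (w : V), F (u + (1 : ℂ) • w)⟫_ℂ -
        ⟪(u : V) + (-1 : ℂ) • (w : V), F (u + (-1 : ℂ) • w)⟫_ℂ) +
      Complex.I * (⟪(u : V) + Complex.I • (w : V), F (u + Complex.I • w)⟫_ℂ -
        ⟪(u : V) + (-Complex.I) • (w : V), F (u + (-Complex.I) • w)⟫_ℂ) := by
    intro F
    simp only [map_add, map_smul, inner_add_left, inner_add_right, inner_smul_left,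
      inner_smul_right, map_neg, map_one, Complex.conj_I]
    linear_combination (2 * ⟪(w : V), F u⟫_ℂ - 2 * ⟪(u : V), F w⟫_ℂ) * Complex.I_mul_I
  have h1 := hpol (H j).toFun
  have h2 := hpol ((A : V →ₗ[ℂ] V) ∘ₗ (H j).domain.subtype)
  have e1 : ∀ c : ℂ, (H j).toFun (u + c • w) = H j (u + c • w) := fun _ => rfl
  have e2 : ∀ c : ℂ, ((A : V →ₗ[ℂ] V) ∘ₗ (H j).domain.subtype) (u + c • w) =
    A ((u : V) + c • (w : V)) := fun _ => rfl
  simp only [e1, hdiff] at h1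
  simp only [e2] at h2
  have h3 : ⟪(w : V), H j u⟫_ℂ = ⟪(w : V), A u⟫_ℂ := by
    have h4 : ⟪(w : V), (H j).toFun u⟫_ℂ = ⟪(w : V), A u⟫_ℂ := by
      have : ((A : V →ₗ[ℂ] V) ∘ₗ (H j).domain.subtype) u = A u := rfl
      rw [this] at h2
      linear_combination (h1 - h2) / 4
    exact h4
  have h5 : ∀ y : V, ⟪(w : V), y⟫_ℂ = ⟪v, E.proj B y⟫_ℂ := fun y =>
    (E.isStarProjection B hB).isSelfAdjoint.isSymmetric v y
  rwa [h5, h5, hAdef, E.proj_integral hbm hB, Set.indicator_indicator, Set.inter_self] at h3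

theorem tendsto_proj (hE : IsJointSpectralMeasure H E) {B : ℕ → Set (Fin n → ℝ)}
    (hB : ∀ N, MeasurableSet (B N)) (hlim : ∀ x, ∀ᶠ N in atTop, x ∈ B N) (f : V) :
    Tendsto (fun N => E.proj (B N) f) atTop (𝓝 f) := by
  have h := E.tendsto_integral (l := atTop) (M := 1) (φ := fun _ => 1)
    (Φ := fun N => (B N).indicator fun _ => (1 : ℂ))
    (fun N => (BoundedMeasurable.indicator_one (hB N)).measurable)
    (fun N x => by by_cases hx : x ∈ B N <;> simp [hx]) (BoundedMeasurable.const 1)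
    (fun x => tendsto_const_nhds.congr' ((hlim x).mono fun N hN => by simp [hN])) f
  simp only [fun N => E.integral_indicator_one (hB N)] at h
  rw [hE.integral_one] at h
  exact h

theorem measurableSet_abs_le (j : Fin n) (R : ℝ) : MeasurableSet {x : Fin n → ℝ | |x j| ≤ R} :=
  measurableSet_le (measurable_pi_apply j).abs measurable_const

theorem tendsto_proj_abs_le (hE : IsJointSpectralMeasure H E) (j : Fin n) (f : V) :
    Tendsto (fun N : ℕ => E.proj {x | |x j| ≤ N} f) atTop (𝓝 f) :=
  hE.tendsto_proj (fun N => measurableSet_abs_le j N) (fun x => by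
    obtain ⟨N, hN⟩ := exists_nat_ge |x j|
    filter_upwards [eventually_ge_atTop N] with k hk
    exact hN.trans (by exact_mod_cast hk)) f

/-- `H_j ∫ φ dE = ∫ x_j φ dE` if `φ` and `x_j φ` are bounded. -/
theorem apply_integral (hE : IsJointSpectralMeasure H E) {j : Fin n} {φ : (Fin n → ℝ) → ℂ}
    (hφ : BoundedMeasurable φ) (hxφ : BoundedMeasurable fun x => (x j : ℂ) * φ x) (f : V) :
    H j ⟨E.integral φ f, hE.integral_mem_domain hφ hxφ f⟩ =
      E.integral (fun x => (x j : ℂ) * φ x) f := by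
  -- The two sides agree after projection to `|x_j| ≤ N`, where the coordinate is bounded, and these
  -- projections tend strongly to the identity.
  refine tendsto_nhds_unique (hE.tendsto_proj_abs_le j _)
    ((hE.tendsto_proj_abs_le j (E.integral (fun x => (x j : ℂ) * φ x) f)).congr fun N => ?_)
  have hB := measurableSet_abs_le j (N : ℝ)
  rw [hE.proj_apply (R := N) hB (fun x hx => hx)]
  rw [E.integral_mul_apply (boundedMeasurable_indicator_coord (R := N) hB (fun x hx => hx)) hφ,
    E.proj_integral hxφ hB]
  congr 2
  ext x
  by_cases hx : |x j| ≤ N <;> simp [hx]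

theorem apply_proj (hE : IsJointSpectralMeasure H E) {j : Fin n} {B : Set (Fin n → ℝ)}
    (hB : MeasurableSet B) {R : ℝ} (hR : ∀ x ∈ B, |x j| ≤ R) (f : V) :
    H j ⟨E.proj B f, hE.proj_mem_domain hB hR f⟩ =
      E.integral (B.indicator fun x : Fin n → ℝ => ((x j : ℝ) : ℂ)) f := by
  have heq : (fun x : Fin n → ℝ => (x j : ℂ) * B.indicator (fun _ => (1 : ℂ)) x) =
      B.indicator fun x : Fin n → ℝ => ((x j : ℝ) : ℂ) := by
    ext x
    by_cases hx : x ∈ B <;> simp [hx]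
  have h := hE.apply_integral (j := j) (BoundedMeasurable.indicator_one hB)
    (by rw [heq]; exact boundedMeasurable_indicator_coord hB hR) f
  conv_rhs at h => rw [heq]
  rw [← h]
  congr 1
  exact Subtype.ext (congrArg (fun A : V →L[ℂ] V => A f) (E.integral_indicator_one hB).symm)

theorem boundedMeasurable_inv_sub (j : Fin n) {z : ℂ} (hz : z.im ≠ 0) :
    BoundedMeasurable fun x : Fin n → ℝ => ((x j : ℂ) - z)⁻¹ := by
  refine ⟨((measurable_coord j).sub_const z).inv, |z.im|⁻¹, fun x => ?_⟩
  rw [norm_inv]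
  refine inv_anti₀ (abs_pos.2 hz) ?_
  have := Complex.abs_im_le_norm ((x j : ℂ) - z)
  simpa using this

theorem sub_ne_zero_of_im_ne_zero {z : ℂ} (hz : z.im ≠ 0) (t : ℝ) : (t : ℂ) - z ≠ 0 := fun h =>
  hz (by simpa using congrArg Complex.im h)

/-- The spectral integral of `(x_j - z)⁻¹` satisfies both inverse relations, and a two-sided inverse
is unique. -/
theorem resolventOp_eq (hE : IsJointSpectralMeasure H E) (j : Fin n) {z : ℂ} (hz : z.im ≠ 0) :
    (H j).resolventOp z = E.integral fun x => ((x j : ℂ) - z)⁻¹ := by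
  have hb := boundedMeasurable_inv_sub j hz
  have hxeq : (fun x : Fin n → ℝ => (x j : ℂ) * ((x j : ℂ) - z)⁻¹) =
      fun x => 1 + z * ((x j : ℂ) - z)⁻¹ := by
    ext x
    field_simp [sub_ne_zero_of_im_ne_zero hz (x j)]
    ring
  have hxb : BoundedMeasurable fun x : Fin n → ℝ => (x j : ℂ) * ((x j : ℂ) - z)⁻¹ := by
    rw [hxeq]; exact (BoundedMeasurable.const 1).add (hb.const_mul z)
  set R := E.integral fun x => ((x j : ℂ) - z)⁻¹ with hR
  have h1 : ∀ f : V, ∃ hf : R f ∈ (H j).domain, H j ⟨R f, hf⟩ - z • R f = f := by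
    intro f
    refine ⟨hE.integral_mem_domain hb hxb f, ?_⟩
    rw [hE.apply_integral hb hxb f, hxeq, E.integral_add (BoundedMeasurable.const 1)
      (hb.const_mul z), E.integral_const_mul z hb, hE.integral_one]
    simp [hR]
  have h2 : ∀ u : (H j).domain, R (H j u - z • (u : V)) = u := by
    intro u
    refine tendsto_nhds_unique (hE.tendsto_proj_abs_le j _)
      ((hE.tendsto_proj_abs_le j (u : V)).congr fun N => ?_)
    have hB := measurableSet_abs_le j (N : ℝ)
    have hbc := boundedMeasurable_indicator_coord (j := j) (R := N) hB (fun x hx => hx)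
    have hcomm : E.proj {x | |x j| ≤ N} (R (H j u - z • (u : V))) =
        R (E.proj {x | |x j| ≤ N} (H j u - z • (u : V))) := by
      rw [hR, E.proj_integral hb hB, E.integral_proj hb hB]
    rw [hcomm, map_sub, map_smul, hE.proj_apply (R := N) hB (fun x hx => hx), map_sub, map_smul,
      hR, E.integral_proj hb hB, E.integral_mul_apply hb hbc,
      ← E.integral_indicator_one hB]
    have : ∀ {φ ψ : (Fin n → ℝ) → ℂ}, BoundedMeasurable φ → BoundedMeasurable ψ → ∀ f : V,
        E.integral φ f - z • E.integral ψ f = E.integral (fun x => φ x - z * ψ x) f := by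
      intro φ ψ hφ hψ f
      rw [E.integral_sub hφ (hψ.const_mul z), E.integral_const_mul z hψ]; rfl
    rw [this (hb.mul hbc) (hb.indicator hB)]
    congr 2
    ext x
    by_cases hx : |x j| ≤ N
    · simp only [Set.mem_ofPred_eq, hx, Set.indicator_of_mem]
      field_simp [sub_ne_zero_of_im_ne_zero hz (x j)]
    · simp [hx]
  have h : ∃ R : V →L[ℂ] V,
      (∀ f : V, ∃ hf : R f ∈ (H j).domain, H j ⟨R f, hf⟩ - z • R f = f) ∧
      (∀ u : (H j).domain, R (H j u - z • (u : V)) = u) := ⟨R, h1, h2⟩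
  rw [LinearPMap.resolventOp, dif_pos h]
  ext f
  -- Uniqueness: the chosen left inverse is applied to `f = (H_j - z) R f`.
  obtain ⟨hf, hf'⟩ := h1 f
  conv_lhs => rw [← hf']
  exact h.choose_spec.2 ⟨R f, hf⟩

end IsJointSpectralMeasure

/-! ### Poisson kernels and `Im R_a` -/

/-- The kernel `μ / ((t - λ)² + μ²) = Im (t - λ - iμ)⁻¹`. -/
noncomputable def poisson (l m t : ℝ) : ℝ := m / ((t - l) ^ 2 + m ^ 2)

theorem poisson_nonneg {l m : ℝ} (hm : 0 ≤ m) (t : ℝ) : 0 ≤ poisson l m t :=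
  div_nonneg hm (by positivity)

theorem poisson_le_inv {l m : ℝ} (hm : 0 < m) (t : ℝ) : poisson l m t ≤ m⁻¹ := by
  rw [poisson, div_le_iff₀ (by positivity)]
  have : m⁻¹ * ((t - l) ^ 2 + m ^ 2) = m⁻¹ * (t - l) ^ 2 + m := by
    field_simp
  rw [this]
  have : 0 ≤ m⁻¹ * (t - l) ^ 2 := by positivity
  linarith

theorem measurable_poisson (l m : ℝ) : Measurable (poisson l m) := by
  unfold poisson; fun_prop

theorem boundedMeasurable_poisson {l m : ℝ} (hm : 0 < m) (j : Fin n) :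
    BoundedMeasurable fun x : Fin n → ℝ => ((poisson l m (x j) : ℝ) : ℂ) :=
  ⟨Complex.measurable_ofReal.comp ((measurable_poisson l m).comp (measurable_pi_apply j)), m⁻¹,
    fun x => by
      rw [Complex.norm_real, Real.norm_of_nonneg (poisson_nonneg hm.le _)]
      exact poisson_le_inv hm _⟩

theorem boundedMeasurable_sqrt_poisson {l m : ℝ} (hm : 0 < m) (j : Fin n) :
    BoundedMeasurable fun x : Fin n → ℝ => ((√(poisson l m (x j)) : ℝ) : ℂ) :=
  ⟨Complex.measurable_ofReal.comp
    ((measurable_poisson l m).comp (measurable_pi_apply j)).sqrt, √m⁻¹,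
    fun x => by
      rw [Complex.norm_real, Real.norm_of_nonneg (Real.sqrt_nonneg _)]
      exact Real.sqrt_le_sqrt (poisson_le_inv hm _)⟩

namespace IsJointSpectralMeasure

theorem imaginaryPart_resolventOp (hE : IsJointSpectralMeasure H E) (j : Fin n) {l m : ℝ}
    (hm : 0 < m) :
    ((imaginaryPart ((H j).resolventOp ((l : ℂ) + Complex.I * (m : ℂ))) :
      selfAdjoint (V →L[ℂ] V)) : V →L[ℂ] V) =
    E.integral fun x => ((poisson l m (x j) : ℝ) : ℂ) := by
  have hz : ((l : ℂ) + Complex.I * (m : ℂ)).im ≠ 0 := by simpa using hm.ne'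
  have hb := boundedMeasurable_inv_sub j hz
  rw [imaginaryPart_apply_coe, hE.resolventOp_eq j hz, ContinuousLinearMap.star_eq_adjoint,
    E.adjoint_integral hb, ← E.integral_sub hb hb.star]
  have : ∀ A : V →L[ℂ] V, -Complex.I • (2 : ℝ)⁻¹ • A = (-Complex.I * (2 : ℂ)⁻¹) • A := by
    intro A
    rw [mul_smul]
    congr 1
    rw [RCLike.real_smul_eq_coe_smul (K := ℂ)]
    simp
  rw [this, ← E.integral_const_mul _ (hb.sub hb.star)]
  congr 1
  ext x
  have h0 := sub_ne_zero_of_im_ne_zero hz (x j)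
  have h1 := Complex.sub_conj (((x j : ℂ) - ((l : ℂ) + Complex.I * (m : ℂ)))⁻¹)
  rw [h1, Complex.inv_im, Complex.normSq_apply, poisson]
  simp
  field_simp
  simp [Complex.I_sq]
  ring_nf

theorem imResolvent_eq (hE : IsJointSpectralMeasure H E) (a : Finset (Fin n))
    (lam mu : Fin n → ℝ) (hmu : ∀ j, 0 < mu j) :
    imResolvent H a lam mu =
      E.integral fun x => ∏ j ∈ a, ((poisson (lam j) (mu j) (x j) : ℝ) : ℂ) := by
  -- Boundedness of the partial products has to accompany the identity, since multiplicativity of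
  -- the integral needs it at each step.
  have key : ∀ L : List (Fin n),
      BoundedMeasurable (fun x : Fin n → ℝ =>
        (L.map fun j => ((poisson (lam j) (mu j) (x j) : ℝ) : ℂ)).prod) ∧
      (L.map fun j => ((imaginaryPart ((H j).resolventOp
        ((lam j : ℂ) + Complex.I * (mu j : ℂ))) : selfAdjoint (V →L[ℂ] V)) : V →L[ℂ] V)).prod =
      E.integral fun x => (L.map fun j => ((poisson (lam j) (mu j) (x j) : ℝ) : ℂ)).prod := by
    intro L
    induction L with
    | nil => exact ⟨by simpa using BoundedMeasurable.const 1, by simpa using hE.integral_one.symm⟩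
    | cons j L ih =>
      have hp := boundedMeasurable_poisson (n := n) (l := lam j) (hmu j) j
      simp only [List.map_cons, List.prod_cons]
      refine ⟨hp.mul ih.1, ?_⟩
      rw [ih.2, hE.imaginaryPart_resolventOp j (hmu j), E.integral_mul hp ih.1]
  rw [imResolvent, (key _).2]
  congr 1
  ext x
  rw [Finset.prod_eq_multiset_prod, ← Finset.sort_eq a (· ≤ ·), Multiset.map_coe,
    Multiset.prod_coe]

end IsJointSpectralMeasure

end KatoSmooth

/-! ### Differentiation of measures -/

/-- A finite measure whose value on small balls centred in `K` is at most `c` times their volume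
is bounded by `c • volume` on `K`. -/
theorem MeasureTheory.Measure.restrict_le_smul_volume_of_closedBall {ι : Type*} [Fintype ι]
    (ρ : Measure (ι → ℝ)) [IsFiniteMeasure ρ] (c : ℝ≥0) {K : Set (ι → ℝ)}
    (h : ∀ x ∈ K, ∀ r ∈ Set.Ioo (0 : ℝ) 1, ρ (Metric.closedBall x r) ≤
      c * volume (Metric.closedBall x r)) : ρ.restrict K ≤ c • volume := by
  refine Measure.le_iff.2 fun S hS => ?_
  rw [Measure.restrict_apply hS]
  have h1 : ρ (S ∩ K) ≤ (c • (volume : Measure (ι → ℝ))) (S ∩ K) := by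
    -- Closed sup-norm balls, that is cubes, form a Vitali family for `ρ`, so a comparison on
    -- arbitrarily small balls about each point of `S ∩ K` gives one of measures.
    refine (Besicovitch.vitaliFamily ρ).measure_le_of_frequently_le (c • volume)
      Measure.AbsolutelyContinuous.rfl _ fun x hx => ?_
    have ht := Besicovitch.tendsto_filterAt ρ x
    refine ht.frequently (Eventually.frequently ?_)
    filter_upwards [Ioo_mem_nhdsGT (zero_lt_one (α := ℝ))] with r hr
    simpa using h x hx.2 r hr
  exact h1.trans (measure_mono Set.inter_subset_left)

/-! ### The truncations `T E(B)` and the Kato norm as a Poisson integral bound -/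

namespace KatoSmooth

variable {V : Type*} [NormedAddCommGroup V] [InnerProductSpace ℂ V] [CompleteSpace V]
variable {G : Type*} [NormedAddCommGroup G] [InnerProductSpace ℂ G] [CompleteSpace G]
variable {n : ℕ} {H : Fin n → V →ₗ.[ℂ] V} {T : jointDomain H →ₗ[ℂ] G}

theorem exists_abs_le_of_isBounded {B : Set (Fin n → ℝ)} (hB : Bornology.IsBounded B) :
    ∃ R : ℝ, ∀ j, ∀ x ∈ B, |x j| ≤ R := by
  obtain ⟨R, hR⟩ := hB.exists_norm_le
  exact ⟨R, fun j x hx => (norm_le_pi_norm x j).trans (hR x hx)⟩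

theorem applyOn_of_mem {w : V} (hw : w ∈ jointDomain H) : applyOn H T w = T ⟨w, hw⟩ := by
  rw [applyOn, dif_pos hw]

theorem proj_mem_jointDomain (hE : IsJointSpectralMeasure H (jointSpectralMeasure H))
    {B : Set (Fin n → ℝ)} (hB : Bornology.IsBounded B)
    (hBm : MeasurableSet B) (f : V) : (jointSpectralMeasure H).proj B f ∈ jointDomain H := by
  obtain ⟨R, hR⟩ := exists_abs_le_of_isBounded hB
  exact (Submodule.mem_iInf _).2 fun j => hE.proj_mem_domain hBm (hR j) f

theorem component_proj (hE : IsJointSpectralMeasure H (jointSpectralMeasure H))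
    {B : Set (Fin n → ℝ)} (hB : Bornology.IsBounded B)
    (hBm : MeasurableSet B) (f : V) (j : Fin n) :
    component H j ⟨_, proj_mem_jointDomain hE hB hBm f⟩ = (jointSpectralMeasure H).integral
      (B.indicator fun x : Fin n → ℝ => ((x j : ℝ) : ℂ)) f := by
  obtain ⟨R, hR⟩ := exists_abs_le_of_isBounded hB
  exact hE.apply_proj hBm (hR j) f

/-- On the range of `E(B)` every `H_j` is bounded, so graph continuity makes `T E(B)` bounded and
the default value `0` in `truncate` is not taken. -/
theorem truncate_apply (hE : IsJointSpectralMeasure H (jointSpectralMeasure H))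
    (hT : GraphContinuous H T) {B : Set (Fin n → ℝ)}
    (hB : Bornology.IsBounded B) (hBm : MeasurableSet B) (f : V) :
    truncate H T B f = T ⟨_, proj_mem_jointDomain hE hB hBm f⟩ := by
  obtain ⟨R, hR⟩ := exists_abs_le_of_isBounded hB
  obtain ⟨C, hC⟩ := hT
  have h : ∃ S : V →L[ℂ] G, ∀ f : V,
      ∃ hf : (jointSpectralMeasure H).proj B f ∈ jointDomain H, S f = T ⟨_, hf⟩ := by
    let S : V →ₗ[ℂ] G := T ∘ₗ LinearMap.codRestrict (jointDomain H)
      ((jointSpectralMeasure H).proj B : V →ₗ[ℂ] V) (proj_mem_jointDomain hE hB hBm)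
    refine ⟨S.mkContinuous (|C| * (1 + ∑ _j : Fin n, |R|)) fun f => ?_,
      fun f => ⟨proj_mem_jointDomain hE hB hBm f, rfl⟩⟩
    refine (hC _).trans ((mul_le_mul_of_nonneg_right (le_abs_self C) (by positivity)).trans ?_)
    rw [mul_assoc]
    gcongr
    rw [add_mul, one_mul, Finset.sum_mul]
    refine add_le_add ((jointSpectralMeasure H).norm_proj_le hBm f)
      (Finset.sum_le_sum fun j _ => ?_)
    have h1 := component_proj hE hB hBm f j
    refine (congrArg norm h1).le.trans ?_
    refine ((jointSpectralMeasure H).norm_integral_le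
      ((measurable_coord j).indicator hBm) (M := |R|) (fun x => ?_) f).trans (by rw [abs_abs])
    by_cases hx : x ∈ B
    · simpa [hx] using (hR j x hx).trans (le_abs_self R)
    · simp [hx]
  rw [truncate, dif_pos h]
  exact (h.choose_spec f).choose_spec

theorem truncate_apply_eq_applyOn (hE : IsJointSpectralMeasure H (jointSpectralMeasure H))
    (hT : GraphContinuous H T) {B : Set (Fin n → ℝ)}
    (hB : Bornology.IsBounded B) (hBm : MeasurableSet B) (f : V) :
    truncate H T B f = applyOn H T ((jointSpectralMeasure H).proj B f) := by
  rw [truncate_apply hE hT hB hBm, applyOn_of_mem]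

/-- `T E(B_N) u → T u` for `u ∈ D(H)`. -/
theorem tendsto_truncate (hE : IsJointSpectralMeasure H (jointSpectralMeasure H))
    (hT : GraphContinuous H T) {B : ℕ → Set (Fin n → ℝ)}
    (hB : ∀ N, Bornology.IsBounded (B N)) (hBm : ∀ N, MeasurableSet (B N))
    (hlim : ∀ x, ∀ᶠ N in atTop, x ∈ B N) {u : V} (hu : u ∈ jointDomain H) :
    Tendsto (fun N => truncate H T (B N) u) atTop (𝓝 (applyOn H T u)) := by
  obtain ⟨C, hC⟩ := id hT
  rw [applyOn_of_mem hu, tendsto_iff_norm_sub_tendsto_zero]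
  have hpu := hE.tendsto_proj hBm hlim
  have hz : Tendsto (fun N => |C| * (‖(jointSpectralMeasure H).proj (B N) u - u‖ +
      ∑ j, ‖(jointSpectralMeasure H).proj (B N) (component H j ⟨u, hu⟩) -
        component H j ⟨u, hu⟩‖)) atTop (𝓝 0) := by
    have h1 := (tendsto_iff_norm_sub_tendsto_zero.1 (hpu u)).add
      (tendsto_finsetSum Finset.univ fun j _ =>
        tendsto_iff_norm_sub_tendsto_zero.1 (hpu (component H j ⟨u, hu⟩)))
    simpa using h1.const_mul |C|
  refine squeeze_zero (fun _ => norm_nonneg _) (fun N => ?_) hz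
  rw [truncate_apply hE hT (hB N) (hBm N), ← map_sub]
  refine (hC _).trans ((mul_le_mul_of_nonneg_right (le_abs_self C) (by positivity)).trans ?_)
  gcongr with j
  · exact le_rfl
  · obtain ⟨R, hR⟩ := exists_abs_le_of_isBounded (hB N)
    have h1 : component H j (⟨_, proj_mem_jointDomain hE (hB N) (hBm N) u⟩ - ⟨u, hu⟩) =
        component H j ⟨_, proj_mem_jointDomain hE (hB N) (hBm N) u⟩ -
        component H j ⟨u, hu⟩ := (H j).map_sub ⟨_, _⟩ ⟨_, _⟩
    -- `E(B_N)` commutes with `H_j` on `D(H)`, hence `E(B_N) u → u` in the graph topology and not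
    -- only in norm.
    have h2 : component H j ⟨_, proj_mem_jointDomain hE (hB N) (hBm N) u⟩ =
        (jointSpectralMeasure H).proj (B N) (component H j ⟨u, hu⟩) := by
      rw [component_proj hE (hB N) (hBm N)]
      exact (hE.proj_apply (hBm N) (hR j) ⟨u, (Submodule.mem_iInf _).1 hu j⟩).symm
    rw [h1, h2]

/-- The product of Poisson kernels is nonnegative, so its square root gives a self-adjoint `Q` with
`Q² = Im R_a`, and `A Q² A* = (Q A*)* (Q A*)`. The C*-identity then reduces the norm to that of `Q
A*`. -/
theorem kernel_sandwich (hE : IsJointSpectralMeasure H (jointSpectralMeasure H))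
    (a : Finset (Fin n)) (lam mu : Fin n → ℝ) (hmu : ∀ j, 0 < mu j)
    (A : V →L[ℂ] G) :
    A ∘L imResolvent H a lam mu ∘L ContinuousLinearMap.adjoint A =
      ContinuousLinearMap.adjoint ((jointSpectralMeasure H).integral
        (fun x => ∏ j ∈ a, ((√(poisson (lam j) (mu j) (x j)) : ℝ) : ℂ)) ∘L
          ContinuousLinearMap.adjoint A) ∘L
        ((jointSpectralMeasure H).integral
        (fun x => ∏ j ∈ a, ((√(poisson (lam j) (mu j) (x j)) : ℝ) : ℂ)) ∘L
          ContinuousLinearMap.adjoint A) := by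
  have hs : BoundedMeasurable fun x : Fin n → ℝ =>
      ∏ j ∈ a, ((√(poisson (lam j) (mu j) (x j)) : ℝ) : ℂ) :=
    BoundedMeasurable.finset_prod a fun j _ => boundedMeasurable_sqrt_poisson (hmu j) j
  have hsq : imResolvent H a lam mu = (jointSpectralMeasure H).integral
        (fun x => ∏ j ∈ a, ((√(poisson (lam j) (mu j) (x j)) : ℝ) : ℂ)) ∘L
      (jointSpectralMeasure H).integral
        (fun x => ∏ j ∈ a, ((√(poisson (lam j) (mu j) (x j)) : ℝ) : ℂ)) := by
    rw [hE.imResolvent_eq a lam mu hmu]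
    refine Eq.trans ?_ ((jointSpectralMeasure H).integral_mul hs hs)
    congr 1
    ext x
    rw [← Finset.prod_mul_distrib]
    refine Finset.prod_congr rfl fun j _ => ?_
    rw [← Complex.ofReal_mul, Real.mul_self_sqrt (poisson_nonneg (hmu j).le _)]
  have hadj : ContinuousLinearMap.adjoint ((jointSpectralMeasure H).integral
        (fun x => ∏ j ∈ a, ((√(poisson (lam j) (mu j) (x j)) : ℝ) : ℂ))) =
      (jointSpectralMeasure H).integral
        (fun x => ∏ j ∈ a, ((√(poisson (lam j) (mu j) (x j)) : ℝ) : ℂ)) := by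
    rw [(jointSpectralMeasure H).adjoint_integral hs]
    congr 1
    ext x
    simp [map_prod]
  rw [ContinuousLinearMap.adjoint_comp, ContinuousLinearMap.adjoint_adjoint, hadj, hsq]
  rfl

theorem enorm_sq_kernel (a : Finset (Fin n)) (lam mu : Fin n → ℝ) (hmu : ∀ j, 0 < mu j)
    (w : V) :
    ‖(jointSpectralMeasure H).integral
        (fun x => ∏ j ∈ a, ((√(poisson (lam j) (mu j) (x j)) : ℝ) : ℂ)) w‖ₑ ^ 2 =
      ∫⁻ x, ∏ j ∈ a, ENNReal.ofReal (poisson (lam j) (mu j) (x j))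
        ∂((jointSpectralMeasure H).scalarMeasure w) := by
  rw [ProjectionValuedMeasure.enorm_integral_sq _
    (BoundedMeasurable.finset_prod a fun j _ => boundedMeasurable_sqrt_poisson (hmu j) j)]
  refine lintegral_congr fun x => ?_
  rw [← ofReal_norm, norm_prod, ← ENNReal.ofReal_pow (by positivity), ← Finset.prod_pow,
    ENNReal.ofReal_prod_of_nonneg (fun j _ => by positivity)]
  refine Finset.prod_congr rfl fun j _ => ?_
  rw [Complex.norm_real, Real.norm_of_nonneg (Real.sqrt_nonneg _),
    Real.sq_sqrt (poisson_nonneg (hmu j).le _)]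

theorem enorm_kernel_sandwich (hE : IsJointSpectralMeasure H (jointSpectralMeasure H))
    (a : Finset (Fin n)) (lam mu : Fin n → ℝ) (hmu : ∀ j, 0 < mu j)
    (A : V →L[ℂ] G) :
    ‖A ∘L imResolvent H a lam mu ∘L ContinuousLinearMap.adjoint A‖ₑ =
      ‖(jointSpectralMeasure H).integral
        (fun x => ∏ j ∈ a, ((√(poisson (lam j) (mu j) (x j)) : ℝ) : ℂ)) ∘L
          ContinuousLinearMap.adjoint A‖ₑ ^ 2 := by
  rw [kernel_sandwich hE a lam mu hmu A, ← ofReal_norm,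
    ContinuousLinearMap.norm_adjoint_comp_self, ENNReal.ofReal_mul (norm_nonneg _), ofReal_norm,
    sq]

/-- Together with `katoNorm_le` this makes `katoNorm` the best constant in a bound for Poisson
integrals that is uniform in `B`; operators no longer enter the estimates of (K). -/
theorem lintegral_poisson_le_katoNorm (hE : IsJointSpectralMeasure H (jointSpectralMeasure H))
    (a : Finset (Fin n)) (lam mu : Fin n → ℝ)
    (hmu : ∀ j, 0 < mu j) {B : Set (Fin n → ℝ)}
    (hB : Bornology.IsBounded B) (hBm : MeasurableSet B) (h : G) :
    ∫⁻ x, ∏ j ∈ a, ENNReal.ofReal (poisson (lam j) (mu j) (x j))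
      ∂((jointSpectralMeasure H).scalarMeasure
        (ContinuousLinearMap.adjoint (truncate H T B) h)) ≤ katoNorm H T a lam mu * ‖h‖ₑ ^ 2 := by
  have h1 : ‖truncate H T B ∘L imResolvent H a lam mu ∘L
      ContinuousLinearMap.adjoint (truncate H T B)‖ₑ ≤ katoNorm H T a lam mu :=
    le_iSup_of_le B (le_iSup_of_le hB (le_iSup_of_le hBm le_rfl))
  rw [enorm_kernel_sandwich hE a lam mu hmu] at h1
  refine le_trans ?_ (mul_le_mul_left h1 _)
  rw [← enorm_sq_kernel a lam mu hmu, ← mul_pow]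
  gcongr
  exact ContinuousLinearMap.le_opENorm _ h

theorem katoNorm_le (hE : IsJointSpectralMeasure H (jointSpectralMeasure H))
    (a : Finset (Fin n)) (lam mu : Fin n → ℝ) (hmu : ∀ j, 0 < mu j) (M : ℝ≥0)
    (hM : ∀ B : Set (Fin n → ℝ), Bornology.IsBounded B → MeasurableSet B → ∀ h : G,
      ∫⁻ x, ∏ j ∈ a, ENNReal.ofReal (poisson (lam j) (mu j) (x j))
      ∂((jointSpectralMeasure H).scalarMeasure
        (ContinuousLinearMap.adjoint (truncate H T B) h)) ≤ M * ‖h‖ₑ ^ 2) :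
    katoNorm H T a lam mu ≤ M := by
  refine iSup_le fun B => iSup_le fun hB => iSup_le fun hBm => ?_
  rw [enorm_kernel_sandwich hE a lam mu hmu]
  have h1 : ‖(jointSpectralMeasure H).integral
        (fun x => ∏ j ∈ a, ((√(poisson (lam j) (mu j) (x j)) : ℝ) : ℂ)) ∘L
          ContinuousLinearMap.adjoint (truncate H T B)‖ ≤ √M := by
    refine ContinuousLinearMap.opNorm_le_bound _ (Real.sqrt_nonneg _) fun h => ?_
    have h2 := hM B hB hBm h
    rw [← enorm_sq_kernel a lam mu hmu] at h2
    have h3 := ENNReal.toReal_mono (by finiteness) h2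
    simp only [ENNReal.toReal_pow, toReal_enorm, ENNReal.toReal_mul, ENNReal.coe_toReal] at h3
    refine le_of_sq_le_sq ?_ (by positivity)
    rw [mul_pow, Real.sq_sqrt (NNReal.coe_nonneg M)]
    exact h3
  rw [← ofReal_norm, ← ENNReal.ofReal_pow (norm_nonneg _)]
  refine ENNReal.ofReal_le_of_le_toReal ?_
  rw [ENNReal.coe_toReal, ← Real.sq_sqrt (NNReal.coe_nonneg M)]
  exact pow_le_pow_left₀ (norm_nonneg _) h1 2

/-! ### From (K) to bounded densities -/

theorem cyl_eq_preimage (K : Set (Fin n → ℝ)) (a : Finset (Fin n)) :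
    cyl K a = a.restrict ⁻¹' (a.restrict '' K) := by
  ext x
  simp only [cyl, Set.mem_ofPred_eq, Set.mem_preimage, Set.mem_image]
  constructor
  · rintro ⟨y, hy, h⟩
    exact ⟨y, hy, funext fun j => (h j j.2).symm⟩
  · rintro ⟨y, hy, h⟩
    exact ⟨y, hy, fun j hj => (congrFun h ⟨j, hj⟩).symm⟩

theorem isCompact_restrict_image {K : Set (Fin n → ℝ)} (hK : IsCompact K) (a : Finset (Fin n)) :
    IsCompact (a.restrict '' K : Set (a → ℝ)) :=
  hK.image (continuous_pi fun j => continuous_apply (j : Fin n))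

theorem measurableSet_cyl {K : Set (Fin n → ℝ)} (hK : IsCompact K) (a : Finset (Fin n)) :
    MeasurableSet (cyl K a) := by
  rw [cyl_eq_preimage]
  exact (isCompact_restrict_image hK a).measurableSet.preimage (Finset.measurable_restrict a)

/-- The marginals on `ℝ^a` of the measures `⟨h, T E(·) T* h⟩` are bounded by a multiple of
`‖h‖²` times the Lebesgue measure on the projection of every compact `K ⊆ J`. -/
def LocallyBoundedDensity (H : Fin n → V →ₗ.[ℂ] V) (T : jointDomain H →ₗ[ℂ] G)
    (J : Set (Fin n → ℝ)) : Prop :=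
  ∀ a : Finset (Fin n), a.Nonempty → ∀ K : Set (Fin n → ℝ), IsCompact K → K ⊆ J →
    ∃ C : ℝ≥0, ∀ B : Set (Fin n → ℝ), Bornology.IsBounded B → MeasurableSet B → ∀ h : G,
      ((((jointSpectralMeasure H).scalarMeasure
        (ContinuousLinearMap.adjoint (truncate H T B) h)).map a.restrict).restrict
          (a.restrict '' K)) ≤ (C * ‖h‖₊ ^ 2) • (volume : Measure (a → ℝ))

theorem LocallyBoundedDensity.of_katoCondition
    (hE : IsJointSpectralMeasure H (jointSpectralMeasure H)) {J : Set (Fin n → ℝ)}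
    (hK : KatoCondition H T J) : LocallyBoundedDensity H T J := by
  intro a ha K hKc hKJ
  obtain ⟨M, hM⟩ := (ENNReal.lt_iff_exists_coe.1 (hK a ha K hKc hKJ)).imp fun M h => h.1
  refine ⟨M, fun B hB hBm h => ?_⟩
  have hmeas := Finset.measurable_restrict (X := fun _ : Fin n => ℝ) a
  refine Measure.restrict_le_smul_volume_of_closedBall _ _ ?_
  rintro _ ⟨lam, hlam, rfl⟩ r hr
  rw [Measure.map_apply hmeas measurableSet_closedBall, Real.volume_pi_closedBall _ hr.1.le,
    Fintype.card_coe]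
  have hr0 : (0 : ℝ) < 2 * r := by linarith [hr.1]
  -- All widths are set to the radius `r` of the cube. Differentiation only asks for `r < 1`, the
  -- range that (K) covers.
  have hle : katoNorm H T a lam (fun _ => r) ≤ M := by
    rw [← hM]
    exact le_iSup₂_of_le lam hlam (le_iSup₂_of_le (fun _ => r) (fun _ => hr) le_rfl)
  set μ := (jointSpectralMeasure H).scalarMeasure
    (ContinuousLinearMap.adjoint (truncate H T B) h)
  -- For `|t - λ| ≤ r` one has `r / ((t - λ)² + r²) ≥ 1/(2r)`, and `(2r)^|a|` is the volume of the
  -- cube.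
  have key : ∀ x ∈ (a.restrict ⁻¹' Metric.closedBall (a.restrict lam) r : Set (Fin n → ℝ)),
      1 ≤ ENNReal.ofReal ((2 * r) ^ a.card) *
        ∏ j ∈ a, ENNReal.ofReal (poisson (lam j) r (x j)) := by
    intro x hx
    rw [ENNReal.ofReal_pow hr0.le, ← Finset.prod_const, ← Finset.prod_mul_distrib]
    refine Finset.one_le_prod' fun j hj => ?_
    have hj' : |x j - lam j| ≤ r := by
      have := (dist_le_pi_dist (a.restrict x) (a.restrict lam) ⟨j, hj⟩).trans hx
      rwa [Real.dist_eq] at this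
    rw [← ENNReal.ofReal_mul hr0.le, ENNReal.one_le_ofReal, poisson, ← mul_div_assoc,
      one_le_div (by have := hr.1; positivity)]
    nlinarith [sq_le_sq' (neg_le_of_abs_le hj') (le_of_abs_le hj')]
  calc μ (a.restrict ⁻¹' Metric.closedBall (a.restrict lam) r)
      = ∫⁻ x in a.restrict ⁻¹' Metric.closedBall (a.restrict lam) r, 1 ∂μ := by simp
    _ ≤ ∫⁻ x in a.restrict ⁻¹' Metric.closedBall (a.restrict lam) r,
          ENNReal.ofReal ((2 * r) ^ a.card) *
          ∏ j ∈ a, ENNReal.ofReal (poisson (lam j) r (x j)) ∂μ :=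
        setLIntegral_mono' (measurableSet_closedBall.preimage hmeas) key
    _ ≤ ∫⁻ x, ENNReal.ofReal ((2 * r) ^ a.card) *
          ∏ j ∈ a, ENNReal.ofReal (poisson (lam j) r (x j)) ∂μ := setLIntegral_le_lintegral _ _
    _ = ENNReal.ofReal ((2 * r) ^ a.card) *
          ∫⁻ x, ∏ j ∈ a, ENNReal.ofReal (poisson (lam j) r (x j)) ∂μ :=
        lintegral_const_mul' _ _ ENNReal.ofReal_ne_top
    _ ≤ ENNReal.ofReal ((2 * r) ^ a.card) * (M * ‖h‖ₑ ^ 2) := by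
        gcongr
        exact (lintegral_poisson_le_katoNorm hE a lam (fun _ => r) (fun _ => hr.1) hB hBm h).trans
          (mul_le_mul_left hle _)
    _ = _ := by
        rw [mul_comm]
        push_cast
        rfl

end KatoSmooth

/-! ### From smoothness to bounded densities -/

namespace KatoSmooth

variable {V : Type*} [NormedAddCommGroup V] [InnerProductSpace ℂ V] [CompleteSpace V]
variable {G : Type*} [NormedAddCommGroup G] [InnerProductSpace ℂ G] [CompleteSpace G]
variable {n : ℕ} {H : Fin n → V →ₗ.[ℂ] V} {T : jointDomain H →ₗ[ℂ] G}

/-- The function `σ ↦ e^{i x_a · σ_a}`. -/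
noncomputable def phase (a : Finset (Fin n)) (x : a → ℝ) (σ : Fin n → ℝ) : ℂ :=
  Complex.exp (Complex.I * ((∑ j : a, x j * σ j : ℝ) : ℂ))

theorem expI_eq (a : Finset (Fin n)) (x : a → ℝ) :
    expI H a x = (jointSpectralMeasure H).integral (phase a x) := rfl

theorem continuous_phase (a : Finset (Fin n)) :
    Continuous fun p : (a → ℝ) × (Fin n → ℝ) => phase a p.1 p.2 := by
  unfold phase
  fun_prop

theorem norm_phase (a : Finset (Fin n)) (x : a → ℝ) (σ : Fin n → ℝ) : ‖phase a x σ‖ = 1 := by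
  rw [phase, mul_comm, Complex.norm_exp_ofReal_mul_I]

theorem measurable_phase (a : Finset (Fin n)) (x : a → ℝ) : Measurable (phase a x) :=
  ((continuous_phase a).comp (Continuous.prodMk_right x)).measurable

theorem boundedMeasurable_phase (a : Finset (Fin n)) (x : a → ℝ) :
    BoundedMeasurable (phase a x) :=
  ⟨measurable_phase a x, 1, fun σ => (norm_phase a x σ).le⟩

theorem proj_expI (a : Finset (Fin n)) (x : a → ℝ) {S : Set (Fin n → ℝ)} (hS : MeasurableSet S)
    (f : V) : (jointSpectralMeasure H).proj S (expI H a x f) =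
      expI H a x ((jointSpectralMeasure H).proj S f) := by
  have hb := boundedMeasurable_phase a x
  rw [expI_eq, ProjectionValuedMeasure.proj_integral _ hb hS,
    ProjectionValuedMeasure.integral_proj _ hb hS]

theorem scalarMeasure_expI (a : Finset (Fin n)) (x : a → ℝ) (f : V) :
    (jointSpectralMeasure H).scalarMeasure (expI H a x f) =
      (jointSpectralMeasure H).scalarMeasure f := by
  have h : ∀ σ, ‖phase a x σ‖ₑ = 1 := fun σ => by
    rw [← ofReal_norm, norm_phase, ENNReal.ofReal_one]
  rw [expI_eq, ProjectionValuedMeasure.scalarMeasure_integral _ (boundedMeasurable_phase a x)]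
  simp only [h, one_pow]
  exact withDensity_one

theorem expI_mem_jointDomain (hE : IsJointSpectralMeasure H (jointSpectralMeasure H))
    (a : Finset (Fin n)) (x : a → ℝ) {u : V} (hu : u ∈ jointDomain H) :
    expI H a x u ∈ jointDomain H := by
  refine (Submodule.mem_iInf _).2 fun j => ?_
  have h := (Submodule.mem_iInf _).1 hu j
  rw [hE.mem_domain_iff] at h ⊢
  rwa [scalarMeasure_expI]

theorem truncate_expI (hE : IsJointSpectralMeasure H (jointSpectralMeasure H))
    (hT : GraphContinuous H T) {B : Set (Fin n → ℝ)} (hB : Bornology.IsBounded B)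
    (hBm : MeasurableSet B) (a : Finset (Fin n)) (x : a → ℝ) (f : V) :
    truncate H T B (expI H a x f) =
      applyOn H T (expI H a x ((jointSpectralMeasure H).proj B f)) := by
  rw [truncate_apply_eq_applyOn hE hT hB hBm, proj_expI a x hBm]

/-- The Fourier transform of a measure of mass `m` concentrated near a point has modulus at least
`m / 2` near the origin. -/
theorem half_measure_le_norm_integral_phase (μ : Measure (Fin n → ℝ)) [IsFiniteMeasure μ]
    (a : Finset (Fin n)) (y : a → ℝ) {r : ℝ} {S : Set (Fin n → ℝ)}
    (hS : MeasurableSet S) (hSy : ∀ σ ∈ S, ∀ j : a, |σ j - y j| ≤ r) (x : a → ℝ)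
    (hx : ∀ j, |x j| * (r * a.card) ≤ 1) :
    μ.real S / 2 ≤ ‖∫ σ in S, phase a x σ ∂μ‖ := by
  rcases a.eq_empty_or_nonempty with rfl | ha
  · have : ∀ σ, phase ∅ x σ = 1 := fun σ => by simp [phase]
    simp only [this]
    have h0 := measureReal_nonneg (μ := μ) (s := S)
    simp [abs_of_nonneg h0, h0]
  have hcard : (0 : ℝ) < a.card := by exact_mod_cast ha.card_pos
  -- A unimodular factor moves the centre `y` to the origin without changing the modulus of the
  -- integral.
  set c : ℂ := Complex.exp (-(Complex.I * ((∑ j : a, x j * y j : ℝ) : ℂ))) with hc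
  have hcn : ‖c‖ = 1 := by
    rw [hc, ← mul_neg, ← Complex.ofReal_neg, mul_comm, Complex.norm_exp_ofReal_mul_I]
  have hre : ∀ σ, (c * phase a x σ).re = Real.cos (∑ j : a, x j * (σ j - y j)) := by
    intro σ
    rw [hc, phase, ← Complex.exp_add]
    have : -(Complex.I * ((∑ j : a, x j * y j : ℝ) : ℂ)) +
        Complex.I * ((∑ j : a, x j * σ j : ℝ) : ℂ) =
        ((∑ j : a, x j * (σ j - y j) : ℝ) : ℂ) * Complex.I := by
      simp only [mul_sub, Finset.sum_sub_distrib]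
      push_cast
      ring
    rw [this, Complex.exp_ofReal_mul_I_re]
  have hint : Integrable (fun σ => c * phase a x σ) (μ.restrict S) :=
    ((boundedMeasurable_phase a x).const_mul c).integrable _
  have h1 : ‖∫ σ in S, phase a x σ ∂μ‖ = ‖∫ σ in S, c * phase a x σ ∂μ‖ := by
    rw [MeasureTheory.integral_const_mul, norm_mul, hcn, one_mul]
  rw [h1]
  refine le_trans ?_ (Complex.re_le_norm _)
  have h2 : (∫ σ in S, c * phase a x σ ∂μ).re = ∫ σ in S, (c * phase a x σ).re ∂μ :=
    (integral_re hint).symm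
  rw [h2]
  -- The centred phase is at most `1` in absolute value, and there `cos s ≥ 1 - s²/2 ≥ 1/2`.
  have h3 : ∫ _σ in S, (1 / 2 : ℝ) ∂μ ≤ ∫ σ in S, (c * phase a x σ).re ∂μ := by
    refine setIntegral_mono_on (integrable_const _) hint.re hS fun σ hσ => ?_
    rw [hre]
    refine le_trans ?_ (Real.one_sub_sq_div_two_le_cos)
    have h4 : |∑ j : a, x j * (σ j - y j)| ≤ 1 := by
      refine (Finset.abs_sum_le_sum_abs _ _).trans ?_
      have h5 : ∀ j : a, |x j * (σ j - y j)| ≤ (a.card : ℝ)⁻¹ := by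
        intro j
        rw [abs_mul, ← one_div, le_div_iff₀ hcard]
        refine le_trans ?_ (hx j)
        rw [mul_assoc]
        gcongr
        exact hSy σ hσ j
      refine (Finset.sum_le_sum fun j _ => h5 j).trans ?_
      rw [Finset.sum_const, Finset.card_univ, Fintype.card_coe, nsmul_eq_mul,
        mul_inv_cancel₀ hcard.ne']
    have := sq_le_one_iff_abs_le_one _ |>.2 h4
    linarith
  simp only [setIntegral_const, smul_eq_mul] at h3
  linarith

/-- Moving `T E(B)` across as an adjoint leaves a quadratic form in one vector. This is how the
smoothness integrand sees the Fourier transform of `μ_h` on `S`. -/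
theorem inner_truncate_expI (B S : Set (Fin n → ℝ)) (hS : MeasurableSet S)
    (a : Finset (Fin n)) (x : a → ℝ) (h : G) :
    ⟪h, truncate H T B (expI H a x ((jointSpectralMeasure H).proj S
      (ContinuousLinearMap.adjoint (truncate H T B) h)))⟫_ℂ =
    ∫ σ in S, phase a x σ ∂((jointSpectralMeasure H).scalarMeasure
      (ContinuousLinearMap.adjoint (truncate H T B) h)) := by
  have hb := boundedMeasurable_phase a x
  rw [← ContinuousLinearMap.adjoint_inner_left, expI_eq,
    ProjectionValuedMeasure.integral_proj _ hb hS,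
    ProjectionValuedMeasure.inner_integral _ (hb.indicator hS), integral_indicator hS]

/-- An uncertainty argument. If `S` lies above a cube of half-side `r` and has mass `m`, the Fourier
transform of `μ_h` on `S` is at least `m/2` for `|x| ≤ ρ = 1/(r|a|)`, while the test vector has
squared norm at most `m`. So `(m/2)² (2ρ)^|a| ≤ C m ‖h‖²`; one factor `m` cancels and `m = O(r^|a|)`
remains. -/
theorem LocallyBoundedDensity.of_locallySmooth
    (hE : IsJointSpectralMeasure H (jointSpectralMeasure H)) (hT : GraphContinuous H T)
    {J : Set (Fin n → ℝ)} (hs : LocallySmooth H T J) : LocallyBoundedDensity H T J := by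
  intro a ha K hKc hKJ
  obtain ⟨C, hC⟩ := hs a ha K hKc hKJ
  have hcard : (0 : ℝ) < a.card := by exact_mod_cast ha.card_pos
  -- Solving `(m/2)² (2/(r|a|))^|a| ≤ C m ‖h‖²` gives `m ≤ 4C ‖h‖² (|a|/4)^|a| (2r)^|a|`, and the
  -- last factor is the volume of the cube.
  refine ⟨4 * C * ((a.card : ℝ≥0) / 4) ^ a.card, fun B hB hBm h => ?_⟩
  set E := jointSpectralMeasure H
  set w := ContinuousLinearMap.adjoint (truncate H T B) h with hw
  have hmeas := Finset.measurable_restrict (X := fun _ : Fin n => ℝ) a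
  have hK'm : MeasurableSet (a.restrict '' K : Set (a → ℝ)) :=
    (isCompact_restrict_image hKc a).measurableSet
  -- Differentiating the already restricted measure means that only the part of each ball above `K`
  -- has to be estimated, where `E(K(a))` acts as the identity.
  have hid : ((E.scalarMeasure w).map a.restrict).restrict (a.restrict '' K) =
      (((E.scalarMeasure w).map a.restrict).restrict (a.restrict '' K)).restrict
        (a.restrict '' K) := by
    rw [Measure.restrict_restrict hK'm, Set.inter_self]
  rw [hid]
  refine Measure.restrict_le_smul_volume_of_closedBall _ _ fun y _ r hr => ?_
  rw [Measure.restrict_apply measurableSet_closedBall, Measure.map_apply hmeas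
    (measurableSet_closedBall.inter hK'm), Real.volume_pi_closedBall _ hr.1.le, Fintype.card_coe]
  set S : Set (Fin n → ℝ) := a.restrict ⁻¹' (Metric.closedBall y r ∩ a.restrict '' K) with hSdef
  have hS : MeasurableSet S := (measurableSet_closedBall.inter hK'm).preimage hmeas
  have hScyl : S ⊆ cyl K a := by
    rw [cyl_eq_preimage]
    exact fun σ hσ => hσ.2
  set m := (E.scalarMeasure w).real S with hm
  have hm0 : 0 ≤ m := measureReal_nonneg
  set ρ : ℝ := 1 / (r * a.card) with hρ
  have hr0 : 0 < r := hr.1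
  have hρ0 : 0 < ρ := by positivity
  -- The factor `E(B)` puts the test vector into `D(H)`, as smoothness requires. It is harmless
  -- because `T E(B)` already contains it.
  have hlow : ∀ x ∈ (Metric.closedBall 0 ρ : Set (a → ℝ)), ENNReal.ofReal ((m / 2) ^ 2) ≤
      ‖h‖ₑ ^ 2 * ‖applyOn H T (expI H a x (E.proj (cyl K a) (E.proj S (E.proj B w))))‖ₑ ^ 2 := by
    intro x hx
    have hcyl : E.proj (cyl K a) (E.proj S (E.proj B w)) = E.proj B (E.proj S w) := by
      rw [E.proj_apply_proj (measurableSet_cyl hKc a) hS, Set.inter_eq_right.2 hScyl,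
        E.proj_apply_proj hS hBm, E.proj_apply_proj hBm hS, Set.inter_comm]
    rw [hcyl, ← truncate_expI hE hT hB hBm, ← mul_pow, ENNReal.ofReal_pow (by positivity)]
    gcongr
    have h1 := half_measure_le_norm_integral_phase (E.scalarMeasure w) a y hS
      (fun σ hσ j => by
        have := (dist_le_pi_dist (a.restrict σ) y j).trans hσ.1
        rwa [Real.dist_eq] at this) x (fun j => by
        have h2 : |x j| ≤ ρ := by
          have := (norm_le_pi_norm x j).trans (mem_closedBall_zero_iff.1 hx)
          simpa using this
        rw [hρ, le_div_iff₀ (by positivity)] at h2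
        exact h2)
    rw [hw, ← inner_truncate_expI B S hS a x h, ← hw] at h1
    refine (ENNReal.ofReal_le_ofReal (h1.trans (norm_inner_le_norm _ _))).trans ?_
    rw [ENNReal.ofReal_mul (norm_nonneg _), ofReal_norm, ofReal_norm]
  have hup : ∫⁻ x : a → ℝ,
      ‖applyOn H T (expI H a x (E.proj (cyl K a) (E.proj S (E.proj B w))))‖ₑ ^ 2 ≤
        C * ENNReal.ofReal m := by
    refine (hC _ ?_).trans ?_
    · rw [E.proj_apply_proj (measurableSet_cyl hKc a) hS, Set.inter_eq_right.2 hScyl,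
        E.proj_apply_proj hS hBm, Set.inter_comm, ← E.proj_apply_proj hBm hS]
      exact proj_mem_jointDomain hE hB hBm _
    · gcongr
      rw [hm, ofReal_measureReal, E.scalarMeasure_eq_enorm_sq w hS, E.proj_apply_proj hS hBm,
        Set.inter_comm, ← E.proj_apply_proj hBm hS]
      gcongr
      exact enorm_le_iff_norm_le.2 (E.norm_proj_le hBm _)
  have hmain : ENNReal.ofReal ((m / 2) ^ 2) * ENNReal.ofReal ((2 * ρ) ^ a.card) ≤
      ‖h‖ₑ ^ 2 * (C * ENNReal.ofReal m) := by
    calc ENNReal.ofReal ((m / 2) ^ 2) * ENNReal.ofReal ((2 * ρ) ^ a.card)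
        = ∫⁻ _ in (Metric.closedBall 0 ρ : Set (a → ℝ)), ENNReal.ofReal ((m / 2) ^ 2) := by
          rw [setLIntegral_const, Real.volume_pi_closedBall _ hρ0.le, Fintype.card_coe]
      _ ≤ ∫⁻ x in (Metric.closedBall 0 ρ : Set (a → ℝ)), ‖h‖ₑ ^ 2 *
          ‖applyOn H T (expI H a x (E.proj (cyl K a) (E.proj S (E.proj B w))))‖ₑ ^ 2 :=
        setLIntegral_mono' measurableSet_closedBall hlow
      _ ≤ ∫⁻ x, ‖h‖ₑ ^ 2 *
          ‖applyOn H T (expI H a x (E.proj (cyl K a) (E.proj S (E.proj B w))))‖ₑ ^ 2 :=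
        setLIntegral_le_lintegral _ _
      _ = ‖h‖ₑ ^ 2 * ∫⁻ x,
          ‖applyOn H T (expI H a x (E.proj (cyl K a) (E.proj S (E.proj B w))))‖ₑ ^ 2 :=
        lintegral_const_mul' _ _ (by finiteness)
      _ ≤ _ := by gcongr
  have hreal : (m / 2) ^ 2 * (2 * ρ) ^ a.card ≤ ‖h‖ ^ 2 * (C * m) := by
    have h3 := ENNReal.toReal_mono (by finiteness) hmain
    simpa [ENNReal.toReal_ofReal, hm0, hρ0.le, ENNReal.toReal_mul, div_nonneg] using h3
  have hmle : m ≤ 4 * C * ((a.card : ℝ) / 4) ^ a.card * ‖h‖ ^ 2 * (2 * r) ^ a.card := by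
    rcases hm0.eq_or_lt with h0 | h0
    · rw [← h0]; positivity
    have h4 : ((2 : ℝ) * ρ) ^ a.card * (((a.card : ℝ) / 4) ^ a.card * (2 * r) ^ a.card) = 1 := by
      rw [← mul_pow, ← mul_pow, hρ]
      have : 2 * (1 / (r * (a.card : ℝ))) * ((a.card : ℝ) / 4 * (2 * r)) = 1 := by
        field_simp; norm_num
      rw [this, one_pow]
    have h5 : 0 ≤ ((a.card : ℝ) / 4) ^ a.card * (2 * r) ^ a.card := by positivity
    have h6 := mul_le_mul_of_nonneg_right hreal h5
    rw [mul_assoc, h4] at h6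
    have h7 : m * m ≤ (4 * C * ((a.card : ℝ) / 4) ^ a.card * ‖h‖ ^ 2 * (2 * r) ^ a.card) * m := by
      nlinarith
    exact le_of_mul_le_mul_right h7 h0
  have h8 := ENNReal.ofReal_le_ofReal hmle
  rw [hm, ofReal_measureReal] at h8
  refine h8.trans (le_of_eq ?_)
  rw [ENNReal.ofReal_mul (by positivity)]
  congr 1
  rw [← ENNReal.ofReal_coe_nnreal]
  congr 1

end KatoSmooth

/-! ### Parseval on a box, and grids of cubes -/

theorem integral_exp_int_mul (R : ℝ) (hR : 0 < R) (k : ℤ) :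
    ∫ x in Set.Ioc (-R) R, Complex.exp (Complex.I * ((x * (Real.pi / R * k) : ℝ) : ℂ)) =
      if k = 0 then ((2 * R : ℝ) : ℂ) else 0 := by
  rw [← intervalIntegral.integral_of_le (by linarith)]
  split_ifs with hk
  · subst hk
    simp
    ring
  · have hR' : (R : ℂ) ≠ 0 := by exact_mod_cast hR.ne'
    have hk' : (k : ℂ) ≠ 0 := by exact_mod_cast hk
    have hpi : (Real.pi : ℂ) ≠ 0 := by exact_mod_cast Real.pi_ne_zero
    have hc : Complex.I * (Real.pi / R * k : ℂ) ≠ 0 :=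
      mul_ne_zero Complex.I_ne_zero (mul_ne_zero (div_ne_zero hpi hR') hk')
    have h1 : ∀ x : ℝ, Complex.exp (Complex.I * ((x * (Real.pi / R * k) : ℝ) : ℂ)) =
        Complex.exp ((Complex.I * (Real.pi / R * k : ℂ)) * x) := fun x => by
      congr 1; push_cast; ring
    simp only [h1]
    rw [integral_exp_mul_complex hc]
    -- Across an interval of length `2R` the exponential makes `k` full turns, so the endpoint
    -- values agree.
    have h2 : Complex.I * (Real.pi / R * k : ℂ) * (R : ℝ) =
        Complex.I * (Real.pi / R * k : ℂ) * ((-R : ℝ) : ℂ) + k * (2 * Real.pi * Complex.I) := by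
      push_cast
      field_simp
      ring
    rw [h2, Complex.exp_add, Complex.exp_int_mul_two_pi_mul_I]
    simp

section Orthogonality

variable {ι : Type*} [Fintype ι] [DecidableEq ι]
variable {G : Type*} [NormedAddCommGroup G] [InnerProductSpace ℂ G]

theorem integral_box_exp (R : ℝ) (hR : 0 < R) (k : ι → ℤ) :
    ∫ x in Set.univ.pi fun _ : ι => Set.Ioc (-R) R,
      Complex.exp (Complex.I * ((∑ j, x j * (Real.pi / R * k j) : ℝ) : ℂ)) =
      if k = 0 then ((2 * R : ℝ) : ℂ) ^ Fintype.card ι else 0 := by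
  have h1 : ∀ x : ι → ℝ, Complex.exp (Complex.I * ((∑ j, x j * (Real.pi / R * k j) : ℝ) : ℂ)) =
      ∏ j, Complex.exp (Complex.I * ((x j * (Real.pi / R * k j) : ℝ) : ℂ)) := fun x => by
    rw [← Complex.exp_sum, Complex.ofReal_sum, Finset.mul_sum]
  simp only [h1]
  rw [volume_pi, Measure.restrict_pi_pi,
    integral_fintype_prod_eq_prod (fun (j : ι) (t : ℝ) =>
      Complex.exp (Complex.I * ((t * (Real.pi / R * k j) : ℝ) : ℂ)))]
  simp only [integral_exp_int_mul R hR]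
  split_ifs with hk
  · simp [hk]
  · obtain ⟨j, hj⟩ := Function.ne_iff.1 hk
    exact Finset.prod_eq_zero (Finset.mem_univ j) (if_neg hj)

/-- Parseval's identity for trigonometric polynomials with values in a Hilbert space. -/
theorem integral_box_norm_sq_sum_exp (R : ℝ) (hR : 0 < R) (F : Finset (ι → ℤ))
    (m : (ι → ℤ) → G) :
    ∫ x in Set.univ.pi fun _ : ι => Set.Ioc (-R) R,
      ‖∑ k ∈ F, Complex.exp (Complex.I * ((∑ j, x j * (Real.pi / R * k j) : ℝ) : ℂ)) • m k‖ ^ 2 =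
      (2 * R) ^ Fintype.card ι * ∑ k ∈ F, ‖m k‖ ^ 2 := by
  set e : (ι → ℤ) → (ι → ℝ) → ℂ := fun k x =>
    Complex.exp (Complex.I * ((∑ j, x j * (Real.pi / R * k j) : ℝ) : ℂ)) with he
  have hmul : ∀ k l x, (starRingEnd ℂ) (e k x) * e l x = e (l - k) x := by
    intro k l x
    rw [he]
    simp only
    rw [← Complex.exp_conj, ← Complex.exp_add]
    congr 1
    simp only [map_mul, Complex.conj_I, Complex.conj_ofReal, Pi.sub_apply, Int.cast_sub, mul_sub,
      Finset.sum_sub_distrib, Complex.ofReal_sub]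
    ring
  have hcont : ∀ k, Continuous (e k) := fun k => by
    rw [he]; fun_prop
  have hfin : volume (Set.univ.pi fun _ : ι => Set.Ioc (-R) R) ≠ ∞ := by
    rw [Real.volume_pi_Ioc]
    exact ENNReal.prod_ne_top fun _ _ => ENNReal.ofReal_ne_top
  have : IsFiniteMeasure (volume.restrict (Set.univ.pi fun _ : ι => Set.Ioc (-R) R)) :=
    ⟨by rw [Measure.restrict_apply_univ]; exact hfin.lt_top⟩
  have hint : ∀ k, Integrable (e k)
      (volume.restrict (Set.univ.pi fun _ : ι => Set.Ioc (-R) R)) := fun k =>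
    Integrable.of_bound (hcont k).aestronglyMeasurable 1 (Eventually.of_forall fun x => by
      rw [he]; simp only; rw [mul_comm, Complex.norm_exp_ofReal_mul_I])
  have hexp : ∀ x, ((‖∑ k ∈ F, e k x • m k‖ ^ 2 : ℝ) : ℂ) =
      ∑ k ∈ F, ∑ l ∈ F, e (l - k) x * ⟪m k, m l⟫_ℂ := by
    intro x
    have h1 : ((‖∑ k ∈ F, e k x • m k‖ ^ 2 : ℝ) : ℂ) =
        ⟪∑ k ∈ F, e k x • m k, ∑ k ∈ F, e k x • m k⟫_ℂ := by
      rw [inner_self_eq_norm_sq_to_K]; norm_cast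
    rw [h1, sum_inner]
    refine Finset.sum_congr rfl fun k _ => ?_
    rw [inner_sum]
    refine Finset.sum_congr rfl fun l _ => ?_
    rw [inner_smul_left, inner_smul_right, ← mul_assoc, hmul]
  change ∫ x in Set.univ.pi fun _ : ι => Set.Ioc (-R) R, ‖∑ k ∈ F, e k x • m k‖ ^ 2 = _
  apply Complex.ofReal_injective
  rw [← integral_complex_ofReal]
  simp only [hexp]
  rw [integral_finsetSum _ fun k _ => integrable_finsetSum _ fun l _ => (hint _).mul_const _]
  push_cast
  rw [Finset.mul_sum]
  refine Finset.sum_congr rfl fun k hk => ?_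
  rw [integral_finsetSum _ fun l _ => (hint _).mul_const _, Finset.sum_eq_single k]
  · rw [integral_mul_const, he, integral_box_exp R hR, if_pos (sub_self k),
      inner_self_eq_norm_sq_to_K]
    push_cast
    rfl
  · intro l _ hl
    rw [integral_mul_const, he, integral_box_exp R hR, if_neg (sub_ne_zero.2 hl), zero_mul]
  · exact fun h => absurd hk h

end Orthogonality

/-- The half-open cube of side `ε` of the grid `ε ℤ^ι` with corner `ε k`. -/
def gridCube {ι : Type*} (ε : ℝ) (k : ι → ℤ) : Set (ι → ℝ) := {y | ∀ j, ⌊y j / ε⌋ = k j}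

theorem gridCube_eq_pi {ι : Type*} {ε : ℝ} (hε : 0 < ε) (k : ι → ℤ) :
    gridCube ε k = Set.univ.pi fun j => Set.Ico (ε * k j) (ε * (k j + 1)) := by
  ext y
  simp only [gridCube, Set.mem_ofPred_eq, Set.mem_pi, Set.mem_univ, true_implies, Set.mem_Ico,
    Int.floor_eq_iff, le_div_iff₀ hε, div_lt_iff₀ hε, mul_comm ε]

theorem measurableSet_gridCube {ι : Type*} [Countable ι] {ε : ℝ} (hε : 0 < ε) (k : ι → ℤ) :
    MeasurableSet (gridCube ε k) := by
  rw [gridCube_eq_pi hε]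
  exact MeasurableSet.univ_pi fun _ => measurableSet_Ico

theorem volume_gridCube {ι : Type*} [Fintype ι] {ε : ℝ} (hε : 0 < ε) (k : ι → ℤ) :
    volume (gridCube ε k) = ENNReal.ofReal (ε ^ Fintype.card ι) := by
  rw [gridCube_eq_pi hε, Real.volume_pi_Ico, ENNReal.ofReal_pow hε.le, ← Finset.card_univ,
    ← Finset.prod_const]
  refine Finset.prod_congr rfl fun j _ => ?_
  congr 1
  ring

theorem tendsto_mul_floor_div (t : ℝ) {ε : ℕ → ℝ} (hε : ∀ N, 0 < ε N)
    (hlim : Tendsto ε atTop (𝓝 0)) : Tendsto (fun N => ε N * ⌊t / ε N⌋) atTop (𝓝 t) := by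
  have h : Tendsto (fun N => t - ε N) atTop (𝓝 t) := by
    simpa using tendsto_const_nhds.sub hlim
  refine tendsto_of_tendsto_of_tendsto_of_le_of_le h tendsto_const_nhds (fun N => ?_) fun N => ?_
  · have := (Int.sub_one_lt_floor (t / ε N)).le
    have h2 := mul_le_mul_of_nonneg_left this (hε N).le
    rwa [mul_sub, mul_div_cancel₀ _ (hε N).ne', mul_one] at h2
  · have := mul_le_mul_of_nonneg_left (Int.floor_le (t / ε N)) (hε N).le
    rwa [mul_div_cancel₀ _ (hε N).ne'] at this

/-! ### From bounded densities to smoothness -/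

namespace KatoSmooth

variable {V : Type*} [NormedAddCommGroup V] [InnerProductSpace ℂ V] [CompleteSpace V]
variable {G : Type*} [NormedAddCommGroup G] [InnerProductSpace ℂ G] [CompleteSpace G]
variable {n : ℕ} {H : Fin n → V →ₗ.[ℂ] V} {T : jointDomain H →ₗ[ℂ] G}

/-- Duality: the hypothesis bounds `E(S) A*`, hence its adjoint `A E(S)` by the same constant. The
proof tests it on `g = A E(S) f`. -/
theorem norm_sq_apply_proj_le (E : ProjectionValuedMeasure (Fin n → ℝ) V) (A : V →L[ℂ] G)
    {S : Set (Fin n → ℝ)} (hS : MeasurableSet S) {c : ℝ} (hc : 0 ≤ c)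
    (h : ∀ g : G, E.scalarMeasure (ContinuousLinearMap.adjoint A g) S ≤
      ENNReal.ofReal (c * ‖g‖ ^ 2)) (f : V) :
    ‖A (E.proj S f)‖ ^ 2 ≤ c * (E.scalarMeasure f).real S := by
  set p := E.proj S f with hp
  rw [E.real_scalarMeasure f hS, ← hp]
  set g := A p with hg
  have h1 := h g
  rw [E.scalarMeasure_eq_norm_sq _ hS, ENNReal.ofReal_le_ofReal_iff (by positivity)] at h1
  have h2 : ‖g‖ ^ 2 ≤ ‖E.proj S (ContinuousLinearMap.adjoint A g)‖ * ‖p‖ := by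
    have h3 : ((‖g‖ ^ 2 : ℝ) : ℂ) = ⟪E.proj S (ContinuousLinearMap.adjoint A g), p⟫_ℂ := by
      have h4 : ⟪E.proj S (ContinuousLinearMap.adjoint A g), p⟫_ℂ =
          ⟪ContinuousLinearMap.adjoint A g, p⟫_ℂ := by
        rw [hp, E.inner_proj_proj hS hS, Set.inter_self]
      rw [h4, ContinuousLinearMap.adjoint_inner_left, ← hg, inner_self_eq_norm_sq_to_K]
      norm_cast
    have h5 := norm_inner_le_norm (𝕜 := ℂ) (E.proj S (ContinuousLinearMap.adjoint A g)) p
    rw [← h3, Complex.norm_real, Real.norm_of_nonneg (by positivity)] at h5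
    exact h5
  have h6 : (‖g‖ ^ 2) * (‖g‖ ^ 2) ≤ (c * ‖p‖ ^ 2) * ‖g‖ ^ 2 := by
    calc (‖g‖ ^ 2) * (‖g‖ ^ 2) ≤ (‖E.proj S (ContinuousLinearMap.adjoint A g)‖ * ‖p‖) *
          (‖E.proj S (ContinuousLinearMap.adjoint A g)‖ * ‖p‖) :=
          mul_le_mul h2 h2 (by positivity) (by positivity)
      _ = ‖E.proj S (ContinuousLinearMap.adjoint A g)‖ ^ 2 * ‖p‖ ^ 2 := by ring
      _ ≤ (c * ‖g‖ ^ 2) * ‖p‖ ^ 2 := by gcongr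
      _ = _ := by ring
  rcases (sq_nonneg ‖g‖).eq_or_lt with h0 | h0
  · rw [← h0]; positivity
  · exact le_of_mul_le_mul_right h6 h0

theorem continuous_expI_apply (a : Finset (Fin n)) (f : V) :
    Continuous fun x : a → ℝ => expI H a x f := by
  refine continuous_iff_continuousAt.2 fun x => ?_
  exact (jointSpectralMeasure H).tendsto_integral (M := 1) (fun y => measurable_phase a y)
    (fun y σ => (norm_phase a y σ).le) (boundedMeasurable_phase a x)
    (fun σ => ((continuous_phase a).comp (Continuous.prodMk_left σ)).continuousAt) f

/-- The step function approximating `phase a x` on `K(a)`. -/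
noncomputable def gridPhase (a : Finset (Fin n)) (K : Set (Fin n → ℝ)) (ε : ℝ) (x : a → ℝ) :
    (Fin n → ℝ) → ℂ :=
  (cyl K a).indicator fun σ =>
    Complex.exp (Complex.I * ((∑ j : a, x j * (ε * ⌊σ j / ε⌋) : ℝ) : ℂ))

theorem norm_gridPhase_le (a : Finset (Fin n)) (K : Set (Fin n → ℝ)) (ε : ℝ) (x : a → ℝ)
    (σ : Fin n → ℝ) : ‖gridPhase a K ε x σ‖ ≤ 1 := by
  refine (norm_indicator_le_norm_self _ _).trans ?_
  rw [mul_comm, Complex.norm_exp_ofReal_mul_I]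

theorem boundedMeasurable_gridPhase (a : Finset (Fin n)) {K : Set (Fin n → ℝ)} (hK : IsCompact K)
    (ε : ℝ) (x : a → ℝ) : BoundedMeasurable (gridPhase a K ε x) := by
  refine ⟨Measurable.indicator ?_ (measurableSet_cyl hK a), 1, norm_gridPhase_le a K ε x⟩
  refine Complex.measurable_exp.comp (measurable_const.mul (Complex.measurable_ofReal.comp ?_))
  refine Finset.measurable_sum _ fun j _ => measurable_const.mul (measurable_const.mul ?_)
  have hj : Measurable fun σ : Fin n → ℝ => σ j / ε := by fun_prop
  exact (measurable_of_countable (fun k : ℤ => (k : ℝ))).comp (Int.measurable_floor.comp hj)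

/-- The part of the cylinder over `K` that lies above a grid cube. -/
def cubeCyl (a : Finset (Fin n)) (K : Set (Fin n → ℝ)) (ε : ℝ) (k : a → ℤ) : Set (Fin n → ℝ) :=
  a.restrict ⁻¹' (gridCube ε k ∩ a.restrict '' K)

theorem measurableSet_cubeCyl (a : Finset (Fin n)) {K : Set (Fin n → ℝ)} (hK : IsCompact K)
    {ε : ℝ} (hε : 0 < ε) (k : a → ℤ) : MeasurableSet (cubeCyl a K ε k) :=
  ((measurableSet_gridCube hε k).inter (isCompact_restrict_image hK a).measurableSet).preimage
    (Finset.measurable_restrict a)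

theorem exists_gridPhase_eq_sum (a : Finset (Fin n)) {K : Set (Fin n → ℝ)} (hK : IsCompact K)
    {ε : ℝ} (hε : 0 < ε) : ∃ F : Finset (a → ℤ), ∀ (x : a → ℝ) (σ : Fin n → ℝ),
      gridPhase a K ε x σ = ∑ k ∈ F,
        Complex.exp (Complex.I * ((∑ j : a, x j * (ε * k j) : ℝ) : ℂ)) *
          (cubeCyl a K ε k).indicator (fun _ => (1 : ℂ)) σ := by
  classical
  obtain ⟨R, hR⟩ := exists_abs_le_of_isBounded hK.isBounded
  -- Finitely many cubes suffice because `K` has bounded coordinates.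
  refine ⟨Fintype.piFinset fun _ => Finset.Icc ⌊-R / ε⌋ ⌊R / ε⌋, fun x σ => ?_⟩
  by_cases hσ : σ ∈ cyl K a
  · have hσ' : a.restrict σ ∈ (a.restrict '' K : Set (a → ℝ)) := by
      rwa [cyl_eq_preimage] at hσ
    rw [Finset.sum_eq_single (fun j : a => ⌊σ j / ε⌋)]
    · rw [gridPhase, Set.indicator_of_mem hσ, Set.indicator_of_mem, mul_one]
      exact ⟨fun j => rfl, hσ'⟩
    · intro k _ hk
      rw [Set.indicator_of_notMem, mul_zero]
      exact fun h => hk (funext fun j => (h.1 j).symm)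
    · intro h
      refine absurd ?_ h
      obtain ⟨y, hy, hyσ⟩ := hσ
      simp only [Fintype.mem_piFinset, Finset.mem_Icc]
      intro j
      rw [hyσ j j.2]
      have := abs_le.1 (hR j y hy)
      exact ⟨Int.floor_mono (by gcongr; exact this.1), Int.floor_mono (by gcongr; exact this.2)⟩
  · rw [gridPhase, Set.indicator_of_notMem hσ]
    refine (Finset.sum_eq_zero fun k _ => ?_).symm
    rw [Set.indicator_of_notMem, mul_zero]
    rw [cyl_eq_preimage] at hσ
    exact fun h => hσ h.2

/-- A grid of side `ε = π/R` has frequencies orthogonal on the box of half-side `R`. Parseval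
contributes `(2R)^|a|` and the density bound on each cube `C ε^|a|`; their product `(2π)^|a| C` is
free of `R`. Continuity in `x` is recorded for the measurability needed in Fatou's lemma. -/
theorem lintegral_box_gridPhase_le (a : Finset (Fin n)) {K : Set (Fin n → ℝ)} (hK : IsCompact K)
    (A : V →L[ℂ] G) (C : ℝ≥0)
    (hA : ∀ h : G, ((((jointSpectralMeasure H).scalarMeasure
        (ContinuousLinearMap.adjoint A h)).map a.restrict).restrict
          (a.restrict '' K)) ≤ (C * ‖h‖₊ ^ 2) • (volume : Measure (a → ℝ)))
    {R : ℝ} (hR : 0 < R) (f : V) :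
    Continuous (fun x : a → ℝ =>
      A ((jointSpectralMeasure H).integral (gridPhase a K (Real.pi / R) x) f)) ∧
    ∫⁻ x in Set.univ.pi fun _ : a => Set.Ioc (-R) R,
      ‖A ((jointSpectralMeasure H).integral (gridPhase a K (Real.pi / R) x) f)‖ₑ ^ 2 ≤
      ENNReal.ofReal ((2 * Real.pi) ^ a.card * C) * ‖f‖ₑ ^ 2 := by
  classical
  set E := jointSpectralMeasure H
  set ε := Real.pi / R with hε
  have hε0 : 0 < ε := div_pos Real.pi_pos hR
  obtain ⟨F, hF⟩ := exists_gridPhase_eq_sum a hK hε0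
  have hmS := fun k => measurableSet_cubeCyl a hK hε0 k
  have hsum : ∀ x : a → ℝ, A (E.integral (gridPhase a K ε x) f) = ∑ k ∈ F,
      Complex.exp (Complex.I * ((∑ j : a, x j * (ε * k j) : ℝ) : ℂ)) •
        A (E.proj (cubeCyl a K ε k) f) := by
    intro x
    rw [funext (hF x), E.integral_finset_sum F fun k _ =>
      (BoundedMeasurable.indicator_one (hmS k)).const_mul _, sum_apply, map_sum]
    refine Finset.sum_congr rfl fun k _ => ?_
    rw [E.integral_const_mul _ (BoundedMeasurable.indicator_one (hmS k)),
      E.integral_indicator_one (hmS k), smul_apply, map_smul]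
  have hcont : Continuous fun x : a → ℝ => A (E.integral (gridPhase a K ε x) f) := by
    simp only [hsum]
    fun_prop
  refine ⟨hcont, ?_⟩
  have hcoef : ∀ k, ‖A (E.proj (cubeCyl a K ε k) f)‖ ^ 2 ≤
      (C * ε ^ a.card) * (E.scalarMeasure f).real (cubeCyl a K ε k) := by
    intro k
    refine norm_sq_apply_proj_le E A (hmS k) (by positivity) (fun h => ?_) f
    have h1 := hA h (gridCube ε k)
    rw [Measure.restrict_apply (measurableSet_gridCube hε0 k), Measure.map_apply
      (Finset.measurable_restrict a) ((measurableSet_gridCube hε0 k).inter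
        (isCompact_restrict_image hK a).measurableSet)] at h1
    refine h1.trans (le_of_eq ?_)
    have h2 : ((C * ‖h‖₊ ^ 2) • (volume : Measure (a → ℝ))) (gridCube ε k) =
        ((C * ‖h‖₊ ^ 2 : ℝ≥0) : ℝ≥0∞) * volume (gridCube ε k) := rfl
    rw [h2, volume_gridCube hε0, Fintype.card_coe, ← ENNReal.ofReal_coe_nnreal,
      ← ENNReal.ofReal_mul (NNReal.coe_nonneg _)]
    congr 1
    push_cast
    ring
  -- The cubes are disjoint, so their spectral masses add up to at most the total mass.
  have hdisj : ∑ k ∈ F, (E.scalarMeasure f).real (cubeCyl a K ε k) ≤ ‖f‖ ^ 2 := by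
    have h1 := sum_measure_le_measure_univ (μ := E.scalarMeasure f) (s := F)
      (t := cubeCyl a K ε) (fun k _ => (hmS k).nullMeasurableSet) (fun k _ l _ hkl =>
        Disjoint.aedisjoint (Set.disjoint_left.2 fun σ hk hl =>
          hkl (funext fun j => (hk.1 j).symm.trans (hl.1 j))))
    have h2 := ENNReal.toReal_mono (by finiteness) (h1.trans (E.scalarMeasure_le f _))
    rw [ENNReal.toReal_sum fun k _ => by finiteness] at h2
    simpa [measureReal_def] using h2
  have hreal : ∫ x in Set.univ.pi fun _ : a => Set.Ioc (-R) R,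
      ‖A (E.integral (gridPhase a K ε x) f)‖ ^ 2 ≤
      ((2 * Real.pi) ^ a.card * C) * ‖f‖ ^ 2 := by
    simp only [hsum]
    rw [hε, integral_box_norm_sq_sum_exp R hR F, ← hε, Fintype.card_coe]
    calc (2 * R) ^ a.card * ∑ k ∈ F, ‖A (E.proj (cubeCyl a K ε k) f)‖ ^ 2
        ≤ (2 * R) ^ a.card * ∑ k ∈ F, (C * ε ^ a.card) *
          (E.scalarMeasure f).real (cubeCyl a K ε k) := by
          gcongr with k; exact hcoef k
      _ = ((2 * R * ε) ^ a.card * C) * ∑ k ∈ F,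
          (E.scalarMeasure f).real (cubeCyl a K ε k) := by
          rw [← Finset.mul_sum, mul_pow (2 * R) ε]; ring
      _ ≤ ((2 * R * ε) ^ a.card * C) * ‖f‖ ^ 2 := by gcongr
      _ = _ := by
          have : 2 * R * ε = 2 * Real.pi := by rw [hε]; field_simp
          rw [this]
  have hint : Integrable (fun x => ‖A (E.integral (gridPhase a K ε x) f)‖ ^ 2)
      (volume.restrict (Set.univ.pi fun _ : a => Set.Ioc (-R) R)) := by
    refine ((hcont.norm.pow 2).continuousOn.integrableOn_compact
      (K := Set.univ.pi fun _ : a => Set.Icc (-R) R)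
      (isCompact_univ_pi fun _ => isCompact_Icc)).mono_set ?_
    exact Set.pi_mono fun _ _ => Set.Ioc_subset_Icc_self
  have h3 := ENNReal.ofReal_le_ofReal hreal
  rw [ofReal_integral_eq_lintegral_ofReal hint (Eventually.of_forall fun x => by positivity),
    ENNReal.ofReal_mul (by positivity)] at h3
  simpa [ENNReal.ofReal_pow] using h3

theorem lintegral_le_of_tendsto_of_le {α : Type*} [MeasurableSpace α] {μ : Measure α}
    {Φ : ℕ → α → ℝ≥0∞} {φ : α → ℝ≥0∞} (hm : ∀ N, Measurable (Φ N))
    (hlim : ∀ x, Tendsto (fun N => Φ N x) atTop (𝓝 (φ x))) {c : ℝ≥0∞}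
    (hc : ∀ N, ∫⁻ x, Φ N x ∂μ ≤ c) : ∫⁻ x, φ x ∂μ ≤ c := by
  calc ∫⁻ x, φ x ∂μ = ∫⁻ x, liminf (fun N => Φ N x) atTop ∂μ :=
        lintegral_congr fun x => (hlim x).liminf_eq.symm
    _ ≤ liminf (fun N => ∫⁻ x, Φ N x ∂μ) atTop := lintegral_liminf_le hm
    _ ≤ liminf (fun _ : ℕ => c) atTop := liminf_le_liminf (Eventually.of_forall hc)
    _ = c := liminf_const c

/-- Fatou's lemma along `R = N + 1`: the boxes exhaust `ℝ^a` while the grids shrink, and the step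
phases converge pointwise to the true phase on `K(a)`. -/
theorem lintegral_expI_proj_le (a : Finset (Fin n)) {K : Set (Fin n → ℝ)} (hK : IsCompact K)
    (A : V →L[ℂ] G) (C : ℝ≥0)
    (hA : ∀ h : G, ((((jointSpectralMeasure H).scalarMeasure
        (ContinuousLinearMap.adjoint A h)).map a.restrict).restrict
          (a.restrict '' K)) ≤ (C * ‖h‖₊ ^ 2) • (volume : Measure (a → ℝ))) (f : V) :
    ∫⁻ x : a → ℝ, ‖A (expI H a x ((jointSpectralMeasure H).proj (cyl K a) f))‖ₑ ^ 2 ≤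
      ENNReal.ofReal ((2 * Real.pi) ^ a.card * C) * ‖f‖ₑ ^ 2 := by
  set E := jointSpectralMeasure H
  let R : ℕ → ℝ := fun N => N + 1
  have hR : ∀ N, 0 < R N := fun N => by positivity
  have hRt : Tendsto R atTop atTop :=
    tendsto_atTop_add_const_right _ _ tendsto_natCast_atTop_atTop
  let Q : ℕ → Set (a → ℝ) := fun N => Set.univ.pi fun _ => Set.Ioc (-R N) (R N)
  have hQ : ∀ N, MeasurableSet (Q N) := fun N => MeasurableSet.univ_pi fun _ => measurableSet_Ioc
  have hstep := fun N => lintegral_box_gridPhase_le (H := H) a hK A C hA (hR N) f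
  refine lintegral_le_of_tendsto_of_le (Φ := fun N => (Q N).indicator fun x =>
    ‖A (E.integral (gridPhase a K (Real.pi / R N) x) f)‖ₑ ^ 2) (fun N => ?_) (fun x => ?_)
    fun N => ?_
  · exact ((continuous_enorm.comp (hstep N).1).measurable.pow_const 2).indicator (hQ N)
  · have hmem : ∀ᶠ N in atTop, x ∈ Q N := by
      filter_upwards [hRt.eventually_gt_atTop ‖x‖] with N hN j _
      have := abs_lt.1 ((norm_le_pi_norm x j).trans_lt hN)
      exact ⟨this.1, this.2.le⟩
    have hlim : Tendsto (fun N => A (E.integral (gridPhase a K (Real.pi / R N) x) f)) atTop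
        (𝓝 (A (expI H a x (E.proj (cyl K a) f)))) := by
      refine (A.continuous.tendsto _).comp ?_
      rw [expI_eq, E.integral_proj (boundedMeasurable_phase a x) (measurableSet_cyl hK a)]
      refine E.tendsto_integral (M := 1)
        (fun N => (boundedMeasurable_gridPhase a hK _ x).measurable)
        (fun N σ => norm_gridPhase_le a K _ x σ)
        ((boundedMeasurable_phase a x).indicator (measurableSet_cyl hK a)) (fun σ => ?_) f
      by_cases hσ : σ ∈ cyl K a
      · simp only [gridPhase, Set.indicator_of_mem hσ, phase]
        refine (Complex.continuous_exp.tendsto _).comp (Tendsto.const_mul _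
          ((Complex.continuous_ofReal.tendsto _).comp (tendsto_finsetSum _ fun j _ =>
            Tendsto.const_mul _ ?_)))
        exact tendsto_mul_floor_div _ (fun N => div_pos Real.pi_pos (hR N))
          (hRt.const_div_atTop _)
      · simp only [gridPhase, Set.indicator_of_notMem hσ]
        exact tendsto_const_nhds
    refine ((ENNReal.continuous_pow 2).tendsto _ |>.comp
      ((continuous_enorm.tendsto _).comp hlim)).congr' ?_
    filter_upwards [hmem] with N hN
    simp [Set.indicator_of_mem hN]
  · rw [lintegral_indicator (hQ N)]
    exact (hstep N).2

theorem LocallyBoundedDensity.locallySmooth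
    (hE : IsJointSpectralMeasure H (jointSpectralMeasure H)) (hT : GraphContinuous H T)
    {J : Set (Fin n → ℝ)} (hL : LocallyBoundedDensity H T J) : LocallySmooth H T J := by
  intro a ha K hKc hKJ
  obtain ⟨C, hC⟩ := hL a ha K hKc hKJ
  refine ⟨((2 * Real.pi) ^ a.card * C).toNNReal, fun f hf => ?_⟩
  let B : ℕ → Set (Fin n → ℝ) := fun N => Metric.closedBall 0 N
  have hB : ∀ N, Bornology.IsBounded (B N) := fun N => Metric.isBounded_closedBall
  have hBm : ∀ N, MeasurableSet (B N) := fun N => measurableSet_closedBall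
  have hlim : ∀ x, ∀ᶠ N in atTop, x ∈ B N := fun x => by
    filter_upwards [tendsto_natCast_atTop_atTop.eventually_ge_atTop ‖x‖] with N hN
    exact mem_closedBall_zero_iff.2 hN
  -- A second use of Fatou, possible because `C` does not depend on `B`. The hypothesis `E(K(a)) f ∈
  -- D(H)` gives the pointwise convergence of `T E(B_N)` to `T`.
  refine lintegral_le_of_tendsto_of_le (Φ := fun N x => ‖truncate H T (B N)
    (expI H a x ((jointSpectralMeasure H).proj (cyl K a) f))‖ₑ ^ 2) (fun N => ?_) (fun x => ?_)
    fun N => ?_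
  · exact (continuous_enorm.comp ((truncate H T (B N)).continuous.comp
      (continuous_expI_apply a _))).measurable.pow_const 2
  · exact (ENNReal.continuous_pow 2).tendsto _ |>.comp ((continuous_enorm.tendsto _).comp
      (tendsto_truncate hE hT hB hBm hlim (expI_mem_jointDomain hE a x hf)))
  · exact lintegral_expI_proj_le a hKc _ C (hC (B N) (hB N) (hBm N)) f

end KatoSmooth

/-! ### From bounded densities to (K), with near and far Poisson kernels -/

namespace KatoSmooth

theorem poisson_eq (l : ℝ) {m : ℝ} (hm : 0 < m) (t : ℝ) :
    poisson l m t = m⁻¹ * (1 + ((t - l) / m) ^ 2)⁻¹ := by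
  rw [poisson]
  field_simp
  ring

theorem integrable_poisson (l : ℝ) {m : ℝ} (hm : 0 < m) : Integrable (poisson l m) := by
  have h := ((integrable_inv_one_add_sq.comp_div hm.ne').comp_sub_right l).const_mul m⁻¹
  exact h.congr (Eventually.of_forall fun t => (poisson_eq l hm t).symm)

theorem integral_poisson (l : ℝ) {m : ℝ} (hm : 0 < m) : ∫ t, poisson l m t = Real.pi := by
  simp only [poisson_eq l hm]
  rw [integral_const_mul, integral_sub_right_eq_self (fun t => (1 + (t / m) ^ 2)⁻¹) l,
    Measure.integral_comp_div (fun t => (1 + t ^ 2)⁻¹), integral_univ_inv_one_add_sq,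
    abs_of_pos hm, smul_eq_mul, inv_mul_cancel_left₀ hm.ne']

theorem lintegral_prod_poisson {ι : Type*} [Fintype ι] (l m : ι → ℝ) (hm : ∀ j, 0 < m j) :
    ∫⁻ y : ι → ℝ, ∏ j, ENNReal.ofReal (poisson (l j) (m j) (y j)) =
      ENNReal.ofReal (Real.pi ^ Fintype.card ι) := by
  have h1 : ∀ y : ι → ℝ, ∏ j, ENNReal.ofReal (poisson (l j) (m j) (y j)) =
      ENNReal.ofReal (∏ j, poisson (l j) (m j) (y j)) := fun y =>
    (ENNReal.ofReal_prod_of_nonneg fun j _ => poisson_nonneg (hm j).le _).symm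
  simp only [h1]
  rw [volume_pi, ← ofReal_integral_eq_lintegral_ofReal
    (Integrable.fintype_prod fun j => integrable_poisson (l j) (hm j))
    (Eventually.of_forall fun y => Finset.prod_nonneg fun j _ => poisson_nonneg (hm j).le _),
    integral_fintype_prod_eq_prod (fun j => poisson (l j) (m j))]
  simp only [fun j => integral_poisson (l j) (hm j), Finset.prod_const, Finset.card_univ]

theorem poisson_le_of_lt {l m t δ : ℝ} (hδ : 0 < δ) (hm : 0 < m) (hm1 : m ≤ 1)
    (ht : δ < |t - l|) : poisson l m t ≤ ((t - l) ^ 2)⁻¹ := by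
  have h : 0 < (t - l) ^ 2 := by
    rw [← sq_abs]; exact pow_pos (hδ.trans ht) 2
  rw [poisson, div_le_iff₀ (by positivity), mul_add, inv_mul_cancel₀ h.ne']
  have : 0 ≤ ((t - l) ^ 2)⁻¹ * m ^ 2 := by positivity
  linarith

theorem poisson_le_of_lt' {l m t δ L : ℝ} (hδ : 0 < δ) (hm : 0 < m) (hm1 : m ≤ 1)
    (hl : |l| ≤ L) (ht : δ < |t - l|) :
    poisson l m t ≤ ((1 + 2 * L ^ 2) / δ ^ 2 + 2) * (1 + t ^ 2)⁻¹ := by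
  refine (poisson_le_of_lt hδ hm hm1 ht).trans ?_
  have hsq : δ ^ 2 ≤ (t - l) ^ 2 := by
    rw [← sq_abs (t - l)]; exact pow_le_pow_left₀ hδ.le ht.le 2
  have hδ2 : 0 < δ ^ 2 := by positivity
  have h : 0 < (t - l) ^ 2 := hδ2.trans_le hsq
  have hl2 : l ^ 2 ≤ L ^ 2 := sq_le_sq' (by linarith [neg_le_of_abs_le hl]) (le_of_abs_le hl)
  rw [← div_eq_mul_inv, le_div_iff₀ (by positivity), inv_mul_le_iff₀ h]
  have h1 : 1 + 2 * L ^ 2 ≤ (t - l) ^ 2 * ((1 + 2 * L ^ 2) / δ ^ 2) := by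
    rw [mul_div_assoc', le_div_iff₀ hδ2]
    nlinarith [sq_nonneg L]
  -- The hint encodes `t² ≤ 2(t - l)² + 2l²`: the difference of the two sides is `(t - 2l)²`.
  nlinarith [sq_nonneg (t - 2 * l)]

variable {V : Type*} [NormedAddCommGroup V] [InnerProductSpace ℂ V] [CompleteSpace V]
variable {G : Type*} [NormedAddCommGroup G] [InnerProductSpace ℂ G] [CompleteSpace G]
variable {n : ℕ} {H : Fin n → V →ₗ.[ℂ] V} {T : jointDomain H →ₗ[ℂ] G}

/-- Relative boundedness gives `‖(H_j - i)⁻¹ (T E(B))*‖ ≤ const`, uniformly in `B`. -/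
theorem RelativelyBounded.exists_lintegral_le
    (hE : IsJointSpectralMeasure H (jointSpectralMeasure H)) (hT : GraphContinuous H T) {j : Fin n}
    (hj : RelativelyBounded H T j) : ∃ D : ℝ≥0, ∀ B : Set (Fin n → ℝ),
      Bornology.IsBounded B → MeasurableSet B → ∀ h : G,
        ∫⁻ x, ENNReal.ofReal (1 + x j ^ 2)⁻¹ ∂((jointSpectralMeasure H).scalarMeasure
          (ContinuousLinearMap.adjoint (truncate H T B) h)) ≤ D * ‖h‖ₑ ^ 2 := by
  obtain ⟨C, hC⟩ := hj
  set E := jointSpectralMeasure H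
  refine ⟨⟨(|C| * 2) ^ 2, by positivity⟩, fun B hB hBm h => ?_⟩
  have him : (Complex.I).im ≠ 0 := by simp
  have him' : (-Complex.I).im ≠ 0 := by simp
  have hb := IsJointSpectralMeasure.boundedMeasurable_inv_sub j him
  have hb' := IsJointSpectralMeasure.boundedMeasurable_inv_sub j him'
  set A := E.integral fun x => ((x j : ℂ) - Complex.I)⁻¹ with hA
  have hAadj : ContinuousLinearMap.adjoint A =
      E.integral fun x => ((x j : ℂ) - (-Complex.I))⁻¹ := by
    rw [hA, E.adjoint_integral hb]
    congr 1
    ext x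
    simp
  have hnorm : ∀ t : ℝ, ‖((t : ℂ) - Complex.I)⁻¹‖ ^ 2 = (1 + t ^ 2)⁻¹ := by
    intro t
    rw [norm_inv, inv_pow, ← Complex.normSq_eq_norm_sq, Complex.normSq_apply]
    simp
    ring
  have hnorm' : ∀ t : ℝ, ‖((t : ℂ) - (-Complex.I))⁻¹‖ ^ 2 = (1 + t ^ 2)⁻¹ := by
    intro t
    rw [norm_inv, inv_pow, ← Complex.normSq_eq_norm_sq, Complex.normSq_apply]
    simp
    ring
  have hle : ∀ t : ℝ, (1 + t ^ 2)⁻¹ ≤ 1 := fun t => inv_le_one_of_one_le₀ (by nlinarith)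
  -- Here `A* = (H_j + i)⁻¹`. Both `(t + i)⁻¹` and `t (t + i)⁻¹` have modulus at most `1`, so each
  -- term of the relative bound costs at most `|C| ‖f‖`, whatever `B` is.
  have hTA : ‖truncate H T B ∘L ContinuousLinearMap.adjoint A‖ ≤ |C| * 2 := by
    refine ContinuousLinearMap.opNorm_le_bound _ (by positivity) fun f => ?_
    rw [ContinuousLinearMap.comp_apply, truncate_apply hE hT hB hBm]
    refine (hC _).trans ((mul_le_mul_of_nonneg_right (le_abs_self C) (by positivity)).trans ?_)
    rw [component_proj hE hB hBm, mul_assoc, two_mul]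
    obtain ⟨R, hR⟩ := exists_abs_le_of_isBounded hB
    gcongr
    · refine (E.norm_proj_le hBm _).trans ?_
      rw [hAadj]
      refine (E.norm_integral_le hb'.measurable (M := 1) (fun x => ?_) f).trans (by simp)
      exact (sq_le_one_iff₀ (norm_nonneg _)).1 ((hnorm' _).trans_le (hle _))
    · have hbx := IsJointSpectralMeasure.boundedMeasurable_indicator_coord hBm (hR j)
      rw [hAadj, E.integral_mul_apply hbx hb']
      refine (E.norm_integral_le (hbx.mul hb').measurable (M := 1) (fun x => ?_) f).trans (by simp)
      refine (sq_le_one_iff₀ (norm_nonneg _)).1 ?_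
      rw [norm_mul, mul_pow, hnorm', ← div_eq_mul_inv, div_le_one (by positivity)]
      by_cases hx : x ∈ B
      · simp [hx]
      · simp [hx]; positivity
  have hAT : ‖A ∘L ContinuousLinearMap.adjoint (truncate H T B)‖ ≤ |C| * 2 := by
    rw [← LinearIsometryEquiv.norm_map ContinuousLinearMap.adjoint,
      ContinuousLinearMap.adjoint_comp, ContinuousLinearMap.adjoint_adjoint]
    exact hTA
  have h1 : ‖A (ContinuousLinearMap.adjoint (truncate H T B) h)‖ₑ ^ 2 ≤
      (ENNReal.ofReal (|C| * 2) * ‖h‖ₑ) ^ 2 := by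
    gcongr
    rw [← ofReal_norm, ← ofReal_norm h, ← ENNReal.ofReal_mul (by positivity)]
    exact ENNReal.ofReal_le_ofReal (ContinuousLinearMap.le_of_opNorm_le _ hAT h)
  rw [hA, E.enorm_integral_sq hb] at h1
  have h2 : ∀ x : Fin n → ℝ, ‖((x j : ℂ) - Complex.I)⁻¹‖ₑ ^ 2 =
      ENNReal.ofReal (1 + x j ^ 2)⁻¹ := fun x => by
    rw [← ofReal_norm, ← ENNReal.ofReal_pow (norm_nonneg _), hnorm]
  simp only [h2] at h1
  refine h1.trans (le_of_eq ?_)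
  rw [mul_pow, ← ENNReal.ofReal_pow (by positivity)]
  congr 1
  exact ENNReal.ofReal_eq_coe_nnreal _

/-- The witness takes the coordinates of `σ` in `c` and those of `λ` elsewhere; in the sup norm it
stays within `δ` of `λ`. -/
theorem mem_cyl_cthickening {K : Set (Fin n → ℝ)} {δ : ℝ} (hδ : 0 ≤ δ) {lam σ : Fin n → ℝ}
    (hlam : lam ∈ K) {c : Finset (Fin n)} (h : ∀ j ∈ c, |σ j - lam j| ≤ δ) :
    σ ∈ cyl (Metric.cthickening δ K) c := by
  classical
  refine ⟨fun j => if j ∈ c then σ j else lam j, ?_, fun j hj => by simp [hj]⟩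
  refine Metric.mem_cthickening_of_dist_le _ lam δ K hlam ((dist_pi_le_iff hδ).2 fun j => ?_)
  by_cases hj : j ∈ c
  · simpa [hj, Real.dist_eq] using h j hj
  · simpa [hj] using hδ

/-- The Poisson kernel at distance at most `δ` from its centre. -/
noncomputable def nearPoisson (δ l m t : ℝ) : ℝ≥0∞ :=
  {t : ℝ | |t - l| ≤ δ}.indicator (fun t => ENNReal.ofReal (poisson l m t)) t

/-- The Poisson kernel at distance more than `δ` from its centre. -/
noncomputable def farPoisson (δ l m t : ℝ) : ℝ≥0∞ :=
  {t : ℝ | |t - l| ≤ δ}ᶜ.indicator (fun t => ENNReal.ofReal (poisson l m t)) t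

theorem nearPoisson_of_le {δ l m t : ℝ} (h : |t - l| ≤ δ) :
    nearPoisson δ l m t = ENNReal.ofReal (poisson l m t) :=
  Set.indicator_of_mem (s := {t : ℝ | |t - l| ≤ δ}) h _

theorem nearPoisson_of_lt {δ l m t : ℝ} (h : δ < |t - l|) : nearPoisson δ l m t = 0 :=
  Set.indicator_of_notMem (s := {t : ℝ | |t - l| ≤ δ}) (not_le.2 h) _

theorem nearPoisson_add_farPoisson (δ l m t : ℝ) :
    nearPoisson δ l m t + farPoisson δ l m t = ENNReal.ofReal (poisson l m t) :=
  congrFun (Set.indicator_self_add_compl _ _) t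

theorem measurable_nearPoisson (δ l m : ℝ) : Measurable (nearPoisson δ l m) :=
  (measurable_poisson l m).ennreal_ofReal.indicator
    (measurableSet_le (measurable_id.sub_const l).abs measurable_const)

theorem measurable_farPoisson (δ l m : ℝ) : Measurable (farPoisson δ l m) :=
  (measurable_poisson l m).ennreal_ofReal.indicator
    (measurableSet_le (measurable_id.sub_const l).abs measurable_const).compl

theorem farPoisson_le {l m t δ : ℝ} (hδ : 0 < δ) (hm : 0 < m) (hm1 : m ≤ 1) :
    farPoisson δ l m t ≤ ENNReal.ofReal (δ ^ 2)⁻¹ := by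
  by_cases ht : |t - l| ≤ δ
  · rw [farPoisson, Set.indicator_of_notMem (by simpa using ht)]
    exact zero_le
  · rw [farPoisson, Set.indicator_of_mem ht]
    rw [not_le] at ht
    refine ENNReal.ofReal_le_ofReal ((poisson_le_of_lt hδ hm hm1 ht).trans ?_)
    rw [← sq_abs (t - l)]
    gcongr

theorem farPoisson_le' {l m t δ L : ℝ} (hδ : 0 < δ) (hm : 0 < m) (hm1 : m ≤ 1) (hl : |l| ≤ L) :
    farPoisson δ l m t ≤ ENNReal.ofReal ((1 + 2 * L ^ 2) / δ ^ 2 + 2) *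
      ENNReal.ofReal (1 + t ^ 2)⁻¹ := by
  by_cases ht : |t - l| ≤ δ
  · rw [farPoisson, Set.indicator_of_notMem (by simpa using ht)]
    exact zero_le
  · rw [farPoisson, Set.indicator_of_mem ht, ← ENNReal.ofReal_mul (by positivity)]
    rw [not_le] at ht
    exact ENNReal.ofReal_le_ofReal (poisson_le_of_lt' hδ hm hm1 hl ht)

/-- The near product is supported above the `δ`-thickening of `K`, where the density bound allows
replacing the measure by Lebesgue measure. Each Poisson kernel then integrates to `π`, for every
width. -/
theorem lintegral_prod_nearPoisson_le {c : Finset (Fin n)} {K : Set (Fin n → ℝ)} {δ : ℝ}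
    (hK : IsCompact K) (hδ : 0 ≤ δ) (ν : Measure (Fin n → ℝ)) (M : ℝ≥0)
    (hν : (ν.map c.restrict).restrict (c.restrict '' Metric.cthickening δ K) ≤
      M • (volume : Measure (c → ℝ))) {lam mu : Fin n → ℝ} (hlam : lam ∈ K)
    (hmu : ∀ j, 0 < mu j) :
    ∫⁻ σ, ∏ j ∈ c, nearPoisson δ (lam j) (mu j) (σ j) ∂ν ≤
      M * ENNReal.ofReal (Real.pi ^ c.card) := by
  have hKδ : IsCompact (Metric.cthickening δ K) := hK.cthickening
  have hmeas := Finset.measurable_restrict (X := fun _ : Fin n => ℝ) c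
  have hK' := (isCompact_restrict_image hKδ c).measurableSet
  have hm : Measurable fun y : c → ℝ =>
      ∏ j : c, ENNReal.ofReal (poisson (lam j) (mu j) (y j)) :=
    Finset.measurable_prod _ fun j _ =>
      ((measurable_poisson _ _).comp (measurable_pi_apply j)).ennreal_ofReal
  have hle : ∀ σ, ∏ j ∈ c, nearPoisson δ (lam j) (mu j) (σ j) ≤
      (cyl (Metric.cthickening δ K) c).indicator (fun σ : Fin n → ℝ =>
        ∏ j : c, ENNReal.ofReal (poisson (lam j) (mu j) (c.restrict σ j))) σ := by
    intro σ
    by_cases h : ∀ j ∈ c, |σ j - lam j| ≤ δ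
    · rw [Set.indicator_of_mem (mem_cyl_cthickening hδ hlam h)]
      refine le_of_eq ?_
      rw [← Finset.prod_coe_sort c (fun j => nearPoisson δ (lam j) (mu j) (σ j))]
      exact Finset.prod_congr rfl fun j _ => nearPoisson_of_le (h j j.2)
    · push Not at h
      obtain ⟨j, hj, hjδ⟩ := h
      rw [Finset.prod_eq_zero hj (nearPoisson_of_lt hjδ)]
      exact zero_le
  calc ∫⁻ σ, ∏ j ∈ c, nearPoisson δ (lam j) (mu j) (σ j) ∂ν
      ≤ ∫⁻ σ in c.restrict ⁻¹' (c.restrict '' Metric.cthickening δ K),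
        ∏ j : c, ENNReal.ofReal (poisson (lam j) (mu j) (c.restrict σ j)) ∂ν := by
        rw [← cyl_eq_preimage, ← lintegral_indicator (measurableSet_cyl hKδ c)]
        exact lintegral_mono hle
    _ = ∫⁻ y, ∏ j : c, ENNReal.ofReal (poisson (lam j) (mu j) (y j))
        ∂((ν.map c.restrict).restrict (c.restrict '' Metric.cthickening δ K)) := by
        rw [setLIntegral_map hK' hm hmeas]
    _ ≤ ∫⁻ y, ∏ j : c, ENNReal.ofReal (poisson (lam j) (mu j) (y j))
        ∂(M • (volume : Measure (c → ℝ))) := lintegral_mono' hν le_rfl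
    _ = _ := by
        rw [lintegral_smul_measure, lintegral_prod_poisson (fun j : c => lam j)
          (fun j : c => mu j) (fun j => hmu j), Fintype.card_coe, ENNReal.smul_def, smul_eq_mul]

/-- The density is used on `ℝ^c` rather than `ℝ^a`, which is why the conditions are imposed for all
nonempty subsets. Only the term without near factors needs relative boundedness. -/
theorem LocallyBoundedDensity.exists_lintegral_near_far_le
    (hE : IsJointSpectralMeasure H (jointSpectralMeasure H)) (hT : GraphContinuous H T)
    {J : Set (Fin n → ℝ)} (hL : LocallyBoundedDensity H T J)
    (hrel : ∀ j, RelativelyBounded H T j) {K : Set (Fin n → ℝ)} (hK : IsCompact K) {δ : ℝ}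
    (hδ : 0 < δ) (hKJ : Metric.cthickening δ K ⊆ J) {a : Finset (Fin n)} (ha : a.Nonempty)
    (c : Finset (Fin n)) :
    ∃ M : ℝ≥0, ∀ lam ∈ K, ∀ mu : Fin n → ℝ, (∀ j, mu j ∈ Set.Ioo (0 : ℝ) 1) →
      ∀ B : Set (Fin n → ℝ), Bornology.IsBounded B → MeasurableSet B → ∀ h : G,
        ∫⁻ σ, (∏ j ∈ c, nearPoisson δ (lam j) (mu j) (σ j)) *
          (∏ j ∈ a \ c, farPoisson δ (lam j) (mu j) (σ j))
          ∂((jointSpectralMeasure H).scalarMeasure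
            (ContinuousLinearMap.adjoint (truncate H T B) h)) ≤ M * ‖h‖ₑ ^ 2 := by
  set D := (δ ^ 2)⁻¹.toNNReal with hD
  -- If all factors are far, one of them is bounded by a multiple of `(1 + x_j²)⁻¹`, whose integral
  -- is controlled by relative boundedness; the others are at most `δ⁻²`.
  rcases c.eq_empty_or_nonempty with rfl | hc
  · obtain ⟨j, hj⟩ := ha
    obtain ⟨D₂, hD₂⟩ := (hrel j).exists_lintegral_le hE hT
    obtain ⟨L, hLb⟩ := exists_abs_le_of_isBounded hK.isBounded
    refine ⟨((1 + 2 * L ^ 2) / δ ^ 2 + 2).toNNReal * D ^ (a.erase j).card * D₂,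
      fun lam hlam mu hmu B hB hBm h => ?_⟩
    have hle : ∀ σ : Fin n → ℝ, (∏ j ∈ (∅ : Finset (Fin n)),
        nearPoisson δ (lam j) (mu j) (σ j)) *
          (∏ j ∈ a \ ∅, farPoisson δ (lam j) (mu j) (σ j)) ≤
        (ENNReal.ofReal ((1 + 2 * L ^ 2) / δ ^ 2 + 2) * (D : ℝ≥0∞) ^ (a.erase j).card) *
          ENNReal.ofReal (1 + σ j ^ 2)⁻¹ := by
      intro σ
      rw [Finset.prod_empty, one_mul, Finset.sdiff_empty, ← Finset.mul_prod_erase a _ hj,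
        mul_right_comm]
      gcongr
      · exact farPoisson_le' hδ (hmu j).1 (hmu j).2.le (hLb j lam hlam)
      · exact Finset.prod_le_pow_card _ _ _ fun i _ =>
          farPoisson_le hδ (hmu i).1 (hmu i).2.le
    refine (lintegral_mono hle).trans ?_
    rw [lintegral_const_mul' _ _ (by finiteness)]
    refine (mul_le_mul_right (hD₂ B hB hBm h) _).trans (le_of_eq ?_)
    push_cast
    rw [ENNReal.ofReal]
    ring
  · obtain ⟨C, hC⟩ := hL c hc _ hK.cthickening hKJ
    refine ⟨C * (Real.pi ^ c.card).toNNReal * D ^ (a \ c).card,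
      fun lam hlam mu hmu B hB hBm h => ?_⟩
    have hle : ∀ σ : Fin n → ℝ, (∏ j ∈ c, nearPoisson δ (lam j) (mu j) (σ j)) *
          (∏ j ∈ a \ c, farPoisson δ (lam j) (mu j) (σ j)) ≤
        (∏ j ∈ c, nearPoisson δ (lam j) (mu j) (σ j)) * (D : ℝ≥0∞) ^ (a \ c).card := by
      intro σ
      gcongr
      exact Finset.prod_le_pow_card _ _ _ fun i _ => farPoisson_le hδ (hmu i).1 (hmu i).2.le
    refine (lintegral_mono hle).trans ?_
    rw [lintegral_mul_const' _ _ (by finiteness)]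
    refine (mul_le_mul_left (lintegral_prod_nearPoisson_le hK hδ.le _ _ (hC B hB hBm h) hlam
      (fun j => (hmu j).1)) _).trans (le_of_eq ?_)
    push_cast
    rw [ENNReal.ofReal, enorm_eq_nnnorm]
    ring

theorem LocallyBoundedDensity.katoCondition
    (hE : IsJointSpectralMeasure H (jointSpectralMeasure H)) (hT : GraphContinuous H T)
    {J : Set (Fin n → ℝ)} (hJ : IsOpen J) (hL : LocallyBoundedDensity H T J)
    (hrel : ∀ j, RelativelyBounded H T j) : KatoCondition H T J := by
  intro a ha K hK hKJ
  -- Openness of `J` leaves room for a thickening of `K`, needed because near kernels reach distance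
  -- `δ` from `K`.
  obtain ⟨δ, hδ, hδJ⟩ := hK.exists_cthickening_subset_open hJ hKJ
  choose M hM using hL.exists_lintegral_near_far_le hE hT hrel hK hδ hδJ ha
  refine lt_of_le_of_lt ?_ (ENNReal.coe_lt_top (r := ∑ c ∈ a.powerset, M c))
  refine iSup₂_le fun lam hlam => iSup₂_le fun mu hmu => ?_
  refine katoNorm_le hE a lam mu (fun j => (hmu j).1) _ fun B hB hBm h => ?_
  simp only [← nearPoisson_add_farPoisson δ, Finset.prod_add]
  rw [lintegral_finsetSum]
  · push_cast
    rw [Finset.sum_mul]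
    exact Finset.sum_le_sum fun c _ => hM c lam hlam mu hmu B hB hBm h
  · intro c _
    exact (Finset.measurable_prod _ fun j _ =>
      (measurable_nearPoisson _ _ _).comp (measurable_pi_apply j)).mul
      (Finset.measurable_prod _ fun j _ =>
        (measurable_farPoisson _ _ _).comp (measurable_pi_apply j))

end KatoSmooth

/-! ### The projection-valued measure of a star homomorphism -/

open scoped CompactlySupported

namespace StarHomMeasure

variable {Y : Type*} [MetricSpace Y] [CompactSpace Y] [MeasurableSpace Y] [BorelSpace Y]
variable {V : Type*} [NormedAddCommGroup V] [InnerProductSpace ℂ V] [CompleteSpace V]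
variable (Ψ : C(Y, ℂ) →⋆ₐ[ℂ] (V →L[ℂ] V))

/-- A real continuous function, as a complex one. -/
def complexify (φ : C(Y, ℝ)) : C(Y, ℂ) := ⟨fun y => (φ y : ℂ), by fun_prop⟩

theorem inner_mul (φ ψ : C(Y, ℂ)) (f : V) : ⟪Ψ φ f, Ψ ψ f⟫_ℂ = ⟪f, Ψ (star φ * ψ) f⟫_ℂ := by
  rw [map_mul, map_star, ContinuousLinearMap.star_eq_adjoint]
  exact (ContinuousLinearMap.adjoint_inner_right _ _ _).symm

/-- Positivity comes from writing `φ` as the square of the real function `√φ`; this makes the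
Riesz–Markov theorem applicable. -/
theorem inner_complexify_nonneg {φ : C(Y, ℝ)} (hφ : ∀ y, 0 ≤ φ y) (f : V) :
    ⟪f, Ψ (complexify φ) f⟫_ℂ =
      ((‖Ψ (complexify ⟨fun y => √(φ y), by fun_prop⟩) f‖ ^ 2 : ℝ) : ℂ) := by
  have h : complexify φ = star (complexify ⟨fun y => √(φ y), by fun_prop⟩) *
      complexify ⟨fun y => √(φ y), by fun_prop⟩ := by
    ext y
    simp only [complexify, ContinuousMap.coe_mk, ContinuousMap.mul_apply, ContinuousMap.star_apply,
      RCLike.star_def, Complex.conj_ofReal]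
    rw [← Complex.ofReal_mul, Real.mul_self_sqrt (hφ y)]
  rw [h, ← inner_mul, inner_self_eq_norm_sq_to_K]
  norm_cast

/-- The positive functional `φ ↦ ⟨f, Ψ(φ) f⟩`. -/
noncomputable def functional (f : V) : C_c(Y, ℝ) →ₚ[ℝ] ℝ :=
  PositiveLinearMap.mk₀
    { toFun := fun φ => (⟪f, Ψ (complexify (φ : C(Y, ℝ))) f⟫_ℂ).re
      map_add' := fun φ ψ => by
        have : complexify ((φ + ψ : C_c(Y, ℝ)) : C(Y, ℝ)) =
            complexify (φ : C(Y, ℝ)) + complexify (ψ : C(Y, ℝ)) := by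
          ext y; simp [complexify]
        rw [this, map_add, add_apply, inner_add_right, Complex.add_re]
      map_smul' := fun c φ => by
        have : complexify ((c • φ : C_c(Y, ℝ)) : C(Y, ℝ)) =
            (c : ℂ) • complexify (φ : C(Y, ℝ)) := by
          ext y; simp [complexify]
        rw [this, map_smul, smul_apply, inner_smul_right, Complex.re_ofReal_mul]
        rfl }
    (fun φ hφ => by
      have h := inner_complexify_nonneg Ψ (φ := (φ : C(Y, ℝ))) (fun y => hφ y) f
      change 0 ≤ (⟪f, Ψ (complexify (φ : C(Y, ℝ))) f⟫_ℂ).re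
      rw [h, Complex.ofReal_re]
      positivity)

/-- The measure `μ_f` with `∫ φ dμ_f = ⟨f, Ψ(φ) f⟩`. -/
noncomputable def measure (f : V) : Measure Y := RealRMK.rieszMeasure (functional Ψ f)

instance (f : V) : IsFiniteMeasure (measure Ψ f) := by unfold measure; infer_instance

theorem integral_real (f : V) (φ : C(Y, ℝ)) :
    ∫ y, φ y ∂(measure Ψ f) = (⟪f, Ψ (complexify φ) f⟫_ℂ).re :=
  RealRMK.integral_rieszMeasure (functional Ψ f)
    (CompactlySupportedContinuousMap.continuousMapEquiv φ)

theorem inner_complexify_im (f : V) (φ : C(Y, ℝ)) : (⟪f, Ψ (complexify φ) f⟫_ℂ).im = 0 := by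
  have h : star (complexify φ) = complexify φ := by
    ext y; simp [complexify]
  have h2 : ⟪Ψ (complexify φ) f, f⟫_ℂ = ⟪f, Ψ (complexify φ) f⟫_ℂ := by
    have := inner_mul Ψ (complexify φ) 1 f
    rwa [mul_one, h, map_one, one_apply_eq_self] at this
  rw [← Complex.conj_eq_iff_im, inner_conj_symm, h2]

theorem integral_eq (f : V) (φ : C(Y, ℂ)) :
    ∫ y, φ y ∂(measure Ψ f) = ⟪f, Ψ φ f⟫_ℂ := by
  let φr : C(Y, ℝ) := ⟨fun y => (φ y).re, by fun_prop⟩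
  let φi : C(Y, ℝ) := ⟨fun y => (φ y).im, by fun_prop⟩
  have hφ : φ = complexify φr + Complex.I • complexify φi := by
    ext y
    simp only [φr, φi, complexify, ContinuousMap.add_apply, ContinuousMap.coe_mk,
      ContinuousMap.smul_apply, smul_eq_mul]
    rw [mul_comm]
    exact (Complex.re_add_im _).symm
  have hr : ∀ φ : C(Y, ℝ), ∫ y, (complexify φ) y ∂(measure Ψ f) =
      ⟪f, Ψ (complexify φ) f⟫_ℂ := by
    intro φ
    have h1 : ∫ y, (complexify φ) y ∂(measure Ψ f) = ((∫ y, φ y ∂(measure Ψ f) : ℝ) : ℂ) :=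
      integral_complex_ofReal
    rw [h1, integral_real]
    exact Complex.ext (by simp) (by simp [inner_complexify_im])
  have hint : ∀ φ : C(Y, ℂ), Integrable φ (measure Ψ f) := fun φ =>
    φ.continuous.integrable_of_hasCompactSupport (HasCompactSupport.of_compactSpace _)
  rw [hφ, map_add, map_smul, add_apply, smul_apply, inner_add_right, inner_smul_right, ← hr, ← hr,
    ← MeasureTheory.integral_const_mul, ← integral_add (hint _) ((hint _).const_mul _)]
  rfl

theorem boundedMeasurable_continuous (φ : C(Y, ℂ)) : BoundedMeasurable φ :=
  ⟨φ.continuous.measurable, ‖φ‖, φ.norm_coe_le_norm⟩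

theorem norm_sq_eq (f : V) (φ : C(Y, ℂ)) :
    ‖Ψ φ f‖ ^ 2 = ∫ y, ‖φ y‖ ^ 2 ∂(measure Ψ f) := by
  apply Complex.ofReal_injective
  have h1 : ((‖Ψ φ f‖ ^ 2 : ℝ) : ℂ) = ⟪Ψ φ f, Ψ φ f⟫_ℂ := by
    rw [inner_self_eq_norm_sq_to_K]; norm_cast
  rw [h1, inner_mul, ← integral_eq, ← integral_complex_ofReal]
  refine integral_congr_ae (Eventually.of_forall fun y => ?_)
  simp only [ContinuousMap.mul_apply, ContinuousMap.star_apply, RCLike.star_def]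
  rw [mul_comm, Complex.mul_conj, Complex.normSq_eq_norm_sq]

theorem enorm_eq_eLpNorm_of_norm_sq_eq {μ : Measure Y} [IsFiniteMeasure μ] {φ : Y → ℂ}
    (hφ : BoundedMeasurable φ) (v : V) :
    ‖v‖ₑ = eLpNorm φ 2 μ ↔ ‖v‖ ^ 2 = ∫ y, ‖φ y‖ ^ 2 ∂μ := by
  have h1 : (eLpNorm φ 2 μ) ^ 2 = ENNReal.ofReal (∫ y, ‖φ y‖ ^ 2 ∂μ) := by
    have := eLpNorm_nnreal_pow_eq_lintegral (μ := μ) (f := φ) (p := 2) two_ne_zero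
    rw [ofReal_integral_eq_lintegral_ofReal (hφ.integrable_norm_sq _)
      (Eventually.of_forall fun x => by positivity)]
    simp only [NNReal.coe_ofNat, ENNReal.coe_ofNat, ENNReal.rpow_ofNat] at this
    rw [this]
    simp [ENNReal.ofReal_pow]
  have h0 : 0 ≤ ∫ y, ‖φ y‖ ^ 2 ∂μ := integral_nonneg fun y => by positivity
  constructor
  · intro h
    rw [← h, ← ofReal_norm, ← ENNReal.ofReal_pow (norm_nonneg _)] at h1
    exact (ENNReal.ofReal_eq_ofReal_iff (by positivity) h0).1 h1
  · intro h
    rw [← h, ENNReal.ofReal_pow (norm_nonneg _), ofReal_norm] at h1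
    exact ((ENNReal.pow_right_strictMono two_ne_zero).injective h1).symm

theorem enorm_eq (f : V) (φ : C(Y, ℂ)) : ‖Ψ φ f‖ₑ = eLpNorm φ 2 (measure Ψ f) :=
  (enorm_eq_eLpNorm_of_norm_sq_eq (boundedMeasurable_continuous φ) _).2 (norm_sq_eq Ψ f φ)

theorem edist_eq (f : V) (φ ψ : C(Y, ℂ)) :
    edist (Ψ φ f) (Ψ ψ f) = eLpNorm (⇑φ - ⇑ψ) 2 (measure Ψ f) := by
  rw [edist_eq_enorm_sub, ← sub_apply, ← map_sub, enorm_eq]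
  rfl

theorem memLp {φ : Y → ℂ} (hφ : BoundedMeasurable φ) (μ : Measure Y) [IsFiniteMeasure μ] :
    MemLp φ 2 μ := by
  obtain ⟨M, hM⟩ := hφ.bounded
  exact MemLp.of_bound hφ.measurable.aestronglyMeasurable M (Eventually.of_forall hM)

theorem exists_seq_tendsto_eLpNorm {φ : Y → ℂ} (hφ : BoundedMeasurable φ) (μ : Measure Y)
    [IsFiniteMeasure μ] : ∃ s : ℕ → C(Y, ℂ),
      Tendsto (fun k => eLpNorm (⇑(s k) - φ) 2 μ) atTop (𝓝 0) := by
  have h : ∀ k : ℕ, ∃ s : C(Y, ℂ), eLpNorm (⇑s - φ) 2 μ ≤ ((k : ℝ≥0∞) + 1)⁻¹ := fun k => by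
    obtain ⟨g, hg, -⟩ := (memLp hφ μ).exists_boundedContinuous_eLpNorm_sub_le (by simp)
      (ε := ((k : ℝ≥0∞) + 1)⁻¹) (by simp)
    exact ⟨g.toContinuousMap, by rw [eLpNorm_sub_comm]; exact hg⟩
  choose s hs using h
  refine ⟨s, tendsto_of_tendsto_of_tendsto_of_le_of_le tendsto_const_nhds ?_
    (fun _ => zero_le) hs⟩
  have := ENNReal.tendsto_inv_nat_nhds_zero.comp (tendsto_add_atTop_nat 1)
  refine this.congr fun k => ?_
  simp

theorem tendsto_of_edist_eq {φ : Y → ℂ} {f v : V}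
    (hv : ∀ ψ : C(Y, ℂ), edist (Ψ ψ f) v = eLpNorm (⇑ψ - φ) 2 (measure Ψ f)) {s : ℕ → C(Y, ℂ)}
    (hs : Tendsto (fun k => eLpNorm (⇑(s k) - φ) 2 (measure Ψ f)) atTop (𝓝 0)) :
    Tendsto (fun k => Ψ (s k) f) atTop (𝓝 v) := by
  rw [tendsto_iff_edist_tendsto_0]
  simpa only [hv] using hs

/-- The map `ψ ↦ Ψ(ψ) f` is isometric for the `L²(μ_f)` norm, and continuous functions are dense
there, so it extends to `φ`. The distances to all `Ψ(ψ) f` determine the extended vector. -/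
theorem exists_vector {φ : Y → ℂ} (hφ : BoundedMeasurable φ) (f : V) :
    ∃ v : V, ∀ ψ : C(Y, ℂ), edist (Ψ ψ f) v = eLpNorm (⇑ψ - φ) 2 (measure Ψ f) := by
  obtain ⟨s, hs⟩ := exists_seq_tendsto_eLpNorm hφ (measure Ψ f)
  have hmem := fun ψ : C(Y, ℂ) => memLp (boundedMeasurable_continuous ψ) (measure Ψ f)
  have hdist : ∀ ψ ψ' : C(Y, ℂ), edist (Ψ ψ f) (Ψ ψ' f) =
      edist (hmem ψ).toLp (hmem ψ').toLp := fun ψ ψ' => by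
    rw [edist_eq, Lp.edist_toLp_toLp]
  have hlim : Tendsto (fun k => (hmem (s k)).toLp) atTop (𝓝 (memLp hφ (measure Ψ f)).toLp) := by
    rw [tendsto_iff_edist_tendsto_0]
    simpa only [Lp.edist_toLp_toLp] using hs
  have hc : CauchySeq fun k => Ψ (s k) f := by
    have h1 := hlim.cauchySeq
    rw [EMetric.cauchySeq_iff] at h1 ⊢
    simpa only [hdist] using h1
  obtain ⟨v, hv⟩ := cauchySeq_tendsto_of_complete hc
  refine ⟨v, fun ψ => ?_⟩
  have h2 := (tendsto_const_nhds (x := (hmem ψ).toLp)).edist hlim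
  rw [Lp.edist_toLp_toLp] at h2
  refine tendsto_nhds_unique ((tendsto_const_nhds (x := Ψ ψ f)).edist hv) (h2.congr fun k => ?_)
  rw [hdist]

theorem exists_operator {φ : Y → ℂ} (hφ : BoundedMeasurable φ) : ∃ A : V →L[ℂ] V, ∀ f,
    ∀ ψ : C(Y, ℂ), edist (Ψ ψ f) (A f) = eLpNorm (⇑ψ - φ) 2 (measure Ψ f) := by
  choose A hA using exists_vector Ψ hφ
  have hle : ∀ {s : ℕ → C(Y, ℂ)} {μ ν : Measure Y}, μ ≤ ν →
      Tendsto (fun k => eLpNorm (⇑(s k) - φ) 2 ν) atTop (𝓝 0) →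
      Tendsto (fun k => eLpNorm (⇑(s k) - φ) 2 μ) atTop (𝓝 0) := fun hμν h =>
    tendsto_of_tendsto_of_tendsto_of_le_of_le tendsto_const_nhds h (fun _ => zero_le)
      fun _ => eLpNorm_mono_measure _ hμν
  obtain ⟨M, hM⟩ := hφ.bounded
  let L : V →ₗ[ℂ] V :=
    { toFun := A
      map_add' := fun f g => by
        -- Additivity needs one sequence that converges for `f`, `g` and `f + g` at once, hence
        -- approximation in `L²` of the sum of the three measures.
        obtain ⟨s, hs⟩ := exists_seq_tendsto_eLpNorm hφ
          (measure Ψ f + measure Ψ g + measure Ψ (f + g))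
        have h1 := tendsto_of_edist_eq Ψ (hA f) (hle (Measure.le_add_right (Measure.le_add_right le_rfl)) hs)
        have h2 := tendsto_of_edist_eq Ψ (hA g) (hle (Measure.le_add_right (Measure.le_add_left le_rfl)) hs)
        have h3 := tendsto_of_edist_eq Ψ (hA (f + g)) (hle (Measure.le_add_left le_rfl) hs)
        refine tendsto_nhds_unique h3 ((h1.add h2).congr fun k => ?_)
        rw [map_add]
      map_smul' := fun c f => by
        obtain ⟨s, hs⟩ := exists_seq_tendsto_eLpNorm hφ (measure Ψ f + measure Ψ (c • f))
        have h1 := tendsto_of_edist_eq Ψ (hA f) (hle (Measure.le_add_right le_rfl) hs)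
        have h3 := tendsto_of_edist_eq Ψ (hA (c • f)) (hle (Measure.le_add_left le_rfl) hs)
        refine tendsto_nhds_unique h3 ((h1.const_smul c).congr fun k => ?_)
        rw [map_smul] }
  refine ⟨L.mkContinuous |M| fun f => ?_, hA⟩
  have h := hA f 0
  rw [map_zero, zero_apply, edist_zero_left, ContinuousMap.coe_zero, zero_sub, eLpNorm_neg] at h
  have h2 := (enorm_eq_eLpNorm_of_norm_sq_eq hφ _).1 h
  have hmass : (measure Ψ f).real Set.univ = ‖f‖ ^ 2 := by
    have h3 := norm_sq_eq Ψ f 1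
    simp only [map_one, one_apply_eq_self, ContinuousMap.one_apply, norm_one, one_pow,
      MeasureTheory.integral_const, smul_eq_mul, mul_one] at h3
    exact h3.symm
  refine le_of_sq_le_sq ?_ (by positivity)
  change ‖A f‖ ^ 2 ≤ _
  rw [h2, mul_pow, sq_abs, ← hmass]
  calc ∫ y, ‖φ y‖ ^ 2 ∂(measure Ψ f) ≤ ∫ _, M ^ 2 ∂(measure Ψ f) :=
        integral_mono (hφ.integrable_norm_sq _) (integrable_const _) fun y =>
          pow_le_pow_left₀ (norm_nonneg _) (hM y) 2
    _ = _ := by rw [MeasureTheory.integral_const, smul_eq_mul, mul_comm]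

open Classical in
/-- The operator `φ(Ψ)` for a bounded measurable function `φ`. -/
noncomputable def op (φ : Y → ℂ) : V →L[ℂ] V :=
  if h : BoundedMeasurable φ then (exists_operator Ψ h).choose else 0

variable {φ ψ : Y → ℂ}

theorem edist_op (hφ : BoundedMeasurable φ) (f : V) (ψ : C(Y, ℂ)) :
    edist (Ψ ψ f) (op Ψ φ f) = eLpNorm (⇑ψ - φ) 2 (measure Ψ f) := by
  rw [op, dif_pos hφ]
  exact (exists_operator Ψ hφ).choose_spec f ψ

theorem norm_op_sq (hφ : BoundedMeasurable φ) (f : V) :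
    ‖op Ψ φ f‖ ^ 2 = ∫ y, ‖φ y‖ ^ 2 ∂(measure Ψ f) := by
  have h := edist_op Ψ hφ f 0
  rw [map_zero, zero_apply, edist_zero_left, ContinuousMap.coe_zero, zero_sub, eLpNorm_neg] at h
  exact (enorm_eq_eLpNorm_of_norm_sq_eq hφ _).1 h

theorem op_continuous (φ : C(Y, ℂ)) : op Ψ φ = Ψ φ := by
  ext f
  have h := edist_op Ψ (boundedMeasurable_continuous φ) f φ
  rw [sub_self, eLpNorm_zero, edist_eq_zero] at h
  exact h.symm

theorem op_add_const_mul (hφ : BoundedMeasurable φ) (hψ : BoundedMeasurable ψ) (c : ℂ) (f : V) :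
    op Ψ (fun y => φ y + c * ψ y) f = op Ψ φ f + c • op Ψ ψ f := by
  obtain ⟨s, hs⟩ := exists_seq_tendsto_eLpNorm hφ (measure Ψ f)
  obtain ⟨t, ht⟩ := exists_seq_tendsto_eLpNorm hψ (measure Ψ f)
  have hsum := hφ.add (hψ.const_mul c)
  have h1 := tendsto_of_edist_eq Ψ (edist_op Ψ hφ f) hs
  have h2 := tendsto_of_edist_eq Ψ (edist_op Ψ hψ f) ht
  have hst : Tendsto (fun k => eLpNorm (⇑(s k + c • t k) - fun y => φ y + c * ψ y) 2
      (measure Ψ f)) atTop (𝓝 0) := by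
    have h3 : Tendsto (fun k => eLpNorm (⇑(s k) - φ) 2 (measure Ψ f) +
        ‖c‖ₑ * eLpNorm (⇑(t k) - ψ) 2 (measure Ψ f)) atTop (𝓝 0) := by
      simpa using hs.add (ENNReal.Tendsto.const_mul ht (Or.inr enorm_ne_top))
    refine tendsto_of_tendsto_of_tendsto_of_le_of_le tendsto_const_nhds h3 (fun _ => zero_le)
      fun k => ?_
    have h4 : (⇑(s k + c • t k) - fun y => φ y + c * ψ y) =
        (⇑(s k) - φ) + c • (⇑(t k) - ψ) := by
      ext y
      simp only [ContinuousMap.coe_add, ContinuousMap.coe_smul, Pi.sub_apply, Pi.add_apply,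
        Pi.smul_apply, smul_eq_mul]
      ring
    rw [h4, ← eLpNorm_const_smul]
    refine eLpNorm_add_le ?_ ?_ (by norm_num)
    · exact ((s k).continuous.measurable.sub hφ.measurable).aestronglyMeasurable
    · exact (((t k).continuous.measurable.sub hψ.measurable).const_smul c).aestronglyMeasurable
  refine tendsto_nhds_unique (tendsto_of_edist_eq Ψ (edist_op Ψ hsum f) hst)
    ((h1.add (h2.const_smul c)).congr fun k => ?_)
  rw [map_add, map_smul]
  rfl

theorem inner_op_op (hφ : BoundedMeasurable φ) (hψ : BoundedMeasurable ψ) (f : V) :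
    ⟪op Ψ φ f, op Ψ ψ f⟫_ℂ = ∫ y, (starRingEnd ℂ) (φ y) * ψ y ∂(measure Ψ f) :=
  hφ.inner_eq_integral hψ fun c => by
    rw [← op_add_const_mul Ψ hφ hψ, norm_op_sq Ψ (hφ.add (hψ.const_mul c))]

theorem op_one : op Ψ (fun _ => 1) = 1 := by
  have := op_continuous Ψ 1
  rw [map_one] at this
  exact this

theorem inner_op (hφ : BoundedMeasurable φ) (f : V) :
    ⟪f, op Ψ φ f⟫_ℂ = ∫ y, φ y ∂(measure Ψ f) := by
  have h := inner_op_op Ψ (BoundedMeasurable.const 1) hφ f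
  rw [op_one, one_apply_eq_self] at h
  simpa using h

theorem op_eq_of_inner (hφ : BoundedMeasurable φ) {A : V →L[ℂ] V}
    (hA : ∀ f, ⟪f, A f⟫_ℂ = ∫ y, φ y ∂(measure Ψ f)) : op Ψ φ = A :=
  ContinuousLinearMap.eq_of_inner_self_eq fun f => by rw [inner_op Ψ hφ, hA]

theorem adjoint_op (hφ : BoundedMeasurable φ) :
    ContinuousLinearMap.adjoint (op Ψ φ) = op Ψ (fun y => (starRingEnd ℂ) (φ y)) := by
  refine (op_eq_of_inner Ψ hφ.star fun f => ?_).symm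
  rw [ContinuousLinearMap.adjoint_inner_right, ← inner_conj_symm, inner_op Ψ hφ, ← integral_conj]

theorem op_mul (hφ : BoundedMeasurable φ) (hψ : BoundedMeasurable ψ) :
    op Ψ (fun y => φ y * ψ y) = op Ψ φ * op Ψ ψ :=
  op_eq_of_inner Ψ (hφ.mul hψ) fun f => by
    have h := inner_op_op Ψ hφ.star hψ f
    rw [← adjoint_op Ψ hφ, ContinuousLinearMap.adjoint_inner_left] at h
    simpa using h

theorem integral_indicator_one_eq {S : Set Y} (hS : MeasurableSet S) (f : V) :
    ∫ y, S.indicator (fun _ => (1 : ℂ)) y ∂(measure Ψ f) = ((measure Ψ f).real S : ℂ) := by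
  rw [integral_indicator hS, setIntegral_const]
  simp

theorem inner_op_indicator {S : Set Y} (hS : MeasurableSet S) (f : V) :
    ⟪f, op Ψ (S.indicator fun _ => 1) f⟫_ℂ = ((measure Ψ f).real S : ℂ) := by
  rw [inner_op Ψ (BoundedMeasurable.indicator_one hS), integral_indicator_one_eq Ψ hS]

theorem norm_op_indicator_sq {S : Set Y} (hS : MeasurableSet S) (f : V) :
    ‖op Ψ (S.indicator fun _ => 1) f‖ ^ 2 = (measure Ψ f).real S := by
  rw [norm_op_sq Ψ (BoundedMeasurable.indicator_one hS)]
  have : ∀ y, ‖S.indicator (fun _ => (1 : ℂ)) y‖ ^ 2 = S.indicator (fun _ => (1 : ℝ)) y := by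
    intro y
    by_cases hy : y ∈ S <;> simp [hy]
  simp only [this]
  rw [integral_indicator hS, setIntegral_const]
  simp

/-- The projection-valued measure of a star homomorphism from the continuous functions on a
compact metric space. -/
noncomputable def projectionValuedMeasure : ProjectionValuedMeasure Y V where
  proj S := op Ψ (S.indicator fun _ => 1)
  isStarProjection S hS := by
    have hb := BoundedMeasurable.indicator_one hS
    refine ⟨?_, ?_⟩
    · change op Ψ _ * op Ψ _ = op Ψ _
      rw [← op_mul Ψ hb hb]
      congr 1
      ext y
      by_cases hy : y ∈ S <;> simp [hy]
    · change ContinuousLinearMap.adjoint _ = _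
      rw [adjoint_op Ψ hb]
      congr 1
      ext y
      by_cases hy : y ∈ S <;> simp [hy]
  proj_inter S S' hS hS' := by
    rw [← op_mul Ψ (BoundedMeasurable.indicator_one hS) (BoundedMeasurable.indicator_one hS')]
    congr 1
    ext y
    by_cases hy : y ∈ S <;> by_cases hy' : y ∈ S' <;> simp [hy, hy']
  hasSum_proj S hS hd f := by
    set U := ⋃ i, S i
    have hU : MeasurableSet U := MeasurableSet.iUnion hS
    have hW : ∀ s : Finset ℕ, MeasurableSet (⋃ i ∈ s, S i) := fun s =>
      s.measurableSet_biUnion fun i _ => hS i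
    have hsub : ∀ s : Finset ℕ, (⋃ i ∈ s, S i) ⊆ U := fun s =>
      Set.iUnion₂_subset fun i _ => Set.subset_iUnion S i
    have hreal : ∀ (s : Finset ℕ) (g : V), (measure Ψ g).real (U \ ⋃ i ∈ s, S i) =
        (measure Ψ g).real U - ∑ i ∈ s, (measure Ψ g).real (S i) := fun s g => by
      rw [measureReal_sdiff (hsub s) (hW s),
        measureReal_biUnion_finset (fun i _ j _ hij => hd hij) fun i _ => hS i]
    have hdiff : ∀ s : Finset ℕ, op Ψ ((U \ ⋃ i ∈ s, S i).indicator fun _ => (1 : ℂ)) =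
        op Ψ (U.indicator fun _ => 1) - ∑ i ∈ s, op Ψ ((S i).indicator fun _ => 1) := by
      intro s
      refine op_eq_of_inner Ψ (BoundedMeasurable.indicator_one (hU.diff (hW s))) fun g => ?_
      rw [integral_indicator_one_eq Ψ (hU.diff (hW s)), hreal, sub_apply, sum_apply,
        inner_sub_right, inner_sum, inner_op_indicator Ψ hU]
      simp only [fun i => inner_op_indicator Ψ (hS i) g]
      push_cast
      rfl
    have hlim : Tendsto (fun s : Finset ℕ => (measure Ψ f).real U -
        ∑ i ∈ s, (measure Ψ f).real (S i)) atTop (𝓝 0) := by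
      have h1 : HasSum (fun i => (measure Ψ f).real (S i)) ((measure Ψ f).real U) := by
        have h2 := measure_iUnion (μ := measure Ψ f) hd hS
        have h3 : ∑' i, (measure Ψ f) (S i) ≠ ⊤ := by rw [← h2]; finiteness
        have h4 := ENNReal.hasSum_toReal h3
        rwa [← ENNReal.tsum_toReal_eq fun i => by finiteness, ← h2] at h4
      simpa using (tendsto_const_nhds (x := (measure Ψ f).real U)).sub h1
    -- The squared norm of the error is the measure of the remaining tail, so strong additivity
    -- reduces to that of the scalar measure.
    have hnorm : ∀ s : Finset ℕ, ‖∑ i ∈ s, op Ψ ((S i).indicator fun _ => 1) f -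
        op Ψ (U.indicator fun _ => 1) f‖ = √((measure Ψ f).real U -
        ∑ i ∈ s, (measure Ψ f).real (S i)) := by
      intro s
      rw [norm_sub_rev, ← sum_apply, ← sub_apply, ← hdiff, ← hreal,
        ← norm_op_indicator_sq Ψ (hU.diff (hW s)), Real.sqrt_sq (norm_nonneg _)]
    rw [HasSum, tendsto_iff_norm_sub_tendsto_zero]
    simp only [SummationFilter.unconditional_filter, hnorm]
    simpa using hlim.sqrt

theorem scalarMeasure_projectionValuedMeasure (f : V) :
    (projectionValuedMeasure Ψ).scalarMeasure f = measure Ψ f := by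
  ext S hS
  rw [ProjectionValuedMeasure.scalarMeasure_eq_norm_sq _ f hS]
  change ENNReal.ofReal (‖op Ψ (S.indicator fun _ => 1) f‖ ^ 2) = _
  rw [norm_op_indicator_sq Ψ hS, ofReal_measureReal]

theorem integral_projectionValuedMeasure (φ : C(Y, ℂ)) :
    (projectionValuedMeasure Ψ).integral φ = Ψ φ :=
  ProjectionValuedMeasure.integral_eq_of_inner _ (boundedMeasurable_continuous φ) fun f => by
    rw [scalarMeasure_projectionValuedMeasure, integral_eq]

end StarHomMeasure

/-! ### Resolvents of self-adjoint operators -/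

namespace LinearPMap

variable {V : Type*} [NormedAddCommGroup V] [InnerProductSpace ℂ V] [CompleteSpace V]
  {A : V →ₗ.[ℂ] V}

theorem inner_symm_of_isSelfAdjoint (hA : IsSelfAdjoint A) (u v : A.domain) :
    ⟪A u, (v : V)⟫_ℂ = ⟪(u : V), A v⟫_ℂ := by
  have h := A.adjoint_isFormalAdjoint hA.dense_domain
  rw [LinearPMap.isSelfAdjoint_def.1 hA] at h
  exact h u v

theorem im_inner_self (hA : IsSelfAdjoint A) (u : A.domain) : (⟪(u : V), A u⟫_ℂ).im = 0 := by
  rw [← Complex.conj_eq_iff_im, inner_conj_symm, inner_symm_of_isSelfAdjoint hA]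

/-- `⟨u, A u⟩` is real, so `Im ⟨u, (A - z) u⟩ = -Im z ‖u‖²`, and Cauchy–Schwarz applies. -/
theorem norm_le_norm_sub_smul (hA : IsSelfAdjoint A) (z : ℂ) (u : A.domain) :
    |z.im| * ‖(u : V)‖ ≤ ‖A u - z • (u : V)‖ := by
  have h1 : (⟪(u : V), A u - z • (u : V)⟫_ℂ).im = -(z.im * ‖(u : V)‖ ^ 2) := by
    rw [inner_sub_right, inner_smul_right, Complex.sub_im, im_inner_self hA,
      inner_self_eq_norm_sq_to_K]
    have : (z * ((‖(u : V)‖ : ℂ)) ^ 2).im = z.im * ‖(u : V)‖ ^ 2 := by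
      rw [← Complex.ofReal_pow, Complex.im_mul_ofReal]
    change 0 - (z * ((‖(u : V)‖ : ℂ)) ^ 2).im = _
    rw [this, zero_sub]
  have h2 : |z.im| * ‖(u : V)‖ ^ 2 ≤ ‖(u : V)‖ * ‖A u - z • (u : V)‖ := by
    have h3 := (Complex.abs_im_le_norm _).trans
      (norm_inner_le_norm (𝕜 := ℂ) (u : V) (A u - z • (u : V)))
    rwa [h1, abs_neg, abs_mul, abs_of_nonneg (sq_nonneg ‖(u : V)‖)] at h3
  rcases (norm_nonneg (u : V)).eq_or_lt with h0 | h0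
  · rw [← h0]; simp
  · refine le_of_mul_le_mul_right ?_ h0
    calc |z.im| * ‖(u : V)‖ * ‖(u : V)‖ = |z.im| * ‖(u : V)‖ ^ 2 := by ring
      _ ≤ _ := h2.trans_eq (mul_comm _ _)

/-- The map `u ↦ A u - z u` on the domain of `A`. -/
def subSmul (A : V →ₗ.[ℂ] V) (z : ℂ) : A.domain →ₗ[ℂ] V := A.toFun - z • A.domain.subtype

theorem subSmul_apply (z : ℂ) (u : A.domain) : subSmul A z u = A u - z • (u : V) := rfl

theorem isClosed_range_subSmul (hA : IsSelfAdjoint A) {z : ℂ} (hz : z.im ≠ 0) :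
    _root_.IsClosed (LinearMap.range (subSmul A z) : Set V) := by
  refine IsSeqClosed.isClosed fun f g hf hg => ?_
  choose u hu using hf
  have hz' : 0 < |z.im| := abs_pos.2 hz
  have hc : CauchySeq fun k => ((u k : A.domain) : V) := by
    have h1 := hg.cauchySeq
    rw [Metric.cauchySeq_iff] at h1 ⊢
    intro ε hε
    obtain ⟨N, hN⟩ := h1 (|z.im| * ε) (by positivity)
    refine ⟨N, fun k hk l hl => ?_⟩
    have h2 := hN k hk l hl
    have h3 := norm_le_norm_sub_smul hA z (u k - u l)
    rw [← subSmul_apply, _root_.map_sub, hu, hu, ← dist_eq_norm] at h3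
    rw [dist_eq_norm]
    exact lt_of_mul_lt_mul_left (h3.trans_lt h2) hz'.le
  obtain ⟨v, hv⟩ := cauchySeq_tendsto_of_complete hc
  have hAu : Tendsto (fun k => A (u k)) atTop (𝓝 (g + z • v)) := by
    refine (hg.add (hv.const_smul z)).congr fun k => ?_
    rw [← hu, subSmul_apply, sub_add_cancel]
  have hmem : (v, g + z • v) ∈ A.graph := by
    have hcl : _root_.IsClosed (A.graph : Set (V × V)) := hA.isClosed
    exact hcl.mem_of_tendsto (hv.prodMk_nhds hAu)
      (Eventually.of_forall fun k => A.mem_graph (u k))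
  obtain ⟨w, hw1, hw2⟩ := (A.mem_graph_iff).1 hmem
  refine ⟨w, ?_⟩
  rw [subSmul_apply, hw2]
  have : (w : V) = v := hw1
  rw [this, add_sub_cancel_right]

/-- A vector `y` orthogonal to the range lies in `D(A*) = D(A)` with `A y = z̄ y`, hence vanishes by
the lower bound. The range is closed, because the lower bound makes preimages Cauchy and `A` is
closed. -/
theorem range_subSmul_eq_top (hA : IsSelfAdjoint A) {z : ℂ} (hz : z.im ≠ 0) :
    LinearMap.range (subSmul A z) = ⊤ := by
  have horth : (LinearMap.range (subSmul A z))ᗮ = ⊥ := by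
    refine (Submodule.eq_bot_iff _).2 fun y hy => ?_
    have h1 : ∀ u : A.domain, ⟪(starRingEnd ℂ) z • y, (u : V)⟫_ℂ = ⟪y, A u⟫_ℂ := by
      intro u
      have h2 := (Submodule.mem_orthogonal' _ _).1 hy _ ⟨u, rfl⟩
      rw [subSmul_apply, inner_sub_right, inner_smul_right, sub_eq_zero] at h2
      rw [inner_smul_left, Complex.conj_conj, h2]
    have hmem : y ∈ A.adjoint.domain := A.mem_adjoint_domain_of_exists y ⟨_, h1⟩
    have hval := A.adjoint_apply_eq hA.dense_domain ⟨y, hmem⟩ (x₀ := (starRingEnd ℂ) z • y) h1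
    have hAeq := LinearPMap.isSelfAdjoint_def.1 hA
    have hmem' : y ∈ A.domain := by rwa [hAeq] at hmem
    have hval' : A ⟨y, hmem'⟩ = (starRingEnd ℂ) z • y := by
      rw [← hval]
      exact ((LinearPMap.ext_iff.1 hAeq).2 (x := y) (hf := hmem) (hg := hmem')).symm
    have h3 := norm_le_norm_sub_smul hA ((starRingEnd ℂ) z) ⟨y, hmem'⟩
    rw [hval', sub_self, norm_zero, Complex.conj_im, abs_neg] at h3
    have hz' : 0 < |z.im| := abs_pos.2 hz
    have h4 : ‖y‖ ≤ 0 := by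
      by_contra h
      push Not at h
      have := mul_pos hz' h
      exact absurd h3 (not_le.2 this)
    exact norm_le_zero_iff.1 h4
  have hcl := isClosed_range_subSmul hA hz
  have : CompleteSpace (LinearMap.range (subSmul A z)) := hcl.completeSpace_coe
  exact (Submodule.orthogonal_eq_bot_iff).1 horth

/-- Every non-real number lies in the resolvent set of a self-adjoint operator. -/
theorem exists_resolvent (hA : IsSelfAdjoint A) {z : ℂ} (hz : z.im ≠ 0) : ∃ R : V →L[ℂ] V,
    (∀ f : V, ∃ hf : R f ∈ A.domain, A ⟨R f, hf⟩ - z • R f = f) ∧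
    (∀ u : A.domain, R (A u - z • (u : V)) = u) := by
  have hinj : Function.Injective (subSmul A z) := by
    refine (injective_iff_map_eq_zero _).2 fun u hu => ?_
    have h := norm_le_norm_sub_smul hA z u
    rw [← subSmul_apply, hu, norm_zero] at h
    have hz' : 0 < |z.im| := abs_pos.2 hz
    have h4 : ‖(u : V)‖ ≤ 0 := by
      by_contra h'
      push Not at h'
      exact absurd h (not_le.2 (mul_pos hz' h'))
    exact Subtype.ext (norm_le_zero_iff.1 h4)
  let e := LinearEquiv.ofBijective (subSmul A z)
    ⟨hinj, LinearMap.range_eq_top.1 (range_subSmul_eq_top hA hz)⟩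
  have he : ∀ f, A (e.symm f) - z • ((e.symm f : A.domain) : V) = f := fun f => e.apply_symm_apply f
  let R : V →L[ℂ] V := (A.domain.subtype ∘ₗ (e.symm : V →ₗ[ℂ] A.domain)).mkContinuous |z.im|⁻¹
    fun f => by
      have h := norm_le_norm_sub_smul hA z (e.symm f)
      rw [he f] at h
      rw [inv_mul_eq_div, le_div_iff₀ (abs_pos.2 hz), mul_comm]
      exact h
  refine ⟨R, fun f => ⟨(e.symm f).2, he f⟩, fun u => ?_⟩
  change ((e.symm (subSmul A z u) : A.domain) : V) = u
  rw [show subSmul A z u = e u from rfl, e.symm_apply_apply]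

theorem resolventOp_spec (hA : IsSelfAdjoint A) {z : ℂ} (hz : z.im ≠ 0) :
    (∀ f : V, ∃ hf : A.resolventOp z f ∈ A.domain,
      A ⟨A.resolventOp z f, hf⟩ - z • A.resolventOp z f = f) ∧
    (∀ u : A.domain, A.resolventOp z (A u - z • (u : V)) = u) := by
  have h := exists_resolvent hA hz
  rw [resolventOp, dif_pos h]
  exact h.choose_spec

theorem resolventOp_mem_domain (hA : IsSelfAdjoint A) {z : ℂ} (hz : z.im ≠ 0) (f : V) :
    A.resolventOp z f ∈ A.domain :=
  ((resolventOp_spec hA hz).1 f).1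

theorem apply_resolventOp (hA : IsSelfAdjoint A) {z : ℂ} (hz : z.im ≠ 0) (f : V) :
    A ⟨A.resolventOp z f, resolventOp_mem_domain hA hz f⟩ = f + z • A.resolventOp z f := by
  rw [← sub_eq_iff_eq_add]
  exact ((resolventOp_spec hA hz).1 f).2

theorem adjoint_resolventOp (hA : IsSelfAdjoint A) {z : ℂ} (hz : z.im ≠ 0) :
    ContinuousLinearMap.adjoint (A.resolventOp z) = A.resolventOp ((starRingEnd ℂ) z) := by
  have hz' : ((starRingEnd ℂ) z).im ≠ 0 := by simpa using hz
  symm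
  rw [ContinuousLinearMap.eq_adjoint_iff]
  intro f g
  have h := inner_symm_of_isSelfAdjoint hA ⟨_, resolventOp_mem_domain hA hz' f⟩
    ⟨_, resolventOp_mem_domain hA hz g⟩
  rw [apply_resolventOp hA hz, apply_resolventOp hA hz', inner_add_left, inner_add_right,
    inner_smul_left, inner_smul_right, Complex.conj_conj] at h
  exact (add_right_cancel h).symm

theorem resolventOp_sub (hA : IsSelfAdjoint A) {z w : ℂ} (hz : z.im ≠ 0) (hw : w.im ≠ 0) :
    A.resolventOp z - A.resolventOp w = (z - w) • (A.resolventOp z * A.resolventOp w) := by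
  ext f
  have h1 := (resolventOp_spec hA hz).2 ⟨_, resolventOp_mem_domain hA hw f⟩
  rw [apply_resolventOp hA hw, add_sub_assoc, ← sub_smul, _root_.map_add, _root_.map_smul] at h1
  rw [_root_.sub_apply, _root_.smul_apply, mul_apply_eq_comp]
  have h2 : (z - w) • (A.resolventOp z) ((A.resolventOp w) f) =
      -((w - z) • (A.resolventOp z) ((A.resolventOp w) f)) := by
    rw [← neg_smul, neg_sub]
  rw [h2, ← sub_eq_zero]
  have h3 : (A.resolventOp z) f + (w - z) • (A.resolventOp z) ((A.resolventOp w) f) -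
      (A.resolventOp w) f = 0 := sub_eq_zero.2 h1
  rw [← h3]
  abel

theorem norm_resolventOp_le (hA : IsSelfAdjoint A) {z : ℂ} (hz : z.im ≠ 0) :
    ‖A.resolventOp z‖ ≤ |z.im|⁻¹ := by
  refine ContinuousLinearMap.opNorm_le_bound _ (by positivity) fun f => ?_
  have h := norm_le_norm_sub_smul hA z ⟨_, resolventOp_mem_domain hA hz f⟩
  rw [apply_resolventOp hA hz, add_sub_cancel_right] at h
  rw [inv_mul_eq_div, le_div_iff₀ (abs_pos.2 hz), mul_comm]
  exact h

end LinearPMap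

/-! ### Joint continuous functional calculus by Gelfand duality -/

section JointFunctionalCalculus

variable {A : Type*} [CStarAlgebra A] {n : ℕ}

/-- The closed unit polydisc in `ℂⁿ`. -/
abbrev Polydisc (n : ℕ) : Type := Metric.closedBall (0 : Fin n → ℂ) 1

instance : CompactSpace (Polydisc n) :=
  isCompact_iff_compactSpace.1 (isCompact_closedBall _ _)

namespace Polydisc

/-- The coordinate functions of the polydisc. -/
def coord (j : Fin n) : C(Polydisc n, ℂ) :=
  ⟨fun y => (y : Fin n → ℂ) j, (continuous_apply j).comp continuous_subtype_val⟩

end Polydisc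

/-- The joint continuous functional calculus of commuting normal contractions. -/
theorem exists_starAlgHom_polydisc {r : Fin n → A} (hr : ∀ j, ‖r j‖ ≤ 1)
    (hc : ∀ i j, Commute (r i) (r j)) (hc' : ∀ i j, Commute (r i) (star (r j))) :
    ∃ Ψ : C(Polydisc n, ℂ) →⋆ₐ[ℂ] A, ∀ j, Ψ (Polydisc.coord j) = r j := by
  -- `C1` is the commutant of the `r_j` and their adjoints, and `B` the bicommutant. The `r_j` lie
  -- in `C1`, so `B ⊆ C1`, which makes `B` commutative; it is closed, hence a C*-algebra.
  let C1 : StarSubalgebra ℂ A := StarSubalgebra.centralizer ℂ (Set.range r)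
  let B : StarSubalgebra ℂ A := StarSubalgebra.centralizer ℂ (C1 : Set A)
  have hrC : ∀ j, r j ∈ C1 := by
    intro j
    rw [StarSubalgebra.mem_centralizer_iff]
    rintro _ ⟨i, rfl⟩
    exact ⟨hc i j, (hc' j i).symm⟩
  have hrB : ∀ j, r j ∈ B := by
    intro j
    rw [StarSubalgebra.mem_centralizer_iff]
    intro g hg
    have h1 := (StarSubalgebra.mem_centralizer_iff ℂ).1 hg _ ⟨j, rfl⟩
    have h2 := (StarSubalgebra.mem_centralizer_iff ℂ).1 (star_mem hg) _ ⟨j, rfl⟩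
    exact ⟨h1.1.symm, h2.1.symm⟩
  have hBC : ∀ x ∈ B, x ∈ C1 := by
    intro x hx
    rw [StarSubalgebra.mem_centralizer_iff]
    rintro _ ⟨i, rfl⟩
    exact (StarSubalgebra.mem_centralizer_iff ℂ).1 hx _ (hrC i)
  have hclosed : IsClosed (B : Set A) := by
    rw [StarSubalgebra.coe_centralizer]
    exact Set.isClosed_centralizer _
  let _ : CommCStarAlgebra B :=
    { StarSubalgebra.cstarAlgebra B with
      mul_comm := fun x y => Subtype.ext
        ((StarSubalgebra.mem_centralizer_iff ℂ).1 y.2 _ (hBC _ x.2)).1 }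
  let ρ : Fin n → B := fun j => ⟨r j, hrB j⟩
  have hχ : ∀ (χ : WeakDual.characterSpace ℂ B) (j : Fin n), ‖χ (ρ j)‖ ≤ 1 := by
    intro χ j
    have h1 := (gelfandStarTransform B (ρ j)).norm_coe_le_norm χ
    have h2 : ‖gelfandStarTransform B (ρ j)‖ = ‖ρ j‖ :=
      (gelfandTransform_isometry B).norm_map_of_map_zero (map_zero _) _
    exact h1.trans (h2.trans_le (hr j))
  -- A character is sent to its values on the `r_j`, which lie in the unit disc. Functions on the
  -- polydisc are pulled back along this map.
  let ι : C(WeakDual.characterSpace ℂ B, Polydisc n) :=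
    ⟨fun χ => ⟨fun j => χ (ρ j), mem_closedBall_zero_iff.2
      ((pi_norm_le_iff_of_nonneg zero_le_one).2 (hχ χ))⟩, by
      refine Continuous.subtype_mk (continuous_pi fun j => ?_) _
      exact (gelfandStarTransform B (ρ j)).continuous⟩
  refine ⟨(B.subtype.comp ((gelfandStarTransform B).symm : C(_, ℂ) →⋆ₐ[ℂ] B)).comp
    (ContinuousMap.compStarAlgHom' ℂ ℂ ι), fun j => ?_⟩
  have h : ContinuousMap.compStarAlgHom' ℂ ℂ ι (Polydisc.coord j) =
      gelfandStarTransform B (ρ j) := by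
    ext χ
    rfl
  change (((gelfandStarTransform B).symm
    (ContinuousMap.compStarAlgHom' ℂ ℂ ι (Polydisc.coord j)) : B) : A) = r j
  rw [h, StarAlgEquiv.symm_apply_apply]

end JointFunctionalCalculus

/-! ### Recovering an unbounded operator from its resolvent at `i` -/

namespace ProjectionValuedMeasure

variable {Y : Type*} [MeasurableSpace Y] {X : Type*} [MeasurableSpace X]
variable {V : Type*} [NormedAddCommGroup V] [InnerProductSpace ℂ V] [CompleteSpace V]
variable (F : ProjectionValuedMeasure Y V)

/-- The push-forward of a projection-valued measure. -/
def map {κ : Y → X} (hκ : Measurable κ) : ProjectionValuedMeasure X V where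
  proj S := F.proj (κ ⁻¹' S)
  isStarProjection _ hS := F.isStarProjection _ (hκ hS)
  proj_inter _ _ hS hS' := F.proj_inter _ _ (hκ hS) (hκ hS')
  hasSum_proj S hS hd f := by
    rw [Set.preimage_iUnion]
    exact F.hasSum_proj _ (fun i => hκ (hS i)) (fun i j hij => (hd hij).preimage κ) f

theorem scalarMeasure_map {κ : Y → X} (hκ : Measurable κ) (f : V) :
    (F.map hκ).scalarMeasure f = (F.scalarMeasure f).map κ := by
  ext S hS
  rw [Measure.map_apply hκ hS, scalarMeasure_apply _ _ hS, scalarMeasure_apply _ _ (hκ hS)]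
  rfl

theorem integral_congr_ae {φ ψ : Y → ℂ} (hφ : BoundedMeasurable φ) (hψ : BoundedMeasurable ψ)
    (h : ∀ f, φ =ᵐ[F.scalarMeasure f] ψ) : F.integral φ = F.integral ψ :=
  F.integral_eq_of_inner hφ fun f => by
    rw [F.inner_integral hψ, MeasureTheory.integral_congr_ae (h f)]

theorem ae_eq_zero_of_integral_eq_zero {φ : Y → ℂ} (hφ : BoundedMeasurable φ)
    (h : F.integral φ = 0) (f : V) : ∀ᵐ y ∂F.scalarMeasure f, φ y = 0 := by
  have h1 := F.enorm_integral_sq hφ f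
  rw [h, zero_apply, enorm_zero, zero_pow two_ne_zero, eq_comm,
    lintegral_eq_zero_iff (hφ.measurable.enorm.pow_const 2)] at h1
  filter_upwards [h1] with y hy
  simpa using hy

section Resolvent

variable {F} {w : Y → ℂ} {A : V →ₗ.[ℂ] V}

theorem norm_re_inv_le (z : ℂ) : ‖(z⁻¹).re‖ * ‖z‖ ≤ 1 := by
  calc ‖(z⁻¹).re‖ * ‖z‖ ≤ ‖z⁻¹‖ * ‖z‖ := by
        gcongr
        exact Complex.abs_re_le_norm _
    _ ≤ 1 := by
        rw [norm_inv]
        exact inv_mul_le_one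

theorem integral_const_one (hF : F.proj Set.univ = 1) : F.integral (fun _ => 1) = 1 := by
  rw [← hF, ← F.integral_indicator_one MeasurableSet.univ, Set.indicator_univ]

/-- Let `R = (A - i)⁻¹ = ∫ w dF`. Injectivity of `R` gives `w ≠ 0` almost everywhere, and `R - R* =
2i R R*` gives `Im w = |w|²`. Hence `w⁻¹ = t - i` with `t = Re w⁻¹` real, so that `1 + i w = t w`:
the spectral variable of `A` is `t`. -/
theorem ae_mul_eq_one (hA : IsSelfAdjoint A) (hw : BoundedMeasurable w)
    (hwA : F.integral w = A.resolventOp Complex.I) (f : V) :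
    ∀ᵐ y ∂F.scalarMeasure f, 1 + Complex.I * w y = (((w y)⁻¹).re : ℂ) * w y := by
  have hI : Complex.I.im ≠ 0 := by simp
  have hI' : ((starRingEnd ℂ) Complex.I).im ≠ 0 := by simp
  have h1 : ∀ᵐ y ∂F.scalarMeasure f, w y ≠ 0 := by
    have hS : MeasurableSet {y | w y = 0} := hw.measurable (measurableSet_singleton 0)
    have h2 : A.resolventOp Complex.I (F.proj {y | w y = 0} f) = 0 := by
      rw [← hwA, F.integral_proj hw hS]
      have : Set.indicator {y | w y = 0} w = fun _ => 0 := by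
        ext y
        by_cases hy : y ∈ {y | w y = 0}
        · rw [Set.indicator_of_mem hy]; exact hy
        · rw [Set.indicator_of_notMem hy]
      rw [this, F.integral_zero, zero_apply]
    have h3 := LinearPMap.apply_resolventOp hA hI (F.proj {y | w y = 0} f)
    have h4 : A ⟨A.resolventOp Complex.I (F.proj {y | w y = 0} f),
        LinearPMap.resolventOp_mem_domain hA hI _⟩ = 0 := by
      have : (⟨A.resolventOp Complex.I (F.proj {y | w y = 0} f),
        LinearPMap.resolventOp_mem_domain hA hI _⟩ : A.domain) = 0 := Subtype.ext h2
      rw [this, LinearPMap.map_zero]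
    rw [h4, h2, smul_zero, add_zero] at h3
    rw [ae_iff]
    simp only [ne_eq, not_not]
    rw [F.scalarMeasure_eq_enorm_sq f hS, ← h3]
    simp
  have h2 : ∀ᵐ y ∂F.scalarMeasure f, (w y - (starRingEnd ℂ) (w y)) -
      (2 * Complex.I) * (w y * (starRingEnd ℂ) (w y)) = 0 := by
    refine F.ae_eq_zero_of_integral_eq_zero
      ((hw.sub hw.star).sub ((hw.mul hw.star).const_mul (2 * Complex.I))) ?_ f
    rw [F.integral_sub (hw.sub hw.star) ((hw.mul hw.star).const_mul _), F.integral_sub hw hw.star,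
      F.integral_const_mul _ (hw.mul hw.star), F.integral_mul hw hw.star, ← F.adjoint_integral hw,
      hwA, LinearPMap.adjoint_resolventOp hA hI, LinearPMap.resolventOp_sub hA hI hI', sub_eq_zero,
      Complex.conj_I, sub_neg_eq_add, two_mul]
  filter_upwards [h1, h2] with y hy1 hy2
  rw [Complex.mul_conj, sub_eq_zero] at hy2
  have h3 : (w y).im = Complex.normSq (w y) := by
    have h4 := congrArg Complex.im hy2
    simp only [Complex.sub_im, Complex.conj_im, Complex.mul_im, Complex.mul_re, Complex.I_re,
      Complex.I_im, Complex.ofReal_re, Complex.ofReal_im, Complex.re_ofNat, Complex.im_ofNat] at h4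
    linarith
  have h5 : (w y)⁻¹ = (((w y)⁻¹).re : ℂ) - Complex.I := by
    apply Complex.ext
    · simp
    · rw [Complex.inv_im, h3, neg_div, div_self (Complex.normSq_pos.2 hy1).ne']
      simp
  have h6 : (((w y)⁻¹).re : ℂ) = (w y)⁻¹ + Complex.I := by
    rw [eq_sub_iff_add_eq] at h5
    exact h5.symm
  rw [h6, add_mul, inv_mul_cancel₀ hy1]

theorem boundedMeasurable_re_inv_mul (hw : BoundedMeasurable w) :
    BoundedMeasurable fun y => (((w y)⁻¹).re : ℂ) * w y := by
  refine ⟨(Complex.measurable_ofReal.comp (Complex.measurable_re.comp hw.measurable.inv)).mul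
    hw.measurable, 1, fun y => ?_⟩
  rw [norm_mul, Complex.norm_real]
  exact norm_re_inv_le _

theorem integral_re_inv_mul (hF : F.proj Set.univ = 1) (hA : IsSelfAdjoint A)
    (hw : BoundedMeasurable w) (hwA : F.integral w = A.resolventOp Complex.I) (g : V) :
    F.integral (fun y => (((w y)⁻¹).re : ℂ) * w y) g =
      A ⟨A.resolventOp Complex.I g, LinearPMap.resolventOp_mem_domain hA (by simp) g⟩ := by
  rw [LinearPMap.apply_resolventOp hA (by simp),
    F.integral_congr_ae (boundedMeasurable_re_inv_mul hw)
      ((BoundedMeasurable.const 1).add (hw.const_mul Complex.I)) fun f =>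
        (ae_mul_eq_one hA hw hwA f).mono fun y hy => hy.symm,
    F.integral_add (BoundedMeasurable.const 1) (hw.const_mul Complex.I),
    F.integral_const_mul _ hw, integral_const_one hF, hwA]
  rfl

/-- Every `u ∈ D(A)` is `R g`, so its measure is `|w|²` times that of `g`, and `|Re w⁻¹| |w| ≤ 1`.
-/
theorem lintegral_lt_top_of_mem_domain (hA : IsSelfAdjoint A) (hw : BoundedMeasurable w)
    (hwA : F.integral w = A.resolventOp Complex.I) (u : A.domain) :
    ∫⁻ y, ‖((w y)⁻¹).re‖ₑ ^ 2 ∂F.scalarMeasure (u : V) < ⊤ := by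
  have hm : Measurable fun y => ‖((w y)⁻¹).re‖ₑ ^ 2 :=
    (Complex.measurable_re.comp hw.measurable.inv).enorm.pow_const 2
  rw [← (LinearPMap.resolventOp_spec hA (z := Complex.I) (by simp)).2 u, ← hwA,
    F.scalarMeasure_integral hw, lintegral_withDensity_eq_lintegral_mul _
      (hw.measurable.enorm.pow_const 2) hm]
  refine lt_of_le_of_lt (lintegral_mono (g := fun _ => 1) fun y => ?_) ?_
  · change ‖w y‖ₑ ^ 2 * ‖((w y)⁻¹).re‖ₑ ^ 2 ≤ 1
    rw [← mul_pow, mul_comm, ← enorm_norm (w y), ← enorm_mul]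
    refine pow_le_one' ?_ 2
    rw [← enorm_one (G := ℝ), enorm_le_iff_norm_le, norm_mul, norm_norm, norm_one]
    exact norm_re_inv_le _
  · rw [lintegral_one]
    exact measure_lt_top _ _

/-- With truncations `χ_N` of `t = Re w⁻¹`, the product `⟨f, A u⟩` is the limit of `⟨∫ χ_N dF f,
u⟩`, which is at most `√C ‖u‖`. So `f ∈ D(A*) = D(A)`. -/
theorem mem_domain_of_lintegral_lt_top (hF : F.proj Set.univ = 1) (hA : IsSelfAdjoint A)
    (hw : BoundedMeasurable w) (hwA : F.integral w = A.resolventOp Complex.I) {f : V}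
    (hf : ∫⁻ y, ‖((w y)⁻¹).re‖ₑ ^ 2 ∂F.scalarMeasure f < ⊤) : f ∈ A.domain := by
  set κ : Y → ℝ := fun y => ((w y)⁻¹).re
  have hκ : Measurable κ := Complex.measurable_re.comp hw.measurable.inv
  let B : ℕ → Set Y := fun N => {y | ‖κ y‖ ≤ N}
  have hB : ∀ N, MeasurableSet (B N) := fun N => measurableSet_le hκ.norm measurable_const
  let χ : ℕ → Y → ℂ := fun N => (B N).indicator fun y => (κ y : ℂ)
  have hχm : ∀ N, Measurable (χ N) := fun N =>
    (Complex.measurable_ofReal.comp hκ).indicator (hB N)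
  have hχ : ∀ N, BoundedMeasurable (χ N) := fun N => ⟨hχm N, N, fun y => by
    by_cases hy : y ∈ B N
    · simp only [χ, Set.indicator_of_mem hy, Complex.norm_real]; exact hy
    · simp [χ, Set.indicator_of_notMem hy]⟩
  have hχle : ∀ N y, ‖χ N y‖ ≤ ‖κ y‖ := fun N y => by
    simpa using norm_indicator_le_norm_self (s := B N) (fun y => (κ y : ℂ)) y
  set C : ℝ≥0∞ := ∫⁻ y, ‖κ y‖ₑ ^ 2 ∂F.scalarMeasure f with hC
  have hnorm : ∀ N, ‖F.integral (χ N) f‖ ^ 2 ≤ C.toReal := by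
    intro N
    rw [← ENNReal.ofReal_le_iff_le_toReal hf.ne, ENNReal.ofReal_pow (norm_nonneg _), ofReal_norm,
      F.enorm_integral_sq (hχ N)]
    refine lintegral_mono fun y => ?_
    gcongr
    exact enorm_le_iff_norm_le.2 (hχle N y)
  have hkey : ∀ u : A.domain, ‖⟪f, A u⟫_ℂ‖ ≤ √C.toReal * ‖(u : V)‖ := by
    intro u
    set g : V := A u - Complex.I • (u : V)
    have hu : A.resolventOp Complex.I g = u :=
      (LinearPMap.resolventOp_spec hA (z := Complex.I) (by simp)).2 u
    have hAu : F.integral (fun y => (κ y : ℂ) * w y) g = A u := by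
      rw [integral_re_inv_mul hF hA hw hwA]
      congr 1
      exact Subtype.ext hu
    have hlim : Tendsto (fun N => F.integral (fun y => χ N y * w y) g) atTop (𝓝 (A u)) := by
      rw [← hAu]
      refine F.tendsto_integral (M := 1) (fun N => (hχm N).mul hw.measurable) (fun N y => ?_)
        (boundedMeasurable_re_inv_mul hw) (fun y => ?_) g
      · rw [Pi.mul_apply, norm_mul]
        exact (mul_le_mul_of_nonneg_right (hχle N y) (norm_nonneg _)).trans (norm_re_inv_le _)
      · obtain ⟨N0, hN0⟩ := exists_nat_ge ‖κ y‖
        refine tendsto_const_nhds.congr' ?_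
        filter_upwards [eventually_ge_atTop N0] with N hN
        have : y ∈ B N := hN0.trans (Nat.cast_le.2 hN)
        simp only [χ, Pi.mul_apply, Set.indicator_of_mem this]
        rfl
    refine le_of_tendsto ((tendsto_const_nhds.inner hlim).norm) (Eventually.of_forall fun N => ?_)
    have hself : ContinuousLinearMap.adjoint (F.integral (χ N)) = F.integral (χ N) := by
      rw [F.adjoint_integral (hχ N)]
      congr 1
      ext y
      by_cases hy : y ∈ B N
      · simp [χ, Set.indicator_of_mem hy]
      · simp [χ, Set.indicator_of_notMem hy]
    rw [← F.integral_mul_apply (hχ N) hw, hwA, hu, ← ContinuousLinearMap.adjoint_inner_left, hself]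
    refine (norm_inner_le_norm _ _).trans ?_
    gcongr
    exact Real.le_sqrt_of_sq_le (hnorm N)
  rw [← LinearPMap.isSelfAdjoint_def.1 hA, LinearPMap.mem_adjoint_domain_iff]
  exact AddMonoidHomClass.continuous_of_bound ((innerₛₗ ℂ f).comp A.toFun) _ hkey

theorem inner_apply_eq_integral (hF : F.proj Set.univ = 1) (hA : IsSelfAdjoint A)
    (hw : BoundedMeasurable w) (hwA : F.integral w = A.resolventOp Complex.I) (u : A.domain) :
    ⟪(u : V), A u⟫_ℂ = ((∫ y, ((w y)⁻¹).re ∂F.scalarMeasure (u : V) : ℝ) : ℂ) := by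
  set g : V := A u - Complex.I • (u : V)
  have hu : A.resolventOp Complex.I g = u :=
    (LinearPMap.resolventOp_spec hA (z := Complex.I) (by simp)).2 u
  have hAu : F.integral (fun y => (((w y)⁻¹).re : ℂ) * w y) g = A u := by
    rw [integral_re_inv_mul hF hA hw hwA]
    congr 1
    exact Subtype.ext hu
  rw [← hAu, ← hu, ← hwA, F.inner_integral_integral hw (boundedMeasurable_re_inv_mul hw),
    F.scalarMeasure_integral hw, ← integral_complex_ofReal,
    integral_withDensity_eq_integral_toReal_smul (hw.measurable.enorm.pow_const 2)
      (Eventually.of_forall fun y => by simp)]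
  refine MeasureTheory.integral_congr_ae (Eventually.of_forall fun y => ?_)
  simp only [ENNReal.toReal_pow, toReal_enorm, Complex.real_smul]
  rw [mul_left_comm, mul_comm ((starRingEnd ℂ) (w y)), Complex.mul_conj', mul_comm]
  push_cast
  rfl

end Resolvent

end ProjectionValuedMeasure

/-! ### Existence of the joint spectral measure, and the theorem -/

namespace KatoSmooth

variable {V : Type*} [NormedAddCommGroup V] [InnerProductSpace ℂ V] [CompleteSpace V]
  {n : ℕ} {H : Fin n → V →ₗ.[ℂ] V}

/-- The spectral theorem for strongly commuting self-adjoint operators. -/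
theorem exists_isJointSpectralMeasure (hsa : ∀ j, IsSelfAdjoint (H j))
    (hcomm : StronglyCommuting H) : ∃ E, IsJointSpectralMeasure H E := by
  have hI : Complex.I.im ≠ 0 := by simp
  have hI' : ((starRingEnd ℂ) Complex.I).im ≠ 0 := by simp
  obtain ⟨Ψ, hΨ⟩ := exists_starAlgHom_polydisc (r := fun j => (H j).resolventOp Complex.I)
    (fun j => by simpa using LinearPMap.norm_resolventOp_le (hsa j) hI)
    (fun i j => hcomm i j _ _ hI hI)
    (fun i j => by
      rw [ContinuousLinearMap.star_eq_adjoint, LinearPMap.adjoint_resolventOp (hsa j) hI]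
      exact hcomm i j _ _ hI hI')
  set F := StarHomMeasure.projectionValuedMeasure Ψ
  have hw : ∀ j : Fin n, BoundedMeasurable (Polydisc.coord j) := fun j =>
    StarHomMeasure.boundedMeasurable_continuous _
  have hwA : ∀ j, F.integral (Polydisc.coord j) = (H j).resolventOp Complex.I := fun j => by
    rw [StarHomMeasure.integral_projectionValuedMeasure, hΨ]
  have hF : F.proj Set.univ = 1 := by
    rw [← F.integral_indicator_one MeasurableSet.univ, Set.indicator_univ]
    have := StarHomMeasure.integral_projectionValuedMeasure Ψ 1
    rw [map_one] at this
    exact this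
  -- This inverts `w = (x - i)⁻¹` coordinatewise. Where a coordinate vanishes the value is `0` by
  -- convention, on a set that is null for every scalar measure.
  let κ : Polydisc n → Fin n → ℝ := fun y j => ((Polydisc.coord j y)⁻¹).re
  have hκj : ∀ j, Measurable fun y => κ y j := fun j =>
    Complex.measurable_re.comp (hw j).measurable.inv
  have hκ : Measurable κ := measurable_pi_lambda _ hκj
  refine ⟨F.map hκ, hF, fun j f => ?_, fun j u => ?_⟩
  · rw [F.scalarMeasure_map, lintegral_map ((measurable_pi_apply j).enorm.pow_const 2) hκ]
    exact ⟨fun hf => ProjectionValuedMeasure.lintegral_lt_top_of_mem_domain (hsa j) (hw j) (hwA j)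
        ⟨f, hf⟩,
      ProjectionValuedMeasure.mem_domain_of_lintegral_lt_top hF (hsa j) (hw j) (hwA j)⟩
  · rw [F.scalarMeasure_map, integral_map hκ.aemeasurable
      (measurable_pi_apply j).aestronglyMeasurable]
    exact ProjectionValuedMeasure.inner_apply_eq_integral hF (hsa j) (hw j) (hwA j) u

theorem isJointSpectralMeasure_jointSpectralMeasure (hsa : ∀ j, IsSelfAdjoint (H j))
    (hcomm : StronglyCommuting H) : IsJointSpectralMeasure H (jointSpectralMeasure H) := by
  have h := exists_isJointSpectralMeasure hsa hcomm
  rw [jointSpectralMeasure, dif_pos h]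
  exact h.choose_spec

end KatoSmooth

theorem mainTheorem7 {V : Type*} [NormedAddCommGroup V] [InnerProductSpace ℂ V] [CompleteSpace V]
    {G : Type*} [NormedAddCommGroup G] [InnerProductSpace ℂ G] [CompleteSpace G]
    (n : ℕ) (H : Fin n → V →ₗ.[ℂ] V) (hsa : ∀ j, IsSelfAdjoint (H j))
    (hcomm : KatoSmooth.StronglyCommuting H)
    (J : Set (Fin n → ℝ)) (hJ : IsOpen J)
    (T : KatoSmooth.jointDomain H →ₗ[ℂ] G) (hT : KatoSmooth.GraphContinuous H T) :
    (KatoSmooth.KatoCondition H T J → KatoSmooth.LocallySmooth H T J) ∧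
    ((∀ j, KatoSmooth.RelativelyBounded H T j) →
      (KatoSmooth.LocallySmooth H T J ↔ KatoSmooth.KatoCondition H T J)) := by
  have hE := KatoSmooth.isJointSpectralMeasure_jointSpectralMeasure hsa hcomm
  refine ⟨fun hK => (KatoSmooth.LocallyBoundedDensity.of_katoCondition hE hK).locallySmooth hE hT,
    fun hrel => ⟨fun hs => ?_, fun hK => ?_⟩⟩
  · exact (KatoSmooth.LocallyBoundedDensity.of_locallySmooth hE hT hs).katoCondition hE hT hJ hrel
  · exact (KatoSmooth.LocallyBoundedDensity.of_katoCondition hE hK).locallySmooth hE hT
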